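/- **Conventions.** Circuits have fan-in two; the size of a circuit is its number of gates. A Boolean function $f_n:\{0,1\}^n\to\{0,1\}$ is $\gamma$-approximated by a circuit $C$ if $\Pr_x[C(x)=f_n(x)]\ge\gamma$. $\mathsf E$ is the class of Boolean functions computable in time $2^{O(n)}$. EF is the Extended Frege system over an arbitrary Frege system (a finite set of schematic rules that is sound and implicationally complete), and the size of a proof is its number of symbols. Circuits are turned into propositional formulas in the standard way, with auxiliary variables for the gates. **The formulas.** Let $0<\epsilon<1$, let $f\in\mathsf E$, and let $k,c$ be constants. - $\mathsf{tt}(f_n,2^{\epsilon n},1/2-1/2^{\epsilon n})$ is the formula, with the truth table of $f_n$ hard-wired and with free variables for a circuit, saying that each circuit of size $\lfloor 2^{\epsilon n}\rfloor$ with $n$ inputs fails to compute $f_n$ on at least a $(1/2-1/2^{\epsilon n})$-fraction of all inputs. - $NW_f:\{0,1\}^{c'\lceil\log n\rceil}\to\{0,1\}^n$ is the Nisan–Wigderson generator with base function $f_m$, $m=c\lceil\log n\rceil$, and with a greedily constructed design of $n$ subsets of size $m$ of a set of size $c'\lceil\log n\rceil=Qm$, where $Q=2^{\lceil 4/\epsilon\rceil}$,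 any two of which meet in at most $\epsilon m/2$ points. - Let $q\in(2^{n-1},2^n]$ be a prime and $g$ a generator of $G=\mathbb Z_q^\times$. For a circuit $C$ with $n$ inputs and $n$ outputs put $C'(b,r)=C(bg^r)-r \bmod (q-1)$. The formula $\mathsf{self}_n(p,b,C)=\mathsf{self}_n^{q,g}(p,b,C)$, with free variables for an $n^k$-size circuit $C$, an $n$-bit string $b$ and an $n$-bit number $P$, where $p=P/2^n$, says: if $\Pr_z[x\in G\wedge g^{C(x)}=x \text{ for } x=NW_f(z)]\ge p$, then, if $b\in G$, $\Pr_z[r\in\{1,\dots,q-1\}\wedge g^{C'(b,r)}=b \text{ for } r=NW_f(z)]\ge \frac p2-\frac3{2n}$; here $z$ ranges over $\{0,1\}^{c'\lceil\log n\rceil}$. **The proof system.** $P_\epsilon=P_{\epsilon,f,k,c,n_0}$ is EF that in addition may derive, in a single step, any substitution instance of $\mathsf{tt}(f_n,2^{\epsilon n},1/2-1/2^{\epsilon n})$ and of $\mathsf{self}^{q,g}_n(p,b,C)$, for all $n\ge n_0$; each use of $\mathsf{self}_n^{q,g}$ is accompanied by a Pratt certificate (counted in the size of the proof) that $q$ is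 a prime and that $g$ generates $\mathbb Z_q^\times$. **Theorem (self-provability for the discrete logarithm).** Let $k$ be a constant. Assume that for some $0<\epsilon<1$ we have a Boolean function $f\in\mathsf E$ such that for each sufficiently big $n$, $f_n$ is not $(1/2+1/2^{\epsilon n})$-approximable by any circuit of size at most $2^{\epsilon n}$. Then for every sufficiently big constant $c$ and every sufficiently big $n_0$ (depending on $c$): 1. $P_\epsilon$ is a sound and complete propositional proof system: a formula has a $P_\epsilon$-proof if and only if it is a tautology. 2. There is a constant $e$ such that for every $n$, every prime $q\in(2^{n-1},2^n]$ and every generator $g$ of $\mathbb Z_q^\times$: if there is a circuit of size at most $n^k$ that solves the discrete logarithm problem in $\mathbb Z_q^\times$ to the base $g$ (i.e. finds, for each $b$, an $n$-bit $a$ with $g^a=b$), then there is a circuit $D$ of size at most $e\,n^e$ such that $P_\epsilon$ has a proof of size at most $e\,n^e$ of the propositional formula with free variables $b$ that encodes "$b\in\mathbb Z_q^\times\rightarrow g^{D(b)}=b$". -/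

import Mathlib

namespace SelfProv

/-! ## Bit strings (least significant bit first) -/

/-- The `n` lowest bits of `x`. -/
def bits (n x : ℕ) : List Bool := (List.range n).map x.testBit

/-- The number with the given bits. -/
def ofBits : List Bool → ℕ
  | [] => 0
  | b :: bs => b.toNat + 2 * ofBits bs

/-! ## Boolean circuits of fan-in two

The wires of a circuit with `n` inputs are numbered: `0, …, n - 1` are the inputs, `n + i` is the
output of the `i`-th gate. -/

/-- A gate computes an arbitrary binary Boolean function of two earlier wires. -/
structure Gate where
  op : Bool → Bool → Bool
  left : ℕ
  right : ℕ

structure Circuit where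
  gates : List Gate
  outs : List ℕ

/-- The value of a gate, given the values of the earlier wires. -/
def Gate.eval (g : Gate) (ws : List Bool) : Bool :=
  g.op (ws.getD g.left false) (ws.getD g.right false)

/-- The values of all wires, starting from the values `ws` of the wires that precede the gates. -/
def runGates : List Gate → List Bool → List Bool
  | [], ws => ws
  | g :: gs, ws => runGates gs (ws ++ [g.eval ws])

/-- The output of a circuit. -/
def Circuit.eval (C : Circuit) (x : List Bool) : List Bool :=
  C.outs.map fun i => (runGates C.gates x).getD i false

/-- The size of a circuit is its number of gates. -/
def Circuit.size (C : Circuit) : ℕ := C.gates.length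

/-- `C` is a circuit with `n` inputs and `o` outputs: every gate reads earlier wires only. -/
def Circuit.WF (C : Circuit) (n o : ℕ) : Prop :=
  (∀ (i : ℕ) (h : i < C.gates.length), (C.gates[i]).left < n + i ∧ (C.gates[i]).right < n + i) ∧
  C.outs.length = o ∧ ∀ j ∈ C.outs, j < n + C.gates.length

/-- `C` `γ`-approximates `f` on inputs of length `n`: `Pr_x[C(x) = f(x)] ≥ γ`. -/
def Circuit.Approximates (C : Circuit) (f : List Bool → Bool) (n : ℕ) (γ : ℝ) : Prop :=
  γ ≤ ((Finset.univ.filter fun x : Fin n → Bool =>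
    C.eval (List.ofFn x) = [f (List.ofFn x)]).card : ℝ) / 2 ^ n

/-- The class `E`: Boolean functions computable by a Turing machine in time `2 ^ O(n)`. -/
def InE (f : List Bool → Bool) : Prop :=
  ∃ M : Turing.TM2ComputableInTime (id : List Bool → List Bool) Computability.encodeBool f,
    ∃ c : ℕ, ∀ n, M.time n ≤ 2 ^ (c * (n + 1))

/-- For each sufficiently big `n`, `f` is not `(1/2 + 1/2^(ε n))`-approximable by any circuit of
size at most `2^(ε n)`. -/
def HardOnAverage (ε : ℝ) (f : List Bool → Bool) : Prop :=
  ∀ᶠ n : ℕ in Filter.atTop, ∀ C : Circuit, C.WF n 1 → (C.size : ℝ) ≤ 2 ^ (ε * n) →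
    ¬ C.Approximates f n (1 / 2 + 1 / 2 ^ (ε * n))

/-! ## Propositional formulas -/

inductive Formula where
  | var (i : ℕ)
  | bot
  | top
  | neg (A : Formula)
  | and (A B : Formula)
  | or (A B : Formula)
  | imp (A B : Formula)

namespace Formula

def eval (v : ℕ → Bool) : Formula → Bool
  | var i => v i
  | bot => false
  | top => true
  | neg A => !A.eval v
  | and A B => A.eval v && B.eval v
  | or A B => A.eval v || B.eval v
  | imp A B => !A.eval v || B.eval v

def Tautology (A : Formula) : Prop := ∀ v, A.eval v = true

/-- The size of a formula is its number of symbols. -/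
def size : Formula → ℕ
  | var _ => 1
  | bot => 1
  | top => 1
  | neg A => A.size + 1
  | and A B => A.size + B.size + 1
  | or A B => A.size + B.size + 1
  | imp A B => A.size + B.size + 1

def subst (σ : ℕ → Formula) : Formula → Formula
  | var i => σ i
  | bot => bot
  | top => top
  | neg A => neg (A.subst σ)
  | and A B => and (A.subst σ) (B.subst σ)
  | or A B => or (A.subst σ) (B.subst σ)
  | imp A B => imp (A.subst σ) (B.subst σ)

/-- The set of variables that occur in a formula. -/
def vars : Formula → Set ℕ
  | var i => {i}
  | bot => ∅
  | top => ∅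
  | neg A => A.vars
  | and A B => A.vars ∪ B.vars
  | or A B => A.vars ∪ B.vars
  | imp A B => A.vars ∪ B.vars

def iff (A B : Formula) : Formula := and (imp A B) (imp B A)

def bigAnd : List Formula → Formula
  | [] => top
  | A :: As => and A (bigAnd As)

def bigOr : List Formula → Formula
  | [] => bot
  | A :: As => or A (bigOr As)

/-- The literal `A` or `¬A`. -/
def lit (A : Formula) (b : Bool) : Formula := if b then A else neg A

/-- The formula `op(A, B)` in disjunctive normal form. -/
def ofOp (op : Bool → Bool → Bool) (A B : Formula) : Formula :=
  bigOr (([(false, false), (false, true), (true, false), (true, true)].filter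
    fun u => op u.1 u.2).map fun u => and (lit A u.1) (lit B u.2))

end Formula

/-! ## Frege systems -/

/-- A schematic inference rule; its variables stand for arbitrary formulas. -/
structure FregeRule where
  prems : List Formula
  concl : Formula

/-- Derivability from the hypotheses `Γ` by substitution instances of the rules in `R`. -/
inductive Derives (R : List FregeRule) (Γ : List Formula) : Formula → Prop where
  | hyp {A : Formula} (h : A ∈ Γ) : Derives R Γ A
  | rule (r : FregeRule) (hr : r ∈ R) (σ : ℕ → Formula)
      (h : ∀ A ∈ r.prems, Derives R Γ (A.subst σ)) : Derives R Γ (r.concl.subst σ)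

/-- A Frege system in the sense of Cook and Reckhow: a finite set of schematic rules that are sound
and implicationally complete. -/
structure FregeSystem where
  rules : List FregeRule
  sound : ∀ r ∈ rules, ∀ v : ℕ → Bool,
    (∀ A ∈ r.prems, A.eval v = true) → r.concl.eval v = true
  complete : ∀ (Γ : List Formula) (B : Formula),
    (∀ v : ℕ → Bool, (∀ A ∈ Γ, A.eval v = true) → B.eval v = true) → Derives rules Γ B

/-! ## Building circuits gate by gate -/

/-- A circuit under construction: the number of inputs and the gates so far. -/
structure Netlist where
  inputs : ℕ
  gates : List Gate

abbrev Wire := ℕ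

abbrev Build (α : Type) := StateM Netlist α

/-- Add a gate and return its output wire. -/
def emit (op : Bool → Bool → Bool) (a b : Wire) : Build Wire := fun s =>
  (s.inputs + s.gates.length, { s with gates := s.gates ++ [⟨op, a, b⟩] })

def const (b : Bool) : Build Wire := emit (fun _ _ => b) 0 0

def bnot (a : Wire) : Build Wire := emit (fun x _ => !x) a a

def band (a b : Wire) : Build Wire := emit (fun x y => x && y) a b

def bor (a b : Wire) : Build Wire := emit (fun x y => x || y) a b

def bxor (a b : Wire) : Build Wire := emit (fun x y => xor x y) a b

def bxnor (a b : Wire) : Build Wire := emit (fun x y => !(xor x y)) a b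

/-- If `s` then `a` else `b`. -/
def mux (s a b : Wire) : Build Wire := do
  let x ← band s a
  let y ← emit (fun s b => !s && b) s b
  bor x y

def allOf : List Wire → Build Wire
  | [] => const true
  | a :: as => do
    let r ← allOf as
    band a r

def anyOf : List Wire → Build Wire
  | [] => const false
  | a :: as => do
    let r ← anyOf as
    bor a r

/-- Constant wires for a list of bits. -/
def constList : List Bool → Build (List Wire)
  | [] => pure []
  | b :: bs => do
    let c ← const b
    let r ← constList bs
    pure (c :: r)

/-- Constant wires for the `n` lowest bits of the number `x`. -/
def constBits (n x : ℕ) : Build (List Wire) := constList (bits n x)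

def muxList (s : Wire) : List Wire → List Wire → Build (List Wire)
  | a :: as, b :: bs => do
    let c ← mux s a b
    let r ← muxList s as bs
    pure (c :: r)
  | _, _ => pure []

def notList : List Wire → Build (List Wire)
  | [] => pure []
  | a :: as => do
    let c ← bnot a
    let r ← notList as
    pure (c :: r)

/-- Equality of two numbers of the same length. -/
def eqList : List Wire → List Wire → Build Wire
  | a :: as, b :: bs => do
    let c ← bxnor a b
    let r ← eqList as bs
    band c r
  | _, _ => const true

/-- Ripple-carry addition of two numbers of the same length; returns the sum and the carry. -/
def addCarry : List Wire → List Wire → Wire → Build (List Wire × Wire)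
  | a :: as, b :: bs, c => do
    let x ← bxor a b
    let s ← bxor x c
    let y ← band a b
    let z ← band x c
    let c' ← bor y z
    let r ← addCarry as bs c'
    pure (s :: r.1, r.2)
  | _, _, c => pure ([], c)

/-- Addition of two numbers of the same length `w`, modulo `2 ^ w`. -/
def add (x y : List Wire) : Build (List Wire) := do
  let c ← const false
  let r ← addCarry x y c
  pure r.1

/-- Subtraction of two numbers of the same length `w`, modulo `2 ^ w`; the second component tells
whether `y ≤ x`. -/
def sub (x y : List Wire) : Build (List Wire × Wire) := do
  let y' ← notList y
  let c ← const true
  addCarry x y' c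

/-- Whether `y ≤ x`, for two numbers of the same length. -/
def geq (x y : List Wire) : Build Wire := do
  let r ← sub x y
  pure r.2

/-- `x - m` if `m ≤ x`, and `x` otherwise. -/
def condSub (m : ℕ) (x : List Wire) : Build (List Wire) := do
  let c ← constBits x.length m
  let r ← sub x c
  muxList r.2 r.1 x

/-- `x * m` modulo `2 ^ w`, for a constant `m`. -/
def mulConst (w m : ℕ) : List Wire → Build (List Wire)
  | [] => constBits w 0
  | x :: xs => do
    let acc ← mulConst w m xs
    let z ← const false
    let zs ← constBits w 0
    let c ← constBits w m
    let t ← muxList x c zs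
    add ((z :: acc).take w) t

/-- The number of true wires in a list, as a `w`-bit number. -/
def count (w : ℕ) : List Wire → Build (List Wire)
  | [] => constBits w 0
  | b :: bs => do
    let acc ← count w bs
    let zs ← constBits w 0
    let r ← addCarry acc zs b
    pure r.1

/-! ### Arithmetic modulo `q`, where `q ≤ 2 ^ n`, on `n`-bit numbers -/

/-- `x + y mod q`, for `x, y < q`. -/
def addMod (n q : ℕ) (x y : List Wire) : Build (List Wire) := do
  let z ← const false
  let s ← add (x ++ [z]) (y ++ [z])
  let r ← condSub q s
  pure (r.take n)

/-- `x * y mod q`, for `x, y < q`. -/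
def mulMod (n q : ℕ) (x : List Wire) : List Wire → Build (List Wire)
  | [] => constBits n 0
  | b :: bs => do
    let acc ← mulMod n q x bs
    let dbl ← addMod n q acc acc
    let s ← addMod n q dbl x
    muxList b s dbl

/-- `g ^ e mod q`, for a constant `g < q`. -/
def powMod (n q g : ℕ) : List Wire → Build (List Wire)
  | [] => constBits n 1
  | b :: bs => do
    let acc ← powMod n q g bs
    let sq ← mulMod n q acc acc
    let c ← constBits n g
    let t ← mulMod n q sq c
    muxList b t sq

/-- Whether `0 < x < q`, i.e. whether the `n`-bit string `x` is an element of `ℤ_q^×`. -/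
def inGroup (n q : ℕ) (x : List Wire) : Build Wire := do
  let nz ← anyOf x
  let z ← const false
  let c ← constBits (n + 1) q
  let ge ← geq (x ++ [z]) c
  let lt ← bnot ge
  band nz lt

/-- `l - r mod (q - 1)`, for `n`-bit numbers `l < 2 * (q - 1)` and `1 ≤ r ≤ q - 1`. -/
def subExp (n q : ℕ) (l r : List Wire) : Build (List Wire) := do
  let z ← const false
  let l' ← condSub (q - 1) (l ++ [z])
  let c ← constBits (n + 1) (q - 1)
  let r' ← sub c (r ++ [z])
  let s ← add l' r'.1
  let t ← condSub (q - 1) s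
  pure (t.take n)

/-! ### Evaluation of a circuit that is given by its description

A circuit with `n` inputs, `s` gates and `o` outputs is described by a bit string. Each gate takes
four bits for the truth table of its operation and two pointers to earlier wires; then follow `o`
pointers to the output wires. A pointer has `Nat.size (n + s)` bits; a pointer that does not point
to an existing wire is read as a pointer to wire `0`. -/

/-- The length of the description. -/
def descLen (n s o : ℕ) : ℕ := s * (4 + 2 * Nat.size (n + s)) + o * Nat.size (n + s)

/-- Go through the wires `ws`, the first of which has number `j`, and return the one that `ptr`
points to, or `acc` if there is none. -/
def selectFrom (ptr : List Wire) : ℕ → List Wire → Wire → Build Wire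
  | _, [], acc => pure acc
  | j, a :: as, acc => do
    let c ← constBits ptr.length j
    let e ← eqList ptr c
    let acc' ← mux e a acc
    selectFrom ptr (j + 1) as acc'

def select (ws ptr : List Wire) : Build Wire := selectFrom ptr 0 ws (ws.headD 0)

/-- The value at `(a, b)` of the binary operation with truth table `tt`. -/
def applyTable (tt : List Wire) (a b : Wire) : Build Wire := do
  let x ← mux b (tt.getD 1 0) (tt.getD 0 0)
  let y ← mux b (tt.getD 3 0) (tt.getD 2 0)
  mux a y x

/-- Evaluate the `s` gates described by `desc`; returns the list of all wires. -/
def evalGates (w : ℕ) : ℕ → List Wire → List Wire → Build (List Wire)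
  | 0, _, ws => pure ws
  | s + 1, desc, ws => do
    let a ← select ws ((desc.drop 4).take w)
    let b ← select ws ((desc.drop (4 + w)).take w)
    let v ← applyTable (desc.take 4) a b
    evalGates w s (desc.drop (4 + 2 * w)) (ws ++ [v])

def evalOuts (w : ℕ) (ws : List Wire) : ℕ → List Wire → Build (List Wire)
  | 0, _ => pure []
  | o + 1, desc => do
    let v ← select ws (desc.take w)
    let r ← evalOuts w ws o (desc.drop w)
    pure (v :: r)

/-- The output on input `x` of the circuit described by `desc`. -/
def evalDesc (n s o : ℕ) (desc x : List Wire) : Build (List Wire) := do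
  let w := Nat.size (n + s)
  let ws ← evalGates w s desc x
  evalOuts w ws o (desc.drop (s * (4 + 2 * w)))

/-! ### From circuits to formulas -/

/-- Run a construction on `N` inputs; the result is the formula saying that its output wire is true.
The variable `i` stands for the wire `i`; so the variables from `N` on are auxiliary, and they are
defined by the premise of the formula. -/
def toFormula (N : ℕ) (m : Build Wire) : Formula :=
  let r := m.run ⟨N, []⟩
  Formula.imp
    (Formula.bigAnd (r.2.gates.mapIdx fun i g =>
      Formula.iff (Formula.var (N + i))
        (Formula.ofOp g.op (Formula.var g.left) (Formula.var g.right))))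
    (Formula.var r.1)

/-! ## Average-case hardness as a formula -/

/-- "Every circuit of size `s` with `n` inputs fails to compute `f` on at least `t` inputs." The
truth table of `f` is hard-wired, the circuit is represented by free variables. -/
def ttFormula (f : List Bool → Bool) (n s t : ℕ) : Formula :=
  toFormula (descLen n s 1) do
    let desc := List.range (descLen n s 1)
    let errs ← (List.range (2 ^ n)).mapM fun y => do
      let x ← constBits n y
      let out ← evalDesc n s 1 desc x
      let c ← const (f (bits n y))
      bxor (out.headD 0) c
    let k ← count (n + 1) errs
    let c ← constBits (n + 1) t
    geq k c

/-- The hardness formula for size `2^(ε n)` and error `1/2 - 1/2^(ε n)`. -/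
noncomputable def ttAxiom (ε : ℝ) (f : List Bool → Bool) (n : ℕ) : Formula :=
  ttFormula f n ⌊(2 : ℝ) ^ (ε * n)⌋₊ ⌈(1 / 2 - 1 / 2 ^ (ε * n) : ℝ) * 2 ^ n⌉₊

/-! ## The Nisan–Wigderson generator -/

/-- The number of coordinates `j < m` at which the words with codes `x`, `y` agree; a number codes
the word in `{0, …, Q - 1}^m` that is given by its digits in base `Q`. -/
def agreement (Q m x y : ℕ) : ℕ :=
  ((List.range m).filter fun j => x / Q ^ j % Q = y / Q ^ j % Q).length

/-- A greedy list of `N` words in `{0, …, Q - 1}^m`, any two of which agree in at most `a`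
coordinates: each new word is the first one that fits. -/
def designWords (Q m a : ℕ) : ℕ → List ℕ
  | 0 => []
  | N + 1 =>
    let W := designWords Q m a N
    W ++ [((List.range (Q ^ m)).find? fun x => W.all fun y => agreement Q m x y ≤ a).getD 0]

/-- The combinatorial design: the `i`-th set is `{Q j + w_i(j) | j < m}`, a subset of size `m` of
`{0, …, Q m - 1}`, where `w_i` is the `i`-th word. It is listed in increasing order. -/
def designSets (Q m a N : ℕ) : List (List ℕ) :=
  (designWords Q m a N).map fun x => (List.range m).map fun j => Q * j + x / Q ^ j % Q

/-- The generator `NW_f` with `m`-bit base function `f`, seeds `z` of `Q m` bits and `n` output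
bits: the `i`-th output bit is the value of `f` on the restriction of `z` to the `i`-th set. -/
def nwGen (f : List Bool → Bool) (Q m a n z : ℕ) : List Bool :=
  (designSets Q m a n).map fun S => f (S.map z.testBit)

/-- The constant `c' / c''` relating the seed length to the input length of the base function. -/
noncomputable def nwRatio (ε : ℝ) : ℕ := 2 ^ ⌈4 / ε⌉₊

/-- All the outputs, over all seeds in `{0,1}^(c' ⌈log n⌉)`, of the generator with `n` output bits
whose base function is `f` on `c ⌈log n⌉` bits; here `c' = nwRatio ε * c`. -/
noncomputable def nwOutputs (ε : ℝ) (c : ℕ) (f : List Bool → Bool) (n : ℕ) : List (List Bool) :=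
  let m := c * Nat.clog 2 n
  (List.range (2 ^ (nwRatio ε * m))).map fun z => nwGen f (nwRatio ε) m ⌊ε * m / 2⌋₊ n z

/-! ## Discrete logarithm and its random self-reduction -/

/-- The test `b ∈ G ∧ g ^ C(b) = b`, for the circuit `C` with `s` gates described by `desc`. -/
def dlogTest (n q g s : ℕ) (desc b : List Wire) : Build Wire := do
  let l ← evalDesc n s n desc b
  let y ← powMod n q g l
  let e ← eqList y b
  let i ← inGroup n q b
  band i e

/-- The test `r ∈ [|G|] ∧ g ^ C'(b, r) = b`, where `C'(b, r) = C(b g ^ r) - r`. -/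
def reducedTest (n q g s : ℕ) (desc b r : List Wire) : Build Wire := do
  let t ← powMod n q g r
  let h ← mulMod n q b t
  let l ← evalDesc n s n desc h
  let a ← subExp n q l r
  let y ← powMod n q g a
  let e ← eqList y b
  let i ← inGroup n q r
  band i e

/-- For circuits `C` of size `s`, a list `xs` of `n`-bit strings and `p = P / 2 ^ n` with an `n`-bit
number `P`, the formula: "if `g ^ C(x) = x` for a `p`-fraction of all `x` in `xs`, then for each
`b ∈ G`, `g ^ C'(b, x) = b` for a `(p/2 - 3/(2n))`-fraction of all `x` in `xs`". The free variables
are `P`, `b` and the description of `C`, in this order. With `T = |xs|`, the two inequalities are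
written as `P T ≤ 2 ^ n k₁` and `P n T ≤ 2 n 2 ^ n k₂ + 3 * 2 ^ n T`. -/
def selfFormula (n q g s : ℕ) (xs : List (List Bool)) : Formula :=
  toFormula (2 * n + descLen n s n) do
    let P := List.range n
    let b := (List.range n).map (n + ·)
    let desc := (List.range (descLen n s n)).map (2 * n + ·)
    let T := xs.length
    let w := 2 * n + Nat.size T + 4
    let tests₁ ← xs.mapM fun x => do
      let x' ← constList x
      dlogTest n q g s desc x'
    let k₁ ← count w tests₁
    let lhs₁ ← mulConst w (2 ^ n) k₁
    let rhs₁ ← mulConst w T P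
    let prem ← geq lhs₁ rhs₁
    let bG ← inGroup n q b
    let tests₂ ← xs.mapM fun x => do
      let r ← constList x
      reducedTest n q g s desc b r
    let k₂ ← count w tests₂
    let u ← mulConst w (2 * n * 2 ^ n) k₂
    let v ← constBits w (3 * 2 ^ n * T)
    let lhs₂ ← add u v
    let rhs₂ ← mulConst w (n * T) P
    let concl ← geq lhs₂ rhs₂
    let hyp ← band prem bG
    emit (fun x y => !x || y) hyp concl

/-- The random self-reducibility of the discrete logarithm to the base `g` in `ℤ_q^×` for circuits
of size `n ^ k`, with the probabilities approximated by the generator. -/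
noncomputable def selfAxiom (ε : ℝ) (k c : ℕ) (f : List Bool → Bool) (n q g : ℕ) : Formula :=
  selfFormula n q g (n ^ k) (nwOutputs ε c f n)

/-- The formula `∀ b ∈ ℤ_q^×, g ^ D(b) = b`, where `b` is an `n`-bit string of free variables, and
the circuit `D` with `n` inputs is fixed. -/
def dlogFormula (n q g : ℕ) (D : Circuit) : Formula :=
  toFormula n do
    let b := List.range n
    modify fun s => { s with gates := s.gates ++ D.gates }
    let y ← powMod n q g D.outs
    let e ← eqList y b
    let i ← inGroup n q b
    emit (fun x y => !x || y) i e

/-- `C` solves the discrete logarithm problem in `ℤ_q^×` to the base `u`, where elements of the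
group and exponents are `n`-bit numbers. -/
def SolvesDlog (n q : ℕ) (u : (ZMod q)ˣ) (C : Circuit) : Prop :=
  ∀ b : (ZMod q)ˣ, u ^ ofBits (C.eval (bits n (b : ZMod q).val)) = b

/-! ## The proof system -/

/-- The claim that `q` is a prime and `g` generates `ℤ_q^×`, with the prime factors of `q - 1`,
repeated according to their multiplicity. -/
structure CertEntry where
  q : ℕ
  g : ℕ
  factors : List ℕ

/-- A Pratt certificate: a list of claims, each of which is verified using the later ones. -/
abbrev Cert := List CertEntry

def CertEntry.Checks (e : CertEntry) : Prop :=
  1 < e.q ∧ e.g < e.q ∧ e.factors.prod = e.q - 1 ∧ e.g ^ (e.q - 1) % e.q = 1 ∧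
    ∀ p ∈ e.factors, e.g ^ ((e.q - 1) / p) % e.q ≠ 1

def Cert.Valid : Cert → Prop
  | [] => True
  | e :: es => e.Checks ∧ (∀ p ∈ e.factors, ∃ e' ∈ es, e'.q = p) ∧ Cert.Valid es

/-- The certificate is valid and its first claim is about `q` and `g`. -/
def Cert.Certifies (π : Cert) (q g : ℕ) : Prop :=
  Cert.Valid π ∧ ∃ e es, π = e :: es ∧ e.q = q ∧ e.g = g

def Cert.size (π : Cert) : ℕ :=
  (π.map fun e => 1 + Nat.size e.q + Nat.size e.g + (e.factors.map fun p => 1 + Nat.size p).sum).sum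

/-- The justification of a line of a proof. -/
inductive Just where
  | rule
  | ext (p : ℕ) (A : Formula)
  | tt (n : ℕ)
  | self (n q g : ℕ) (π : Cert)

structure Line where
  formula : Formula
  just : Just

/-- The data that a proof system `P_ε` depends on: a Frege system, the constant `ε`, the function
`f`, the exponent `k`, the constant `c` determining the input length `c ⌈log n⌉` of the base function
of the generator, and the bound `n₀` from which on the axioms are available. -/
structure PSystem where
  frege : FregeSystem
  ε : ℝ
  f : List Bool → Bool
  k : ℕ
  c : ℕ
  n₀ : ℕ

/-- A line is correct, if the formulas `prev` have been derived before, in a proof of `goal`: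
it follows by a Frege rule; or it is an extension axiom `p ↔ A` with a new variable `p`; or it is a
substitution instance of a hardness axiom or of a self-reducibility axiom. -/
def Line.Correct (S : PSystem) (goal : Formula) (prev : List Formula) (l : Line) : Prop :=
  match l.just with
  | .rule => ∃ r ∈ S.frege.rules, ∃ σ : ℕ → Formula,
      (∀ A ∈ r.prems, A.subst σ ∈ prev) ∧ l.formula = r.concl.subst σ
  | .ext p A => l.formula = Formula.iff (Formula.var p) A ∧
      p ∉ A.vars ∧ (∀ B ∈ prev, p ∉ B.vars) ∧ p ∉ goal.vars
  | .tt n => S.n₀ ≤ n ∧ ∃ σ : ℕ → Formula, l.formula = (ttAxiom S.ε S.f n).subst σ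
  | .self n q g π => S.n₀ ≤ n ∧ 2 ^ (n - 1) < q ∧ q ≤ 2 ^ n ∧ π.Certifies q g ∧
      ∃ σ : ℕ → Formula, l.formula = (selfAxiom S.ε S.k S.c S.f n q g).subst σ

/-- `π` is a proof of `A` in the system `S`. -/
def PSystem.IsProof (S : PSystem) (π : List Line) (A : Formula) : Prop :=
  (∀ (i : ℕ) (h : i < π.length),
    (π[i]).Correct S A ((π.take i).map Line.formula)) ∧
  (π.map Line.formula).getLast? = some A

def Line.size (l : Line) : ℕ :=
  l.formula.size + match l.just with
    | .self _ _ _ π => Cert.size π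
    | _ => 0

/-- The size of a proof is its total number of symbols, including the certificates. -/
def proofSize (π : List Line) : ℕ := (π.map Line.size).sum

end SelfProv

/-!
The proof has three ingredients: the Nisan–Wigderson generator fools small tests, which makes the
additional axioms tautologies; a Frege system derives tautologies, in particular schematic rules at
linear cost; and the circuit `D` evaluates an instance of `selfFormula` literally, so that the formula
about `D` follows from that instance by constant propagation.

**Soundness and completeness.** If `f` is hard on average, then a circuit that approximates `f` better
than `ttAxiom` permits does not exist, so these axioms are tautologies (`ttAxiom_tautology`). By the
hybrid argument, a test that distinguishes the outputs of the generator from random strings yields a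
circuit that predicts `f_m` for `m = c ⌈log n⌉` (`nw_fools`). For large `c`, tests of the size needed
for `C` and for its self-reduction are polynomial in `2 ^ ⌈log n⌉` and thus small compared to
`2 ^ (ε m)`, whence they are fooled up to an error of `1 / n` (`exists_fools`). On truly random strings,
the self-reduction `C'(b, r) = C(b g ^ r) - r` succeeds at least as often as `C`, as `r ↦ b g ^ r` is
onto (`IsGen.count_le`). Hence `selfFormula_tautology`, which even leaves some room. A Pratt certificate
is sound, so `selfAxiom` is used for primes and generators only. Extension axioms are
harmless since their variable is new (`PSystem.IsProof.tautology`). Completeness is that of the Frege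
system.

**Short proofs for the discrete logarithm.** Let `C` with description `δ` solve the problem. The circuit
`D` tries out all the exponents `C'(b, r)`, where `r` ranges over the polynomially many outputs of the
generator, and returns the first one that passes the test `g ^ C'(b, r) = b`. It does so by evaluating
all gates of `selfFormula` for `δ` and `P = 2 ^ (n - 2)`, i.e. `p = 1 / 4`; so the gates of this instance
of the formula are among the gates of `D`. In the proof of the formula about `D`, there are two cases.
If a test succeeds, then `D` returns the exponent tried in the first successful test, and the formula
evaluates `g ^ D(b) = b` by the same circuit as that test. If all tests fail, then the premise and the
conclusion of the instance have constant values. They do not depend on `b` otherwise, and are the same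
as for `b = 0`, when no test can succeed. The premise is true by `Fools.quarter`, as `C` is correct and
the generator fools its test; it is a statement without free variables, so a proof system can verify
it by evaluating gates. The conclusion is false as `p / 2 - 3 / (2 n) > 0`. Hence the instance gives
`b ∉ ℤ_q^×`. This is `exists_derivation`.

**Sizes.** The derivation is not written down symbol by symbol. All formulas that it needs are
implications from one of few contexts to one of few conclusions (`Arena`), each follows from others
by a schematic rule of bounded size, whose instances cost linearly many symbols (`Logic`), and a
finite set of formulas closed under such steps has a derivation in which each formula occurs once
(`Reach.drv`). Transport of equivalences and of constants along a circuit is obtained from a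
parametricity principle for circuit constructions (`Par`, `Closed`). Certificates of primality have
polynomial size (`IsGen.exists_small_cert`). The finitely many `n < n₀` are covered by completeness.
-/

namespace SelfProv

/-! ### Bits of numbers -/

@[simp] theorem length_bits (n x : ℕ) : (bits n x).length = n := by simp [bits]

theorem bits_succ (n x : ℕ) : bits (n + 1) x = x.testBit 0 :: bits n (x / 2) := by
  simp only [bits, List.range_succ_eq_map, List.map_cons, List.map_map]
  congr 1
  apply List.map_congr_left
  intro i _
  simp [Nat.testBit_succ]

theorem ofBits_bits (n x : ℕ) : ofBits (bits n x) = x % 2 ^ n := by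
  induction n generalizing x with
  | zero => simp [bits, ofBits, Nat.mod_one]
  | succ n ih =>
    rw [bits_succ, ofBits, ih, pow_succ', Nat.mod_mul]
    simp [Nat.testBit_zero]
    rcases Nat.mod_two_eq_zero_or_one x with h | h <;> simp [h]

theorem ofBits_lt (l : List Bool) : ofBits l < 2 ^ l.length := by
  induction l with
  | nil => simp [ofBits]
  | cons b l ih =>
    have := Bool.toNat_le b
    simp only [ofBits, List.length_cons, pow_succ]
    omega

theorem bits_ofBits (l : List Bool) : bits l.length (ofBits l) = l := by
  induction l with
  | nil => simp [bits]
  | cons b l ih =>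
    rw [List.length_cons, bits_succ, ofBits]
    have h : (b.toNat + 2 * ofBits l) / 2 = ofBits l := by
      have := Bool.toNat_le b
      omega
    rw [h, ih]
    congr 1
    cases b <;> simp [Nat.testBit_zero]

theorem ofBits_append (l l' : List Bool) :
    ofBits (l ++ l') = ofBits l + 2 ^ l.length * ofBits l' := by
  induction l with
  | nil => simp [ofBits]
  | cons b l ih => simp only [List.cons_append, ofBits, ih, List.length_cons, pow_succ]; ring

theorem ofBits_append_false (l : List Bool) : ofBits (l ++ [false]) = ofBits l := by
  simp [ofBits_append, ofBits]

theorem ofBits_take (l : List Bool) (n : ℕ) (h : n ≤ l.length) :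
    ofBits (l.take n) = ofBits l % 2 ^ n := by
  conv_rhs => rw [← List.take_append_drop n l, ofBits_append]
  have := ofBits_lt (l.take n)
  simp only [List.length_take, Nat.min_eq_left h] at this ⊢
  rw [Nat.add_mul_mod_self_left, Nat.mod_eq_of_lt this]

theorem testBit_ofBits (l : List Bool) (i : ℕ) : (ofBits l).testBit i = l.getD i false := by
  rcases lt_or_ge i l.length with h | h
  · have h1 : (bits l.length (ofBits l)).getD i false = l.getD i false := by rw [bits_ofBits]
    rw [← h1, bits]
    simp [h]
  · rw [Nat.testBit_lt_two_pow ((ofBits_lt l).trans_le (Nat.pow_le_pow_right two_pos h))]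
    simp [h]

/-! ### Netlists and runs of builders -/

/-- The gate with output wire `p` is `g`. -/
def Netlist.Has (s : Netlist) (p : ℕ) (g : Gate) : Prop :=
  ∃ i, s.gates[i]? = some g ∧ p = s.inputs + i

/-- `t` arises from `s` by adding gates at the end. -/
def Netlist.Le (s t : Netlist) : Prop := s.inputs = t.inputs ∧ s.gates <+: t.gates

/-- The number of wires. -/
def Netlist.width (s : Netlist) : ℕ := s.inputs + s.gates.length

theorem Netlist.Le.refl (s : Netlist) : s.Le s := ⟨rfl, List.prefix_rfl⟩

theorem Netlist.Le.trans {s t u : Netlist} (h : s.Le t) (h' : t.Le u) : s.Le u :=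
  ⟨h.1.trans h'.1, h.2.trans h'.2⟩

theorem Netlist.Le.has {s t : Netlist} (h : s.Le t) {p g} (hp : s.Has p g) : t.Has p g := by
  obtain ⟨i, hi, rfl⟩ := hp
  refine ⟨i, ?_, by rw [h.1]⟩
  obtain ⟨l, hl⟩ := h.2
  rw [← hl, List.getElem?_append_left (List.getElem?_eq_some_iff.1 hi).1, hi]

theorem Netlist.Le.width_le {s t : Netlist} (h : s.Le t) : s.width ≤ t.width := by
  unfold width
  rw [h.1]
  exact Nat.add_le_add_left h.2.length_le _

/-- The builder only adds gates to the netlist. -/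
class Mono {α : Type} (m : Build α) : Prop where
  le : ∀ s : Netlist, s.Le (m.run s).2

instance {α : Type} (a : α) : Mono (pure a : Build α) := ⟨fun s => Netlist.Le.refl s⟩

instance {α β : Type} (m : Build α) (f : α → Build β) [h : Mono m] [h' : ∀ a, Mono (f a)] :
    Mono (m >>= f) := ⟨fun s => (h.le s).trans ((h' _).le _)⟩

instance (op : Bool → Bool → Bool) (a b : Wire) : Mono (emit op a b) :=
  ⟨fun _ => ⟨rfl, List.prefix_append _ _⟩⟩

instance (b : Bool) : Mono (const b) := by unfold const; infer_instance
instance (a : Wire) : Mono (bnot a) := by unfold bnot; infer_instance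
instance (a b : Wire) : Mono (band a b) := by unfold band; infer_instance
instance (a b : Wire) : Mono (bor a b) := by unfold bor; infer_instance
instance (a b : Wire) : Mono (bxor a b) := by unfold bxor; infer_instance
instance (a b : Wire) : Mono (bxnor a b) := by unfold bxnor; infer_instance
instance (s a b : Wire) : Mono (mux s a b) := by unfold mux; infer_instance

instance (l : List Wire) : Mono (anyOf l) := by
  induction l with
  | nil => unfold anyOf; infer_instance
  | cons a l ih => unfold anyOf; infer_instance

instance (l : List Bool) : Mono (constList l) := by
  induction l with
  | nil => unfold constList; infer_instance
  | cons a l ih => unfold constList; infer_instance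

instance (n x : ℕ) : Mono (constBits n x) := by unfold constBits; infer_instance

instance (s : Wire) (l l' : List Wire) : Mono (muxList s l l') := by
  induction l generalizing l' with
  | nil => unfold muxList; infer_instance
  | cons a l ih => cases l' <;> unfold muxList <;> infer_instance

instance (l : List Wire) : Mono (notList l) := by
  induction l with
  | nil => unfold notList; infer_instance
  | cons a l ih => unfold notList; infer_instance

instance (l l' : List Wire) : Mono (eqList l l') := by
  induction l generalizing l' with
  | nil => unfold eqList; infer_instance
  | cons a l ih => cases l' <;> unfold eqList <;> infer_instance

instance (l l' : List Wire) (c : Wire) : Mono (addCarry l l' c) := by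
  induction l generalizing l' c with
  | nil => unfold addCarry; infer_instance
  | cons a l ih => cases l' <;> unfold addCarry <;> infer_instance

instance (x y : List Wire) : Mono (add x y) := by unfold add; infer_instance
instance (x y : List Wire) : Mono (sub x y) := by unfold sub; infer_instance
instance (x y : List Wire) : Mono (geq x y) := by unfold geq; infer_instance
instance (m : ℕ) (x : List Wire) : Mono (condSub m x) := by unfold condSub; infer_instance

instance (w m : ℕ) (l : List Wire) : Mono (mulConst w m l) := by
  induction l with
  | nil => unfold mulConst; infer_instance
  | cons a l ih => unfold mulConst; infer_instance

instance (w : ℕ) (l : List Wire) : Mono (count w l) := by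
  induction l with
  | nil => unfold count; infer_instance
  | cons a l ih => unfold count; infer_instance

instance (n q : ℕ) (x y : List Wire) : Mono (addMod n q x y) := by unfold addMod; infer_instance

instance (n q : ℕ) (x l : List Wire) : Mono (mulMod n q x l) := by
  induction l with
  | nil => unfold mulMod; infer_instance
  | cons a l ih => unfold mulMod; infer_instance

instance (n q g : ℕ) (l : List Wire) : Mono (powMod n q g l) := by
  induction l with
  | nil => unfold powMod; infer_instance
  | cons a l ih => unfold powMod; infer_instance

instance (n q : ℕ) (x : List Wire) : Mono (inGroup n q x) := by unfold inGroup; infer_instance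
instance (n q : ℕ) (x y : List Wire) : Mono (subExp n q x y) := by unfold subExp; infer_instance

instance (ptr : List Wire) (j : ℕ) (l : List Wire) (acc : Wire) :
    Mono (selectFrom ptr j l acc) := by
  induction l generalizing j acc with
  | nil => unfold selectFrom; infer_instance
  | cons a l ih => unfold selectFrom; infer_instance

instance (l l' : List Wire) : Mono (select l l') := by unfold select; infer_instance
instance (l : List Wire) (a b : Wire) : Mono (applyTable l a b) := by
  unfold applyTable; infer_instance

instance (w s : ℕ) (desc ws : List Wire) : Mono (evalGates w s desc ws) := by
  induction s generalizing desc ws with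
  | zero => unfold evalGates; infer_instance
  | succ s ih => unfold evalGates; infer_instance

instance (w o : ℕ) (desc ws : List Wire) : Mono (evalOuts w ws o desc) := by
  induction o generalizing desc with
  | zero => unfold evalOuts; infer_instance
  | succ s ih => unfold evalOuts; infer_instance

instance (n s o : ℕ) (desc x : List Wire) : Mono (evalDesc n s o desc x) := by
  unfold evalDesc; infer_instance

instance (n q g s : ℕ) (desc b : List Wire) : Mono (dlogTest n q g s desc b) := by
  unfold dlogTest; infer_instance

set_option synthInstance.maxSize 1000 in
instance (n q g s : ℕ) (desc b r : List Wire) : Mono (reducedTest n q g s desc b r) := by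
  unfold reducedTest; infer_instance

instance {α β : Type} (f : α → Build β) (l : List α) [h : ∀ a, Mono (f a)] : Mono (l.mapM f) := by
  induction l with
  | nil => rw [List.mapM_nil]; infer_instance
  | cons a l ih => rw [List.mapM_cons]; infer_instance

/-- Somewhere within the netlist `G`, the builder `m` was run and returned `a`. The netlist may have
been extended before and afterwards; so statements about `Runs G` hold for every part of a larger
construction, no matter where its wires are. -/
def Runs {α : Type} (G : Netlist) (m : Build α) (a : α) : Prop :=
  ∃ s : Netlist, (m.run s).1 = a ∧ (m.run s).2.Le G

theorem Runs.bind {α β : Type} {G : Netlist} {m : Build α} {f : α → Build β} {b : β}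
    [h' : ∀ a, Mono (f a)] (h : Runs G (m >>= f) b) : ∃ a, Runs G m a ∧ Runs G (f a) b := by
  obtain ⟨s, h1, h2⟩ := h
  exact ⟨_, ⟨s, rfl, ((h' _).le _).trans h2⟩, ⟨_, h1, h2⟩⟩

theorem Runs.pure {α : Type} {G : Netlist} {a b : α} (h : Runs G (pure a : Build α) b) :
    b = a := by
  obtain ⟨s, h1, _⟩ := h
  exact h1.symm

theorem Runs.emit {G : Netlist} {op : Bool → Bool → Bool} {a b p : Wire}
    (h : Runs G (emit op a b) p) : G.Has p ⟨op, a, b⟩ := by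
  obtain ⟨s, h1, h2⟩ := h
  refine h2.has ⟨s.gates.length, ?_, ?_⟩
  · show (s.gates ++ _)[_]? = _
    simp
  · exact h1.symm

theorem Runs.mapM {α β : Type} {G : Netlist} {f : α → Build β} [∀ a, Mono (f a)] {l : List α}
    {bs : List β} (h : Runs G (l.mapM f) bs) : List.Forall₂ (fun a b => Runs G (f a) b) l bs := by
  induction l generalizing bs with
  | nil => rw [List.mapM_nil] at h; rw [h.pure]; exact .nil
  | cons a l ih =>
    rw [List.mapM_cons] at h
    obtain ⟨b, hb, h⟩ := h.bind
    obtain ⟨bs', hbs, h⟩ := h.bind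
    rw [h.pure]
    exact .cons hb (ih hbs)

/-! ### Parametricity of builders -/

/-- Every output of `m` in `G` is related to every output of `m'` in `G'`, by `Q`. With `Closed`, this
is used in two ways: to propagate derivable equivalences between two copies of a circuit, and to
propagate derivable values of wires. -/
def Par {α β : Type} (G G' : Netlist) (m : Build α) (m' : Build β) (Q : α → β → Prop) : Prop :=
  ∀ a b, Runs G m a → Runs G' m' b → Q a b

/-- A relation between the wires of two netlists that is preserved by gates with the same operation;
the inputs of a gate do not matter if its operation is constant. -/
def Closed (R : ℕ → ℕ → Prop) (G G' : Netlist) : Prop :=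
  ∀ p p' op a b a' b', G.Has p ⟨op, a, b⟩ → G'.Has p' ⟨op, a', b'⟩ →
    ((∃ c, op = fun _ _ => c) ∨ (R a a' ∧ R b b')) → R p p'

variable {R : ℕ → ℕ → Prop} {G G' : Netlist}

theorem Par.bind {α β γ δ : Type} {m : Build α} {m' : Build β} {f : α → Build γ} {f' : β → Build δ}
    {Q : α → β → Prop} {Q' : γ → δ → Prop} [∀ a, Mono (f a)] [∀ a, Mono (f' a)]
    (h : Par G G' m m' Q) (h' : ∀ a b, Q a b → Par G G' (f a) (f' b) Q') :
    Par G G' (m >>= f) (m' >>= f') Q' := by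
  intro c d hc hd
  obtain ⟨a, ha, hc⟩ := hc.bind
  obtain ⟨b, hb, hd⟩ := hd.bind
  exact h' a b (h a b ha hb) c d hc hd

theorem Par.pure {α β : Type} {a : α} {b : β} {Q : α → β → Prop} (h : Q a b) :
    Par G G' (pure a : Build α) (pure b : Build β) Q := by
  intro c d hc hd
  rwa [hc.pure, hd.pure]

theorem Closed.emit (hR : Closed R G G') {op : Bool → Bool → Bool} {a b a' b' : Wire}
    (h : R a a') (h' : R b b') : Par G G' (emit op a b) (emit op a' b') R :=
  fun _ _ hc hd => hR _ _ _ _ _ _ _ hc.emit hd.emit (.inr ⟨h, h'⟩)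

theorem Closed.const (hR : Closed R G G') (b : Bool) : Par G G' (const b) (const b) R :=
  fun _ _ hc hd => hR _ _ _ _ _ _ _ hc.emit hd.emit (.inl ⟨b, rfl⟩)

/-! ### Values of wires -/

/-- The valuation `v` of the wires respects the gates of `G`. -/
def Cons (v : ℕ → Bool) (G : Netlist) : Prop :=
  ∀ p op a b, G.Has p ⟨op, a, b⟩ → v p = op (v a) (v b)

/-- Every output of `m` in `G` satisfies `Q`. For `Cons v G`, the lemmas `Cons.*` below describe in
this way the values under `v` of what the builders compute. -/
def Sem {α : Type} (G : Netlist) (m : Build α) (Q : α → Prop) : Prop := ∀ a, Runs G m a → Q a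

theorem Sem.bind {α β : Type} {m : Build α} {f : α → Build β} {Q : α → Prop} {Q' : β → Prop}
    [∀ a, Mono (f a)] (h : Sem G m Q) (h' : ∀ a, Q a → Sem G (f a) Q') : Sem G (m >>= f) Q' := by
  intro c hc
  obtain ⟨a, ha, hc⟩ := hc.bind
  exact h' a (h a ha) c hc

theorem Sem.pure {α : Type} {a : α} {Q : α → Prop} (h : Q a) : Sem G (pure a : Build α) Q := by
  intro c hc
  rwa [hc.pure]

theorem Sem.mono {α : Type} {m : Build α} {Q Q' : α → Prop} (h : Sem G m Q) (h' : ∀ a, Q a → Q' a) :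
    Sem G m Q' := fun a ha => h' a (h a ha)

theorem Cons.emit {v : ℕ → Bool} (hv : Cons v G) (op : Bool → Bool → Bool) (a b : Wire) :
    Sem G (emit op a b) fun p => v p = op (v a) (v b) :=
  fun _ hp => hv _ _ _ _ hp.emit

/-! ### Well-formedness and size -/

/-- Every gate reads earlier wires only. -/
def Netlist.WF (s : Netlist) : Prop := ∀ p g, s.Has p g → g.left < p ∧ g.right < p

/-- When run on a netlist with at least `A` wires, the builder adds at most `t` gates; it keeps
well-formedness, and its output `a` satisfies `Q B a`, where `B` is the final number of wires. -/
def Good {α : Type} (m : Build α) (A t : ℕ) (Q : ℕ → α → Prop) : Prop :=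
  ∀ s : Netlist, A ≤ s.width → 0 < s.width → (m.run s).2.width ≤ s.width + t ∧
    (s.WF → (m.run s).2.WF) ∧ Q (m.run s).2.width (m.run s).1

theorem Good.bind {α β : Type} {m : Build α} {f : α → Build β} {Q : ℕ → α → Prop}
    {Q' : ℕ → β → Prop} {A t t' : ℕ} [hm : Mono m] (h : Good m A t Q)
    (h' : ∀ a B, A ≤ B → Q B a → Good (f a) B t' Q') : Good (m >>= f) A (t + t') Q' := by
  intro s hs hs0
  obtain ⟨h1, h2, h3⟩ := h s hs hs0
  have hle := (hm.le s).width_le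
  obtain ⟨h4, h5, h6⟩ := h' _ _ (hs.trans hle) h3 _ le_rfl (hs0.trans_le hle)
  exact ⟨by change _ ≤ _ at h4; exact h4.trans (by omega), fun hw => h5 (h2 hw), h6⟩

theorem Good.mono {α : Type} {m : Build α} {Q Q' : ℕ → α → Prop} {A t t' : ℕ} [hm : Mono m]
    (h : Good m A t Q) (ht : t ≤ t') (h' : ∀ B a, A ≤ B → Q B a → Q' B a) : Good m A t' Q' := by
  intro s hs hs0
  obtain ⟨h1, h2, h3⟩ := h s hs hs0
  exact ⟨h1.trans (by omega), h2, h' _ _ (hs.trans (hm.le s).width_le) h3⟩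

theorem Good.cost {α : Type} {m : Build α} {Q : ℕ → α → Prop} {A t t' : ℕ} [hm : Mono m]
    (h : Good m A t Q) (ht : t ≤ t') : Good m A t' Q := h.mono ht fun _ _ _ h => h

theorem Good.pure {α : Type} {a : α} {Q : ℕ → α → Prop} {A : ℕ} (h : ∀ B, A ≤ B → Q B a) :
    Good (pure a : Build α) A 0 Q := fun _ hs _ => ⟨le_rfl, id, h _ hs⟩

theorem good_emit_aux (op : Bool → Bool → Bool) (a b : ℕ) (s : Netlist) (ha : a < s.width)
    (hb : b < s.width) : ((emit op a b).run s).2.width ≤ s.width + 1 ∧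
    (s.WF → ((emit op a b).run s).2.WF) ∧
      ((emit op a b).run s).1 < ((emit op a b).run s).2.width := by
  have e : (emit op a b).run s = (s.inputs + s.gates.length,
    { s with gates := s.gates ++ [⟨op, a, b⟩] }) := rfl
  rw [e]
  refine ⟨by simp [Netlist.width]; omega, fun hw p g hp => ?_, by simp [Netlist.width]⟩
  obtain ⟨i, hi, rfl⟩ := hp
  simp only at hi ⊢
  rcases lt_trichotomy i s.gates.length with h | h | h
  · rw [List.getElem?_append_left h] at hi
    exact hw _ _ ⟨i, hi, rfl⟩
  · subst h
    simp at hi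
    subst hi
    exact ⟨ha, hb⟩
  · rw [List.getElem?_eq_none (by simp; omega)] at hi
    cases hi

theorem good_emit {op : Bool → Bool → Bool} {a b : ℕ} {A : ℕ} (ha : a < A) (hb : b < A) :
    Good (emit op a b) A 1 fun B (p : ℕ) => p < B :=
  fun s hs _ => good_emit_aux op a b s (ha.trans_le hs) (hb.trans_le hs)

theorem good_const {b : Bool} {A : ℕ} : Good (const b) A 1 fun B (p : ℕ) => p < B :=
  fun s _ hs0 => good_emit_aux _ 0 0 s hs0 hs0

/-- A list of `n` wires with numbers below `B`. -/
def Bd (B n : ℕ) (l : List ℕ) : Prop := l.length = n ∧ ∀ x ∈ l, x < B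

theorem Bd.le {A B n : ℕ} {l : List ℕ} (h : Bd A n l) (hB : A ≤ B) : Bd B n l :=
  ⟨h.1, fun x hx => (h.2 x hx).trans_le hB⟩

theorem Bd.nil {B : ℕ} : Bd B 0 [] := ⟨rfl, by simp⟩

theorem Bd.cons {B n x : ℕ} {l : List ℕ} (hx : x < B) (h : Bd B n l) : Bd B (n + 1) (x :: l) :=
  ⟨by simp [h.1], by simpa [hx] using h.2⟩

theorem Bd.append {B n n' : ℕ} {l l' : List ℕ} (h : Bd B n l) (h' : Bd B n' l') :
    Bd B (n + n') (l ++ l') :=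
  ⟨by simp [h.1, h'.1], fun x hx => (List.mem_append.1 hx).elim (h.2 x) (h'.2 x)⟩

theorem Bd.snoc {B n x : ℕ} {l : List ℕ} (h : Bd B n l) (hx : x < B) :
    Bd B (n + 1) (l ++ [x]) := h.append (Bd.nil.cons hx)

theorem Bd.take {B n k : ℕ} {l : List ℕ} (h : Bd B n l) (hk : k ≤ n) : Bd B k (l.take k) :=
  ⟨by simp [h.1, hk], fun x hx => h.2 x (List.mem_of_mem_take hx)⟩

theorem Bd.drop {B n k : ℕ} {l : List ℕ} (h : Bd B n l) : Bd B (n - k) (l.drop k) :=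
  ⟨by simp [h.1], fun x hx => h.2 x (List.mem_of_mem_drop hx)⟩

theorem Bd.getD {B n i d : ℕ} {l : List ℕ} (h : Bd B n l) (hi : i < n) : l.getD i d < B := by
  rw [List.getD_eq_getElem _ _ (h.1.symm ▸ hi)]
  exact h.2 _ (List.getElem_mem _)

/-! ### Parametricity of the arithmetic builders -/

section Par
open List

variable {R : ℕ → ℕ → Prop} {G G' : Netlist}

theorem Forall₂.getD_rel {l l' : List ℕ} (h : Forall₂ R l l') {i d d' : ℕ} (hi : i < l.length) :
    R (l.getD i d) (l'.getD i d') := by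
  rw [List.getD_eq_getElem _ _ hi, List.getD_eq_getElem _ _ (h.length_eq ▸ hi)]
  exact h.get hi (h.length_eq ▸ hi)

theorem Forall₂.take_rel {l l' : List ℕ} (h : Forall₂ R l l') (n : ℕ) :
    Forall₂ R (l.take n) (l'.take n) := forall₂_take n h

theorem Forall₂.snoc {l l' : List ℕ} (h : Forall₂ R l l') {a a' : ℕ} (ha : R a a') :
    Forall₂ R (l ++ [a]) (l' ++ [a']) := rel_append h (.cons ha .nil)

namespace Closed

theorem mux (hR : Closed R G G') {s a b s' a' b' : Wire} (hs : R s s') (ha : R a a')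
    (hb : R b b') : Par G G' (mux s a b) (mux s' a' b') R := by
  unfold SelfProv.mux
  exact (hR.emit hs ha).bind fun x x' hx => (hR.emit hs hb).bind fun y y' hy => hR.emit hx hy

theorem anyOf (hR : Closed R G G') {l l' : List Wire} (h : Forall₂ R l l') :
    Par G G' (anyOf l) (anyOf l') R := by
  induction h with
  | nil => exact hR.const false
  | cons h _ ih => exact ih.bind fun x x' hx => hR.emit h hx

theorem constList (hR : Closed R G G') (l : List Bool) :
    Par G G' (constList l) (constList l) (Forall₂ R) := by
  induction l with
  | nil => exact .pure .nil
  | cons b l ih =>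
    exact (hR.const b).bind fun x x' hx => ih.bind fun y y' hy => .pure (.cons hx hy)

theorem constBits (hR : Closed R G G') (n x : ℕ) :
    Par G G' (constBits n x) (constBits n x) (Forall₂ R) := hR.constList _

theorem muxList (hR : Closed R G G') {s s' : Wire} {l l' k k' : List Wire} (hs : R s s')
    (hl : Forall₂ R l l') (hk : Forall₂ R k k') :
    Par G G' (muxList s l k) (muxList s' l' k') (Forall₂ R) := by
  induction hl generalizing k k' with
  | nil => unfold SelfProv.muxList; exact .pure .nil
  | cons h hl ih =>
    cases hk with
    | nil => unfold SelfProv.muxList; exact .pure .nil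
    | cons hk1 hk =>
      exact (hR.mux hs h hk1).bind fun x x' hx => (ih hk).bind fun y y' hy => .pure (.cons hx hy)

theorem notList (hR : Closed R G G') {l l' : List Wire} (h : Forall₂ R l l') :
    Par G G' (notList l) (notList l') (Forall₂ R) := by
  induction h with
  | nil => exact .pure .nil
  | cons h hl ih =>
    exact Par.bind (m := bnot _) (m' := bnot _) (hR.emit h h) fun x x' hx => ih.bind fun y y' hy => .pure (.cons hx hy)

theorem eqList (hR : Closed R G G') {l l' k k' : List Wire}
    (hl : Forall₂ R l l') (hk : Forall₂ R k k') :
    Par G G' (eqList l k) (eqList l' k') R := by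
  induction hl generalizing k k' with
  | nil => unfold SelfProv.eqList; exact hR.const true
  | cons h hl ih =>
    cases hk with
    | nil => unfold SelfProv.eqList; exact hR.const true
    | cons hk1 hk =>
      exact Par.bind (m := bxnor _ _) (m' := bxnor _ _) (hR.emit h hk1) fun x x' hx =>
        (ih hk).bind fun y y' hy => hR.emit hx hy

theorem addCarry (hR : Closed R G G') {l l' k k' : List Wire} {c c' : Wire}
    (hl : Forall₂ R l l') (hk : Forall₂ R k k') (hc : R c c') :
    Par G G' (addCarry l k c) (addCarry l' k' c')
      fun r r' => Forall₂ R r.1 r'.1 ∧ R r.2 r'.2 := by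
  induction hl generalizing k k' c c' with
  | nil => unfold SelfProv.addCarry; exact .pure ⟨.nil, hc⟩
  | cons h hl ih =>
    cases hk with
    | nil => unfold SelfProv.addCarry; exact .pure ⟨.nil, hc⟩
    | cons hk1 hk =>
      exact Par.bind (m := bxor _ _) (m' := bxor _ _) (hR.emit h hk1) fun x x' hx =>
        Par.bind (m := bxor _ _) (m' := bxor _ _) (hR.emit hx hc) fun s s' hs =>
        Par.bind (m := band _ _) (m' := band _ _) (hR.emit h hk1) fun y y' hy =>
        Par.bind (m := band _ _) (m' := band _ _) (hR.emit hx hc) fun z z' hz =>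
        Par.bind (m := bor _ _) (m' := bor _ _) (hR.emit hy hz) fun c c' hc =>
        (ih hk hc).bind fun r r' hr => .pure ⟨.cons hs hr.1, hr.2⟩

theorem add (hR : Closed R G G') {l l' k k' : List Wire} (hl : Forall₂ R l l')
    (hk : Forall₂ R k k') : Par G G' (add l k) (add l' k') (Forall₂ R) :=
  (hR.const false).bind fun _ _ hc => (hR.addCarry hl hk hc).bind fun _ _ hr => .pure hr.1

theorem sub (hR : Closed R G G') {l l' k k' : List Wire} (hl : Forall₂ R l l')
    (hk : Forall₂ R k k') : Par G G' (sub l k) (sub l' k')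
      fun r r' => Forall₂ R r.1 r'.1 ∧ R r.2 r'.2 :=
  (hR.notList hk).bind fun _ _ hy => (hR.const true).bind fun _ _ hc => hR.addCarry hl hy hc

theorem geq (hR : Closed R G G') {l l' k k' : List Wire} (hl : Forall₂ R l l')
    (hk : Forall₂ R k k') : Par G G' (geq l k) (geq l' k') R :=
  (hR.sub hl hk).bind fun _ _ hr => .pure hr.2

theorem condSub (hR : Closed R G G') (m : ℕ) {l l' : List Wire} (hl : Forall₂ R l l') :
    Par G G' (condSub m l) (condSub m l') (Forall₂ R) := by
  unfold SelfProv.condSub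
  rw [hl.length_eq]
  exact (hR.constBits _ m).bind fun c c' hc => (hR.sub hl hc).bind fun r r' hr =>
    hR.muxList hr.2 hr.1 hl

theorem mulConst (hR : Closed R G G') (w m : ℕ) {l l' : List Wire} (hl : Forall₂ R l l') :
    Par G G' (mulConst w m l) (mulConst w m l') (Forall₂ R) := by
  induction hl with
  | nil => exact hR.constBits w 0
  | cons h hl ih =>
    exact ih.bind fun x x' hx => (hR.const false).bind fun z z' hz =>
      (hR.constBits w 0).bind fun _ _ h0 => (hR.constBits w m).bind fun _ _ hc =>
      (hR.muxList h hc h0).bind fun t t' ht => hR.add (Forall₂.take_rel (.cons hz hx) w) ht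

theorem count (hR : Closed R G G') (w : ℕ) {l l' : List Wire} (hl : Forall₂ R l l') :
    Par G G' (count w l) (count w l') (Forall₂ R) := by
  induction hl with
  | nil => exact hR.constBits w 0
  | cons h hl ih =>
    exact ih.bind fun x x' hx => (hR.constBits w 0).bind fun _ _ h0 =>
      (hR.addCarry hx h0 h).bind fun t t' ht => .pure ht.1

theorem addMod (hR : Closed R G G') (n q : ℕ) {l l' k k' : List Wire} (hl : Forall₂ R l l')
    (hk : Forall₂ R k k') : Par G G' (addMod n q l k) (addMod n q l' k') (Forall₂ R) :=
  (hR.const false).bind fun _ _ hz => (hR.add (Forall₂.snoc hl hz) (Forall₂.snoc hk hz)).bind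
    fun _ _ hs => (hR.condSub q hs).bind fun _ _ hr => .pure (Forall₂.take_rel hr n)

theorem mulMod (hR : Closed R G G') (n q : ℕ) {l l' k k' : List Wire} (hl : Forall₂ R l l')
    (hk : Forall₂ R k k') : Par G G' (mulMod n q l k) (mulMod n q l' k') (Forall₂ R) := by
  induction hk with
  | nil => exact hR.constBits n 0
  | cons h hk ih =>
    exact ih.bind fun x x' hx => (hR.addMod n q hx hx).bind fun d d' hd =>
      (hR.addMod n q hd hl).bind fun s s' hs => hR.muxList h hs hd

theorem powMod (hR : Closed R G G') (n q g : ℕ) {l l' : List Wire} (hl : Forall₂ R l l') :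
    Par G G' (powMod n q g l) (powMod n q g l') (Forall₂ R) := by
  induction hl with
  | nil => exact hR.constBits n 1
  | cons h hl ih =>
    exact ih.bind fun x x' hx => (hR.mulMod n q hx hx).bind fun d d' hd =>
      (hR.constBits n g).bind fun c c' hc =>
      (hR.mulMod n q hd hc).bind fun s s' hs => hR.muxList h hs hd

theorem inGroup (hR : Closed R G G') (n q : ℕ) {l l' : List Wire} (hl : Forall₂ R l l') :
    Par G G' (inGroup n q l) (inGroup n q l') R :=
  (hR.anyOf hl).bind fun _ _ hn => (hR.const false).bind fun _ _ hz =>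
    (hR.constBits (n + 1) q).bind fun _ _ hc => (hR.geq (Forall₂.snoc hl hz) hc).bind
      fun _ _ hg => Par.bind (m := bnot _) (m' := bnot _) (hR.emit hg hg) fun _ _ h => hR.emit hn h

theorem subExp (hR : Closed R G G') (n q : ℕ) {l l' k k' : List Wire} (hl : Forall₂ R l l')
    (hk : Forall₂ R k k') : Par G G' (subExp n q l k) (subExp n q l' k') (Forall₂ R) :=
  (hR.const false).bind fun _ _ hz => (hR.condSub (q - 1) (Forall₂.snoc hl hz)).bind
    fun _ _ hs => (hR.constBits (n + 1) (q - 1)).bind fun _ _ hc =>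
    (hR.sub hc (Forall₂.snoc hk hz)).bind fun _ _ hr => (hR.add hs hr.1).bind fun _ _ ht =>
    (hR.condSub (q - 1) ht).bind fun _ _ hr => .pure (Forall₂.take_rel hr n)

theorem selectFrom (hR : Closed R G G') {p p' : List Wire} (hp : Forall₂ R p p') (j : ℕ)
    {l l' : List Wire} (hl : Forall₂ R l l') {a a' : Wire} (ha : R a a') :
    Par G G' (selectFrom p j l a) (selectFrom p' j l' a') R := by
  induction hl generalizing j a a' with
  | nil => exact .pure ha
  | cons h hl ih =>
    unfold SelfProv.selectFrom
    rw [hp.length_eq]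
    exact (hR.constBits _ j).bind fun _ _ hc => (hR.eqList hp hc).bind fun _ _ he =>
      (hR.mux he h ha).bind fun _ _ hm => ih _ hm

theorem select (hR : Closed R G G') {l l' p p' : List Wire} (hl : Forall₂ R l l') (h0 : l ≠ [])
    (hp : Forall₂ R p p') : Par G G' (select l p) (select l' p') R := by
  unfold SelfProv.select
  refine hR.selectFrom hp 0 hl ?_
  cases hl with
  | nil => exact absurd rfl h0
  | cons h _ => exact h

theorem applyTable (hR : Closed R G G') {l l' : List Wire} (hl : Forall₂ R l l')
    (h4 : 4 ≤ l.length) {a b a' b' : Wire} (ha : R a a') (hb : R b b') :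
    Par G G' (applyTable l a b) (applyTable l' a' b') R := by
  unfold SelfProv.applyTable
  exact (hR.mux hb (Forall₂.getD_rel hl (by omega)) (Forall₂.getD_rel hl (by omega))).bind
    fun x x' hx => (hR.mux hb (Forall₂.getD_rel hl (by omega))
      (Forall₂.getD_rel hl (by omega))).bind fun y y' hy => hR.mux ha hy hx

theorem evalGates (hR : Closed R G G') (w s : ℕ) {d d' l l' : List Wire} (hd : Forall₂ R d d')
    (hlen : s * (4 + 2 * w) ≤ d.length) (hl : Forall₂ R l l') (h0 : l ≠ []) :
    Par G G' (evalGates w s d l) (evalGates w s d' l') fun r r' => Forall₂ R r r' ∧ r ≠ [] := by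
  induction s generalizing d d' l l' with
  | zero => exact .pure ⟨hl, h0⟩
  | succ s ih =>
    have h1 : 4 + 2 * w ≤ d.length := le_trans (by nlinarith) hlen
    have h2 : s * (4 + 2 * w) ≤ (d.drop (4 + 2 * w)).length := by
      rw [List.length_drop]; rw [Nat.succ_mul] at hlen; omega
    exact (hR.select hl h0 (forall₂_take w (forall₂_drop 4 hd))).bind fun a a' ha =>
      (hR.select hl h0 (forall₂_take w (forall₂_drop (4 + w) hd))).bind fun b b' hb =>
      (hR.applyTable (forall₂_take 4 hd) (by simp; omega) ha hb).bind fun v v' hv =>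
      ih (forall₂_drop _ hd) h2 (Forall₂.snoc hl hv) (by simp)

theorem evalOuts (hR : Closed R G G') (w o : ℕ) {d d' l l' : List Wire} (hd : Forall₂ R d d')
    (hl : Forall₂ R l l') (h0 : l ≠ []) :
    Par G G' (evalOuts w l o d) (evalOuts w l' o d') (Forall₂ R) := by
  induction o generalizing d d' with
  | zero => exact .pure .nil
  | succ o ih =>
    exact (hR.select hl h0 (forall₂_take w hd)).bind fun a a' ha =>
      (ih (forall₂_drop _ hd)).bind fun b b' hb => .pure (.cons ha hb)

theorem evalDesc (hR : Closed R G G') (n s o : ℕ) {d d' x x' : List Wire} (hd : Forall₂ R d d')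
    (hlen : descLen n s o ≤ d.length) (hx : Forall₂ R x x') (h0 : x ≠ []) :
    Par G G' (evalDesc n s o d x) (evalDesc n s o d' x') (Forall₂ R) := by
  unfold SelfProv.evalDesc
  exact (hR.evalGates _ s hd (le_trans (Nat.le_add_right _ _) hlen) hx h0).bind fun l l' hl =>
    hR.evalOuts _ o (forall₂_drop _ hd) hl.1 hl.2

theorem dlogTest (hR : Closed R G G') (n q g s : ℕ) {d d' b b' : List Wire} (hd : Forall₂ R d d')
    (hlen : descLen n s n ≤ d.length) (hb : Forall₂ R b b') (h0 : b ≠ []) :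
    Par G G' (dlogTest n q g s d b) (dlogTest n q g s d' b') R :=
  (hR.evalDesc n s n hd hlen hb h0).bind fun _ _ hl => (hR.powMod n q g hl).bind fun _ _ hy =>
    (hR.eqList hy hb).bind fun _ _ he => (hR.inGroup n q hb).bind fun _ _ hi => hR.emit hi he

end Closed

theorem Par.mapM {α : Type} (f f' : α → Build Wire) [∀ a, Mono (f a)]
    [∀ a, Mono (f' a)] (l : List α) (h : ∀ a ∈ l, Par G G' (f a) (f' a) R) :
    Par G G' (l.mapM f) (l.mapM f') (Forall₂ R) := by
  induction l with
  | nil => simp only [List.mapM_nil]; exact .pure .nil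
  | cons a l ih =>
    simp only [List.mapM_cons]
    exact (h a (by simp)).bind fun x x' hx => (ih fun b hb => h b (by simp [hb])).bind
      fun y y' hy => .pure (.cons hx hy)

end Par

/-! ### Size of the arithmetic builders -/

section Good

variable {A n : ℕ}

theorem good_mux {s a b : ℕ} (hs : s < A) (ha : a < A) (hb : b < A) :
    Good (mux s a b) A 3 fun B (p : ℕ) => p < B := by
  unfold mux
  exact ((good_emit hs ha).bind fun x B hB hx => (good_emit (A := B) (by omega) (by omega)).bind
    fun y C hC hy => good_emit (A := C) (by omega) (by omega)).cost (by omega)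

theorem good_anyOf {l : List ℕ} (h : Bd A n l) :
    Good (anyOf l) A (n + 1) fun B (p : ℕ) => p < B := by
  induction l generalizing n with
  | nil => exact good_const.cost (by omega)
  | cons a l ih =>
    obtain ⟨rfl, h2⟩ := h
    exact ((ih ⟨rfl, fun x hx => h2 x (by simp [hx])⟩).bind fun x B hB hx =>
      good_emit (A := B) ((h2 a (by simp)).trans_le hB) hx).cost (by simp)

theorem good_constList (l : List Bool) : Good (constList l) A l.length fun B r => Bd B l.length r := by
  induction l generalizing A with
  | nil => exact .pure fun _ _ => .nil
  | cons b l ih =>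
    exact (good_const.bind fun x B hB hx => (ih (A := B)).bind fun y C hC hy =>
      .pure fun D hD => (hy.le hD).cons (by omega)).cost (by simp; omega)

theorem good_constBits (n x : ℕ) : Good (constBits n x) A n fun B r => Bd B n r := by
  have h := good_constList (A := A) (bits n x)
  rwa [length_bits] at h

theorem good_muxList {s : ℕ} (hs : s < A) {l k : List ℕ} (hl : Bd A n l) (hk : Bd A n k) :
    Good (muxList s l k) A (3 * n) fun B r => Bd B n r := by
  induction l generalizing n k A with
  | nil => obtain ⟨rfl, _⟩ := hl; unfold muxList; exact .pure fun _ _ => .nil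
  | cons a l ih =>
    obtain ⟨rfl, h2⟩ := hl
    cases k with
    | nil => exact absurd hk.1 (by simp)
    | cons b k =>
      unfold muxList
      have hk' : Bd A l.length k := ⟨by simpa using hk.1, fun x hx => hk.2 x (by simp [hx])⟩
      have hl' : Bd A l.length l := ⟨rfl, fun x hx => h2 x (by simp [hx])⟩
      exact ((good_mux hs (h2 a (by simp)) (hk.2 b (by simp))).bind fun x B hB hx =>
        (ih (A := B) (by omega) (hl'.le hB) (hk'.le hB)).bind fun y C hC hy =>
        .pure fun D hD => (hy.le hD).cons (by omega)).cost (by simp; omega)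

theorem good_notList {l : List ℕ} (hl : Bd A n l) :
    Good (notList l) A n fun B r => Bd B n r := by
  induction l generalizing n A with
  | nil => obtain ⟨rfl, _⟩ := hl; exact .pure fun _ _ => .nil
  | cons a l ih =>
    obtain ⟨rfl, h2⟩ := hl
    have hl' : Bd A l.length l := ⟨rfl, fun x hx => h2 x (by simp [hx])⟩
    exact (Good.bind (m := bnot a) (good_emit (h2 a (by simp)) (h2 a (by simp))) fun x B hB hx =>
        (ih (A := B) (hl'.le hB)).bind fun y C hC hy =>
        .pure fun D hD => (hy.le hD).cons (by omega)).cost (by simp; omega)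

theorem good_eqList {l k : List ℕ} (hl : Bd A n l) (hk : Bd A n k) :
    Good (eqList l k) A (2 * n + 1) fun B (r : ℕ) => r < B := by
  induction l generalizing n k A with
  | nil => obtain ⟨rfl, _⟩ := hl; unfold eqList; exact good_const.cost (by omega)
  | cons a l ih =>
    obtain ⟨rfl, h2⟩ := hl
    cases k with
    | nil => exact absurd hk.1 (by simp)
    | cons b k =>
      have hk' : Bd A l.length k := ⟨by simpa using hk.1, fun x hx => hk.2 x (by simp [hx])⟩
      have hl' : Bd A l.length l := ⟨rfl, fun x hx => h2 x (by simp [hx])⟩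
      exact (Good.bind (m := bxnor a b) (good_emit (h2 a (by simp)) (hk.2 b (by simp)))
        fun x B hB hx => (ih (A := B) (hl'.le hB) (hk'.le hB)).bind fun y C hC hy =>
        good_emit (A := C) (by omega) (by omega)).cost (by simp; omega)

theorem good_addCarry {l k : List ℕ} {c : ℕ} (hl : Bd A n l) (hk : Bd A n k) (hc : c < A) :
    Good (addCarry l k c) A (5 * n) fun B (r : List ℕ × ℕ) => Bd B n r.1 ∧ r.2 < B := by
  induction l generalizing n k A c with
  | nil => obtain ⟨rfl, _⟩ := hl; unfold addCarry; exact .pure fun _ h => ⟨.nil, hc.trans_le h⟩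
  | cons a l ih =>
    obtain ⟨rfl, h2⟩ := hl
    cases k with
    | nil => exact absurd hk.1 (by simp)
    | cons b k =>
      have hk' : Bd A l.length k := ⟨by simpa using hk.1, fun x hx => hk.2 x (by simp [hx])⟩
      have hl' : Bd A l.length l := ⟨rfl, fun x hx => h2 x (by simp [hx])⟩
      have ha := h2 a (by simp)
      have hb := hk.2 b (by simp)
      exact (Good.bind (m := bxor a b) (good_emit ha hb) fun x B1 hB1 hx =>
        Good.bind (m := bxor x c) (good_emit (A := B1) (by omega) (by omega)) fun s B2 hB2 hs =>
        Good.bind (m := band a b) (good_emit (A := B2) (by omega) (by omega)) fun y B3 hB3 hy =>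
        Good.bind (m := band x c) (good_emit (A := B3) (by omega) (by omega)) fun z B4 hB4 hz =>
        Good.bind (m := bor y z) (good_emit (A := B4) (by omega) (by omega)) fun c' B hB hc' =>
        (ih (A := B) (hl'.le (by omega)) (hk'.le (by omega)) hc').bind fun r C hC hr =>
        .pure fun D hD => ⟨(hr.1.le hD).cons (by omega), by omega⟩).cost (by simp; omega)

theorem good_add {l k : List ℕ} (hl : Bd A n l) (hk : Bd A n k) :
    Good (add l k) A (5 * n + 1) fun B r => Bd B n r :=
  (good_const.bind fun _ _ hB hc => (good_addCarry (hl.le hB) (hk.le hB) hc).bind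
    fun _ _ _ hr => .pure fun _ hD => hr.1.le hD).cost (by omega)

theorem good_sub {l k : List ℕ} (hl : Bd A n l) (hk : Bd A n k) :
    Good (sub l k) A (6 * n + 1) fun B (r : List ℕ × ℕ) => Bd B n r.1 ∧ r.2 < B :=
  ((good_notList hk).bind fun _ _ hB hy => good_const.bind fun _ _ hC hc =>
    good_addCarry (hl.le (hB.trans hC)) (hy.le hC) hc).cost (by omega)

theorem good_geq {l k : List ℕ} (hl : Bd A n l) (hk : Bd A n k) :
    Good (geq l k) A (6 * n + 1) fun B (r : ℕ) => r < B :=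
  ((good_sub hl hk).bind fun _ _ _ hr => .pure fun _ hD => hr.2.trans_le hD).cost (by omega)

theorem good_condSub (m : ℕ) {l : List ℕ} (hl : Bd A n l) :
    Good (condSub m l) A (10 * n + 1) fun B r => Bd B n r := by
  unfold condSub
  rw [hl.1]
  exact ((good_constBits n m).bind fun c B hB hc => (good_sub (hl.le hB) hc).bind
    fun r C hC hr => good_muxList hr.2 hr.1 (hl.le (hB.trans hC))).cost (by omega)

theorem good_mulConst (w m : ℕ) {l : List ℕ} (hl : Bd A n l) :
    Good (mulConst w m l) A (n * (10 * w + 2) + w) fun B r => Bd B w r := by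
  induction l generalizing n with
  | nil => exact (good_constBits w 0).cost (by omega)
  | cons a l ih =>
    obtain ⟨rfl, h2⟩ := hl
    have hl' : Bd A l.length l := ⟨rfl, fun x hx => h2 x (by simp [hx])⟩
    have ha := h2 a (by simp)
    exact ((ih hl').bind fun x B1 hB1 hx => good_const.bind fun z B2 hB2 hz =>
      (good_constBits w 0).bind fun _ B3 hB3 h0 => (good_constBits w m).bind fun _ B4 hB4 hc =>
      (good_muxList (by omega) hc (h0.le hB4)).bind fun t B5 hB5 ht =>
      good_add ((((hx.le hB2).cons hz).take (by omega)).le (by omega)) ht).cost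
        (by simp only [List.length_cons, Nat.succ_mul]; omega)

theorem good_count (w : ℕ) {l : List ℕ} (hl : Bd A n l) :
    Good (count w l) A (n * (6 * w) + w) fun B r => Bd B w r := by
  induction l generalizing n with
  | nil => exact (good_constBits w 0).cost (by omega)
  | cons a l ih =>
    obtain ⟨rfl, h2⟩ := hl
    have hl' : Bd A l.length l := ⟨rfl, fun x hx => h2 x (by simp [hx])⟩
    have ha := h2 a (by simp)
    exact ((ih hl').bind fun x B1 hB1 hx => (good_constBits w 0).bind fun _ B3 hB3 h0 =>
      (good_addCarry (hx.le hB3) h0 (by omega)).bind fun t B5 hB5 ht =>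
      .pure fun D hD => ht.1.le hD).cost
        (by simp only [List.length_cons, Nat.succ_mul]; omega)

theorem good_addMod (q : ℕ) {l k : List ℕ} (hl : Bd A n l) (hk : Bd A n k) :
    Good (addMod n q l k) A (15 * n + 18) fun B r => Bd B n r :=
  (good_const.bind fun _ _ hB hz => (good_add ((hl.le hB).snoc hz) ((hk.le hB).snoc hz)).bind
    fun _ _ _ hs => (good_condSub q hs).bind fun _ _ _ hr =>
    .pure fun _ hD => (hr.le hD).take (by omega)).cost (by omega)

theorem good_mulMod (q : ℕ) {l k : List ℕ} {m : ℕ} (hl : Bd A n l) (hk : Bd A m k) :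
    Good (mulMod n q l k) A (m * (33 * n + 36) + n) fun B r => Bd B n r := by
  induction k generalizing m with
  | nil => exact (good_constBits n 0).cost (by omega)
  | cons a k ih =>
    obtain ⟨rfl, h2⟩ := hk
    have hk' : Bd A k.length k := ⟨rfl, fun x hx => h2 x (by simp [hx])⟩
    have ha := h2 a (by simp)
    exact ((ih hk').bind fun x B1 hB1 hx => (good_addMod q hx hx).bind fun _ B2 hB2 hd =>
      (good_addMod q hd (hl.le (by omega))).bind fun t B3 hB3 ht =>
      good_muxList (by omega) ht (hd.le hB3)).cost
        (by simp only [List.length_cons, Nat.succ_mul]; omega)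

theorem good_powMod (q g : ℕ) {l : List ℕ} {m : ℕ} (hl : Bd A m l) :
    Good (powMod n q g l) A (m * (66 * n ^ 2 + 78 * n) + n) fun B r => Bd B n r := by
  induction l generalizing m with
  | nil => exact (good_constBits n 1).cost (by omega)
  | cons a k ih =>
    obtain ⟨rfl, h2⟩ := hl
    have hk' : Bd A k.length k := ⟨rfl, fun x hx => h2 x (by simp [hx])⟩
    have ha := h2 a (by simp)
    exact ((ih hk').bind fun x B1 hB1 hx => (good_mulMod q hx hx).bind fun _ B2 hB2 hd =>
      (good_constBits n g).bind fun _ B3 hB3 hc =>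
      (good_mulMod q (hd.le hB3) hc).bind fun t B4 hB4 ht =>
      good_muxList (by omega) ht (hd.le (by omega))).cost
        (by simp only [List.length_cons]; ring_nf; omega)

theorem good_inGroup (q : ℕ) {l : List ℕ} (hl : Bd A n l) :
    Good (inGroup n q l) A (8 * n + 13) fun B (r : ℕ) => r < B :=
  ((good_anyOf hl).bind fun _ _ hB1 hn => good_const.bind fun _ _ hB2 hz =>
    (good_constBits (n + 1) q).bind fun _ _ hB3 hc =>
    (good_geq (((hl.le (hB1.trans hB2)).snoc hz).le hB3) hc).bind fun _ _ hB4 hg =>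
    Good.bind (m := bnot _) (good_emit hg hg) fun _ _ hB5 h =>
    good_emit (hn.trans_le ((hB2.trans hB3).trans (hB4.trans hB5))) h).cost (by omega)

theorem good_subExp (q : ℕ) {l k : List ℕ} (hl : Bd A n l) (hk : Bd A n k) :
    Good (subExp n q l k) A (32 * n + 40) fun B r => Bd B n r :=
  (good_const.bind fun _ _ hB1 hz => (good_condSub (q - 1) ((hl.le hB1).snoc hz)).bind
    fun _ _ hB2 hs => (good_constBits (n + 1) (q - 1)).bind fun _ _ hB3 hc =>
    (good_sub hc ((((hk.le hB1).snoc hz).le hB2).le hB3)).bind fun _ _ hB4 hr =>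
    (good_add ((hs.le hB3).le hB4) hr.1).bind fun _ _ _ ht =>
    (good_condSub (q - 1) ht).bind fun _ _ _ hr =>
    .pure fun _ hD => (hr.le hD).take (by omega)).cost (by omega)

theorem good_selectFrom {p : List ℕ} {w : ℕ} (hp : Bd A w p) (j : ℕ) {l : List ℕ}
    (hl : Bd A n l) {a : ℕ} (ha : a < A) :
    Good (selectFrom p j l a) A (n * (3 * w + 4)) fun B (r : ℕ) => r < B := by
  induction l generalizing j a n A with
  | nil => exact (Good.pure (Q := fun B (r : ℕ) => r < B) fun _ hB => lt_of_lt_of_le ha hB).cost (by omega)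
  | cons b l ih =>
    obtain ⟨rfl, h2⟩ := hl
    have hl' : Bd A l.length l := ⟨rfl, fun x hx => h2 x (by simp [hx])⟩
    have hb := h2 b (by simp)
    unfold selectFrom
    rw [hp.1]
    exact ((good_constBits w j).bind fun _ B1 hB1 hc =>
      (good_eqList (hp.le hB1) hc).bind fun _ B2 hB2 he =>
      (good_mux he (by omega) (by omega)).bind fun _ B3 hB3 hm =>
      ih (hp.le (by omega)) _ (hl'.le (by omega)) hm).cost
        (by simp only [List.length_cons, Nat.succ_mul]; omega)

theorem good_select {l p : List ℕ} {w : ℕ} (hl : Bd A n l) (h0 : 0 < n) (hp : Bd A w p) :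
    Good (select l p) A (n * (3 * w + 4)) fun B (r : ℕ) => r < B := by
  unfold select
  refine good_selectFrom hp 0 hl ?_
  cases l with
  | nil => exact absurd hl.1 (by simp; omega)
  | cons a l => exact hl.2 a (by simp)

theorem good_applyTable {l : List ℕ} (hl : Bd A 4 l) {a b : ℕ} (ha : a < A) (hb : b < A) :
    Good (applyTable l a b) A 9 fun B (r : ℕ) => r < B := by
  unfold applyTable
  exact ((good_mux hb (hl.getD (by omega)) (hl.getD (by omega))).bind fun x B hB hx =>
    (good_mux (A := B) (by omega) ((hl.le hB).getD (by omega)) ((hl.le hB).getD (by omega))).bind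
      fun y C hC hy => good_mux (A := C) (by omega) hy (by omega)).cost (by omega)

theorem good_evalGates (w s : ℕ) {d l : List ℕ} {m : ℕ} (hd : Bd A m d)
    (hlen : s * (4 + 2 * w) ≤ m) (hl : Bd A n l) (h0 : 0 < n) :
    Good (evalGates w s d l) A (s * (2 * ((n + s) * (3 * w + 4)) + 9)) fun B r => Bd B (n + s) r := by
  induction s generalizing d l A n m with
  | zero => exact (Good.pure fun _ hB => hl.le hB).cost (by omega)
  | succ s ih =>
    have h2 : s * (4 + 2 * w) ≤ m - (4 + 2 * w) := by rw [Nat.succ_mul] at hlen; omega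
    have h1 : 4 + 2 * w ≤ m := le_trans (by nlinarith) hlen
    refine ((good_select hl h0 ((hd.drop (k := 4)).take (by omega))).bind fun a B1 hB1 ha =>
      (good_select (hl.le hB1) h0 (((hd.le hB1).drop (k := 4 + w)).take (by omega))).bind
        fun b B2 hB2 hb =>
      (good_applyTable (((hd.le hB1).le hB2).take (by omega)) (by omega) hb).bind fun v B3 hB3 hv =>
      ih ((hd.le (by omega)).drop) h2 ((hl.le (by omega)).snoc hv) (by omega)).mono ?_ ?_
    · have h3 : n * (3 * w + 4) ≤ (n + (s + 1)) * (3 * w + 4) :=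
        Nat.mul_le_mul_right _ (by omega)
      rw [show n + 1 + s = n + (s + 1) by omega, Nat.succ_mul s]
      omega
    · intro B a _ ha
      rwa [show n + (s + 1) = n + 1 + s by omega]

theorem good_evalOuts (w o : ℕ) {d l : List ℕ} {m : ℕ} (hd : Bd A m d)
    (hlen : o * w ≤ m) (hl : Bd A n l) (h0 : 0 < n) :
    Good (evalOuts w l o d) A (o * (n * (3 * w + 4))) fun B r => Bd B o r := by
  induction o generalizing d A m with
  | zero => exact (Good.pure fun _ _ => .nil).cost (by omega)
  | succ o ih =>
    have h2 : o * w ≤ m - w := by rw [Nat.succ_mul] at hlen; omega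
    have h1 : w ≤ m := le_trans (by nlinarith) hlen
    exact ((good_select hl h0 (hd.take h1)).bind fun a B1 hB1 ha =>
      (ih ((hd.le hB1).drop) h2 (hl.le hB1)).bind fun b B2 hB2 hb =>
      .pure fun D hD => (hb.le hD).cons (by omega)).cost (by rw [Nat.succ_mul o]; omega)

/-- A bound on the number of gates of `evalDesc`. -/
def evalCost (n s o : ℕ) : ℕ :=
  s * (2 * ((n + s) * (3 * Nat.size (n + s) + 4)) + 9) +
    o * ((n + s) * (3 * Nat.size (n + s) + 4))

theorem good_evalDesc (s o : ℕ) {d x : List ℕ} (hd : Bd A (descLen n s o) d)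
    (hx : Bd A n x) (h0 : 0 < n) :
    Good (evalDesc n s o d x) A (evalCost n s o) fun B r => Bd B o r := by
  unfold evalDesc
  exact ((good_evalGates _ s hd (Nat.le_add_right _ _) hx h0).bind fun l B hB hl =>
    good_evalOuts _ o ((hd.le hB).drop) (by unfold descLen; omega) hl (by omega))

theorem good_dlogTest (q g s : ℕ) {d b : List ℕ} (hd : Bd A (descLen n s n) d)
    (hb : Bd A n b) (h0 : 0 < n) :
    Good (dlogTest n q g s d b) A (evalCost n s n + 66 * n ^ 3 + 78 * n ^ 2 + 11 * n + 15)
      fun B (r : ℕ) => r < B :=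
  ((good_evalDesc s n hd hb h0).bind fun _ _ hB1 hl => (good_powMod q g hl).bind fun _ _ hB2 hy =>
    (good_eqList hy ((hb.le hB1).le hB2)).bind fun _ _ hB3 he =>
    (good_inGroup q (((hb.le hB1).le hB2).le hB3)).bind fun _ _ hB4 hi =>
    good_emit hi (he.trans_le hB4)).cost (by ring_nf; omega)

theorem good_reducedTest (q g s : ℕ) {d b r : List ℕ} (hd : Bd A (descLen n s n) d)
    (hb : Bd A n b) (hr : Bd A n r) (h0 : 0 < n) :
    Good (reducedTest n q g s d b r) A
      (evalCost n s n + 132 * n ^ 3 + 200 * n ^ 2 + 100 * n + 100) fun B (r : ℕ) => r < B :=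
  ((good_powMod q g hr).bind fun _ _ hB1 ht => (good_mulMod q (hb.le hB1) ht).bind
    fun _ _ hB2 hh => (good_evalDesc s n ((hd.le hB1).le hB2) hh h0).bind fun _ _ hB3 hl =>
    (good_subExp q hl (((hr.le hB1).le hB2).le hB3)).bind fun _ _ hB4 ha =>
    (good_powMod q g ha).bind fun _ _ hB5 hy =>
    (good_eqList hy (hb.le (((hB1.trans hB2).trans hB3).trans (hB4.trans hB5)))).bind
      fun _ _ hB6 he =>
    (good_inGroup q (hr.le ((((hB1.trans hB2).trans hB3).trans (hB4.trans hB5)).trans hB6))).bind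
      fun _ _ hB7 hi =>
    good_emit hi (he.trans_le hB7)).cost (by ring_nf; omega)

theorem good_mapM {α : Type} (f : α → Build Wire) [∀ a, Mono (f a)] (t : ℕ) (l : List α)
    (h : ∀ a ∈ l, ∀ B, A ≤ B → Good (f a) B t fun C (p : ℕ) => p < C) :
    Good (l.mapM f) A (l.length * t) fun B r => Bd B l.length r := by
  induction l generalizing A with
  | nil => rw [List.mapM_nil]; exact (Good.pure fun _ _ => .nil).cost (by omega)
  | cons a l ih =>
    rw [List.mapM_cons]
    exact ((h a (by simp) A le_rfl).bind fun x B hB hx =>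
      (ih fun a ha C hC => h a (by simp [ha]) C (hB.trans hC)).bind fun y C hC hy =>
      .pure fun D hD => (hy.le hD).cons (by omega)).cost
        (by rw [List.length_cons, Nat.succ_mul]; omega)

end Good

/-! ### Semantics of the arithmetic builders -/

section Sem

/-- The number that is represented by a list of wires. -/
def val (v : ℕ → Bool) (l : List ℕ) : ℕ := ofBits (l.map v)

theorem val_lt (v : ℕ → Bool) (l : List ℕ) : val v l < 2 ^ l.length := by
  have h := ofBits_lt (l.map v)
  rwa [List.length_map] at h

@[simp] theorem val_nil (v : ℕ → Bool) : val v [] = 0 := rfl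

theorem val_cons (v : ℕ → Bool) (a : ℕ) (l : List ℕ) :
    val v (a :: l) = (v a).toNat + 2 * val v l := rfl

theorem val_snoc_false {v : ℕ → Bool} {z : ℕ} (hz : v z = false) (l : List ℕ) :
    val v (l ++ [z]) = val v l := by
  simp [val, hz, ofBits_append_false]

theorem val_take (v : ℕ → Bool) (l : List ℕ) (n : ℕ) (h : n ≤ l.length) :
    val v (l.take n) = val v l % 2 ^ n := by
  unfold val
  rw [List.map_take, ofBits_take _ _ (by simpa using h)]

variable {v : ℕ → Bool} {G : Netlist}

namespace Cons

theorem const (hv : Cons v G) (b : Bool) : Sem G (const b) fun p => v p = b := hv.emit _ _ _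

theorem mux (hv : Cons v G) (s a b : ℕ) :
    Sem G (mux s a b) fun p => v p = if v s then v a else v b := by
  unfold SelfProv.mux
  refine (hv.emit _ _ _).bind fun x hx => (hv.emit _ _ _).bind fun y hy =>
    (hv.emit _ _ _).mono fun p hp => ?_
  rw [hp, hx, hy]
  cases v s <;> simp

theorem anyOf (hv : Cons v G) (l : List ℕ) :
    Sem G (anyOf l) fun p => v p = decide (0 < val v l) := by
  induction l with
  | nil => exact hv.const false
  | cons a l ih =>
    refine ih.bind fun x hx => (hv.emit _ _ _).mono fun p hp => ?_
    rw [hp, hx, val_cons]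
    cases v a <;> simp

theorem constList (hv : Cons v G) (l : List Bool) :
    Sem G (constList l) fun r => r.map v = l := by
  induction l with
  | nil => exact .pure rfl
  | cons b l ih =>
    exact (hv.const b).bind fun x hx => ih.bind fun y hy => .pure (by simp [hx, hy])

theorem constBits (hv : Cons v G) (n x : ℕ) :
    Sem G (constBits n x) fun r => r.length = n ∧ val v r = x % 2 ^ n := by
  refine (hv.constList (bits n x)).mono fun r hr => ⟨?_, ?_⟩
  · simpa using congrArg List.length hr
  · rw [val, hr, ofBits_bits]

theorem muxList (hv : Cons v G) (s : ℕ) (l k : List ℕ) (h : l.length = k.length) :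
    Sem G (muxList s l k) fun r => r.map v = if v s then l.map v else k.map v := by
  induction l generalizing k with
  | nil =>
    cases k with
    | nil => unfold SelfProv.muxList; exact .pure (by simp)
    | cons => simp at h
  | cons a l ih =>
    cases k with
    | nil => simp at h
    | cons b k =>
      refine (hv.mux s a b).bind fun x hx => (ih k (by simpa using h)).bind fun y hy => .pure ?_
      simp only [List.map_cons, hx, hy]
      split <;> rfl

theorem muxList_val (hv : Cons v G) (s : ℕ) (l k : List ℕ) (h : l.length = k.length) :
    Sem G (SelfProv.muxList s l k) fun r => r.length = k.length ∧
      val v r = if v s then val v l else val v k := by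
  refine (hv.muxList s l k h).mono fun r hr => ⟨?_, ?_⟩
  · have := congrArg List.length hr
    split at this <;> simp at this <;> omega
  · rw [val, hr]; split <;> rfl

theorem notList (hv : Cons v G) (l : List ℕ) :
    Sem G (notList l) fun r => r.length = l.length ∧ val v r + val v l + 1 = 2 ^ l.length := by
  induction l with
  | nil => exact .pure ⟨rfl, rfl⟩
  | cons a l ih =>
    refine Sem.bind (m := bnot a) (hv.emit _ _ _) fun x hx => ih.bind fun y hy => .pure ?_
    refine ⟨by simp [hy.1], ?_⟩
    rw [val_cons, val_cons, hx, List.length_cons, pow_succ, ← hy.2]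
    cases v a <;> simp <;> ring

theorem eqList (hv : Cons v G) (l k : List ℕ) (h : l.length = k.length) :
    Sem G (eqList l k) fun p => v p = decide (val v l = val v k) := by
  induction l generalizing k with
  | nil =>
    cases k with
    | nil => unfold SelfProv.eqList; exact hv.const true
    | cons => simp at h
  | cons a l ih =>
    cases k with
    | nil => simp at h
    | cons b k =>
      refine Sem.bind (m := bxnor a b) (hv.emit _ _ _) fun x hx =>
        (ih k (by simpa using h)).bind fun y hy => (hv.emit _ _ _).mono fun p hp => ?_
      rw [hp, hx, hy, val_cons, val_cons]
      cases v a <;> cases v b <;> simp <;> omega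

theorem addCarry (hv : Cons v G) (l k : List ℕ) (c : ℕ) (h : l.length = k.length) :
    Sem G (addCarry l k c) fun r => r.1.length = k.length ∧
      val v r.1 + 2 ^ k.length * (v r.2).toNat = val v l + val v k + (v c).toNat := by
  induction l generalizing k c with
  | nil =>
    cases k with
    | nil => unfold SelfProv.addCarry; exact .pure ⟨rfl, by simp [val, ofBits]⟩
    | cons => simp at h
  | cons a l ih =>
    cases k with
    | nil => simp at h
    | cons b k =>
      refine Sem.bind (m := bxor a b) (hv.emit _ _ _) fun x hx =>
        Sem.bind (m := bxor x c) (hv.emit _ _ _) fun s hs =>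
        Sem.bind (m := band a b) (hv.emit _ _ _) fun y hy =>
        Sem.bind (m := band x c) (hv.emit _ _ _) fun z hz =>
        Sem.bind (m := bor y z) (hv.emit _ _ _) fun c' hc' =>
        (ih k c' (by simpa using h)).bind fun r hr => .pure ⟨by simp [hr.1], ?_⟩
      simp only [val_cons, List.length_cons, pow_succ]
      have e : (v s).toNat + 2 * (v c').toNat = (v a).toNat + (v b).toNat + (v c).toNat := by
        rw [hs, hc', hy, hz, hx]
        cases v a <;> cases v b <;> cases v c <;> rfl
      linarith [hr.2]

theorem add (hv : Cons v G) (l k : List ℕ) (h : l.length = k.length) :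
    Sem G (add l k) fun r => r.length = k.length ∧
      val v r = (val v l + val v k) % 2 ^ k.length := by
  refine (hv.const false).bind fun c hc => (hv.addCarry l k c h).bind fun r hr => .pure ⟨hr.1, ?_⟩
  have h1 := val_lt v r.1
  rw [hr.1] at h1
  have h2 := hr.2
  rw [hc, Bool.toNat_false, add_zero] at h2
  rw [← h2, Nat.add_mul_mod_self_left, Nat.mod_eq_of_lt h1]

theorem sub (hv : Cons v G) (l k : List ℕ) (h : l.length = k.length) :
    Sem G (sub l k) fun r => r.1.length = k.length ∧ v r.2 = decide (val v k ≤ val v l) ∧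
      (val v k ≤ val v l → val v r.1 = val v l - val v k) := by
  refine (hv.notList k).bind fun y hy => (hv.const true).bind fun c hc =>
    (hv.addCarry l y c (by rw [h, hy.1])).mono fun r hr => ?_
  rw [hy.1, hc] at hr
  have h1 := val_lt v r.1
  rw [hr.1] at h1
  have h2 := hr.2
  have h3 := hy.2
  simp only [Bool.toNat_true] at h2
  have h4 := val_lt v l
  rw [h] at h4
  refine ⟨hr.1, ?_, ?_⟩
  · cases e : v r.2 <;> simp [e] at h2 ⊢ <;> omega
  · cases e : v r.2 <;> simp [e] at h2 ⊢ <;> omega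

theorem geq (hv : Cons v G) (l k : List ℕ) (h : l.length = k.length) :
    Sem G (geq l k) fun p => v p = decide (val v k ≤ val v l) :=
  (hv.sub l k h).bind fun _ hr => .pure hr.2.1

theorem condSub (hv : Cons v G) (m : ℕ) (l : List ℕ) (hm : m < 2 ^ l.length) :
    Sem G (condSub m l) fun r => r.length = l.length ∧
      val v r = if m ≤ val v l then val v l - m else val v l := by
  refine (hv.constBits _ m).bind fun c hc => (hv.sub l c hc.1.symm).bind fun r hr =>
    (hv.muxList_val _ _ _ (by rw [hr.1, hc.1])).mono fun t ht => ⟨ht.1, ?_⟩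
  rw [ht.2, hr.2.1, hc.2, Nat.mod_eq_of_lt hm]
  simp only [decide_eq_true_eq]
  split
  · next h => rw [hr.2.2 (by rwa [hc.2, Nat.mod_eq_of_lt hm]), hc.2, Nat.mod_eq_of_lt hm]
  · rfl

theorem mulConst (hv : Cons v G) (w m : ℕ) (l : List ℕ) :
    Sem G (mulConst w m l) fun r => r.length = w ∧ val v r = val v l * m % 2 ^ w := by
  induction l with
  | nil => exact (hv.constBits w 0).mono fun r hr => ⟨hr.1, by simp [hr.2]⟩
  | cons a l ih =>
    refine ih.bind fun acc hacc => (hv.const false).bind fun z hz =>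
      (hv.constBits w 0).bind fun zs hzs => (hv.constBits w m).bind fun c hc =>
      (hv.muxList_val a c zs (by rw [hc.1, hzs.1])).bind fun t ht =>
      (hv.add _ _ (by simp [ht.1, hzs.1, hacc.1])).mono fun r hr => ?_
    rw [ht.1, hzs.1] at hr
    refine ⟨hr.1, ?_⟩
    rw [hr.2, val_take _ _ _ (by simp [hacc.1]), val_cons, hz, ht.2, hacc.2, hc.2, hzs.2, val_cons]
    have e1 : (2 * (val v l * m % 2 ^ w)) ≡ 2 * (val v l * m) [MOD 2 ^ w] :=
      (Nat.mod_modEq _ _).mul_left 2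
    have e2 : (if v a = true then m % 2 ^ w else 0 % 2 ^ w) ≡ (v a).toNat * m [MOD 2 ^ w] := by
      cases v a <;> simp [Nat.ModEq]
    have e3 := ((Nat.mod_modEq _ _).trans e1).add e2
    simp only [Bool.toNat_false, zero_add]
    refine e3.trans (congrArg (· % _) ?_)
    ring

theorem count (hv : Cons v G) (w : ℕ) (l : List ℕ) :
    Sem G (count w l) fun r => r.length = w ∧ val v r = (l.countP v) % 2 ^ w := by
  induction l with
  | nil => exact (hv.constBits w 0).mono fun r hr => ⟨hr.1, by simp [hr.2]⟩
  | cons a l ih =>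
    refine ih.bind fun acc hacc => (hv.constBits w 0).bind fun zs hzs =>
      (hv.addCarry acc zs a (by rw [hacc.1, hzs.1])).bind fun r hr => .pure ?_
    rw [hzs.1, hzs.2, hacc.2] at hr
    refine ⟨hr.1, ?_⟩
    have h1 := val_lt v r.1
    rw [hr.1] at h1
    rw [← Nat.mod_eq_of_lt h1, ← Nat.add_mul_mod_self_left (val v r.1) (2 ^ w) (v r.2).toNat, hr.2,
      List.countP_cons]
    have e : (v a).toNat = if v a = true then 1 else 0 := by cases v a <;> rfl
    simp [e]

theorem addMod (hv : Cons v G) (n q : ℕ) (hq : q ≤ 2 ^ n) (x y : List ℕ) (hx : x.length = n)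
    (hy : y.length = n) (hxq : val v x < q) (hyq : val v y < q) :
    Sem G (addMod n q x y) fun r => r.length = n ∧ val v r = (val v x + val v y) % q := by
  refine (hv.const false).bind fun z hz => (hv.add (x ++ [z]) (y ++ [z]) (by simp [hx, hy])).bind
    fun s hs => ?_
  rw [val_snoc_false hz, val_snoc_false hz, List.length_append, hy, List.length_singleton,
    pow_succ, Nat.mod_eq_of_lt (by omega)] at hs
  refine (hv.condSub q s (by rw [hs.1, pow_succ]; omega)).bind fun r hr => .pure ?_
  rw [hs.1, hs.2] at hr
  refine ⟨by simp [hr.1], ?_⟩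
  rw [val_take _ _ _ (by omega), hr.2]
  split
  · next h => rw [Nat.mod_eq_of_lt (by omega), Nat.mod_eq_sub_mod h, Nat.mod_eq_of_lt (by omega)]
  · next h => rw [Nat.mod_eq_of_lt (by omega), Nat.mod_eq_of_lt (by omega)]

theorem mulMod (hv : Cons v G) (n q : ℕ) (hq : q ≤ 2 ^ n) (x y : List ℕ) (hx : x.length = n)
    (hxq : val v x < q) :
    Sem G (mulMod n q x y) fun r => r.length = n ∧ val v r = val v x * val v y % q := by
  induction y with
  | nil => exact (hv.constBits n 0).mono fun r hr => ⟨hr.1, by simp [hr.2]⟩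
  | cons b y ih =>
    have hq0 : 0 < q := by omega
    refine ih.bind fun acc hacc => (hv.addMod n q hq acc acc hacc.1 hacc.1
      (hacc.2 ▸ Nat.mod_lt _ hq0) (hacc.2 ▸ Nat.mod_lt _ hq0)).bind fun d hd =>
      (hv.addMod n q hq d x hd.1 hx (hd.2 ▸ Nat.mod_lt _ hq0) hxq).bind fun s hs =>
      (hv.muxList_val b s d (by rw [hs.1, hd.1])).mono fun r hr => ⟨by rw [hr.1, hd.1], ?_⟩
    have e1 : val v d ≡ 2 * (val v x * val v y) [MOD q] := by
      rw [hd.2, hacc.2, ← two_mul]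
      exact (Nat.mod_modEq _ _).trans ((Nat.mod_modEq _ _).mul_left 2)
    have hlt : val v r < q := by
      rw [hr.2]
      split
      · exact hs.2 ▸ Nat.mod_lt _ hq0
      · exact hd.2 ▸ Nat.mod_lt _ hq0
    rw [← Nat.mod_eq_of_lt hlt, hr.2, val_cons]
    cases v b
    · refine Nat.ModEq.trans (by simpa using e1) (congrArg (· % _) ?_)
      simp; ring
    · have e2 : val v s ≡ 2 * (val v x * val v y) + val v x [MOD q] := by
        rw [hs.2]; exact (Nat.mod_modEq _ _).trans (e1.add_right _)
      refine Nat.ModEq.trans (by simpa using e2) (congrArg (· % _) ?_)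
      simp; ring

theorem powMod (hv : Cons v G) (n q g : ℕ) (hq : q ≤ 2 ^ n) (hq1 : 1 < q) (hg : g < q)
    (y : List ℕ) :
    Sem G (powMod n q g y) fun r => r.length = n ∧ val v r = g ^ val v y % q := by
  induction y with
  | nil =>
    refine (hv.constBits n 1).mono fun r hr => ⟨hr.1, ?_⟩
    simp [hr.2, Nat.mod_eq_of_lt hq1, Nat.mod_eq_of_lt (hq1.trans_le hq)]
  | cons b y ih =>
    have hq0 : 0 < q := by omega
    refine ih.bind fun acc hacc => (hv.mulMod n q hq acc acc hacc.1
      (hacc.2 ▸ Nat.mod_lt _ hq0)).bind fun d hd =>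
      (hv.constBits n g).bind fun c hc =>
      (hv.mulMod n q hq d c hd.1 (hd.2 ▸ Nat.mod_lt _ hq0)).bind fun s hs =>
      (hv.muxList_val b s d (by rw [hs.1, hd.1])).mono fun r hr => ⟨by rw [hr.1, hd.1], ?_⟩
    have e1 : val v d ≡ g ^ (2 * val v y) [MOD q] := by
      rw [hd.2, hacc.2, two_mul, pow_add]
      exact (Nat.mod_modEq _ _).trans ((Nat.mod_modEq _ _).mul (Nat.mod_modEq _ _))
    have hlt : val v r < q := by
      rw [hr.2]
      split
      · exact hs.2 ▸ Nat.mod_lt _ hq0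
      · exact hd.2 ▸ Nat.mod_lt _ hq0
    rw [← Nat.mod_eq_of_lt hlt, hr.2, val_cons]
    cases v b
    · simpa [Nat.ModEq] using e1
    · have e2 : val v s ≡ g ^ (1 + 2 * val v y) [MOD q] := by
        rw [hs.2, hc.2, Nat.mod_eq_of_lt (hg.trans_le hq), add_comm, pow_succ]
        exact (Nat.mod_modEq _ _).trans (e1.mul_right _)
      simpa [Nat.ModEq] using e2

theorem inGroup (hv : Cons v G) (n q : ℕ) (hq : q ≤ 2 ^ n) (x : List ℕ) (hx : x.length = n) :
    Sem G (inGroup n q x) fun p => v p = decide (0 < val v x ∧ val v x < q) := by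
  refine (hv.anyOf x).bind fun nz hnz => (hv.const false).bind fun z hz =>
    (hv.constBits (n + 1) q).bind fun c hc =>
    (hv.geq (x ++ [z]) c (by simp [hx, hc.1])).bind fun g hg =>
    Sem.bind (m := bnot g) (hv.emit _ _ _) fun l hl => (hv.emit _ _ _).mono fun p hp => ?_
  rw [hp, hnz, hl, hg, val_snoc_false hz, hc.2, Nat.mod_eq_of_lt (by rw [pow_succ]; omega)]
  rw [Bool.eq_iff_iff]
  simp

theorem subExp (hv : Cons v G) (n q : ℕ) (hq : q ≤ 2 ^ n) (hq' : 2 ^ n ≤ 2 * (q - 1))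
    (l r : List ℕ) (hl : l.length = n) (hr : r.length = n) (hr0 : 0 < val v r)
    (hrq : val v r < q) :
    Sem G (subExp n q l r) fun a => a.length = n ∧
      val v a + val v r ≡ val v l [MOD (q - 1)] := by
  have hlt := val_lt v l
  rw [hl] at hlt
  have hp : 2 ^ (n + 1) = 2 * 2 ^ n := pow_succ' 2 n
  refine (hv.const false).bind fun z hz =>
    (hv.condSub (q - 1) (l ++ [z]) (by simp [hl]; omega)).bind fun l' hl' =>
    (hv.constBits (n + 1) (q - 1)).bind fun c hc =>
    (hv.sub c (r ++ [z]) (by simp [hr, hc.1])).bind fun r' hr' =>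
    (hv.add l' r'.1 (by simp [hl'.1, hr'.1, hl, hr])).bind fun s hs =>
    (hv.condSub (q - 1) s (by simp [hs.1, hr'.1, hr]; omega)).bind fun t ht => .pure ?_
  rw [val_snoc_false hz] at hl'
  rw [hc.2, val_snoc_false hz, Nat.mod_eq_of_lt (by omega)] at hr'
  have h1 := hr'.2.2 (by omega)
  rw [hr'.1, List.length_append, hr, List.length_singleton, h1] at hs
  have h2 : val v l' < q - 1 ∧ val v l' ≡ val v l [MOD (q - 1)] := by
    rw [hl'.2]
    split
    · next h => exact ⟨by omega, (Nat.modEq_iff_dvd' (by omega)).2 ⟨1, by omega⟩⟩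
    · exact ⟨by omega, rfl⟩
  rw [Nat.mod_eq_of_lt (by omega)] at hs
  rw [hs.1, hs.2] at ht
  refine ⟨by simp [ht.1], ?_⟩
  have h3 : val v t ≡ val v l' + (q - 1 - val v r) [MOD (q - 1)] := by
    rw [ht.2]
    split
    · next h => exact (Nat.modEq_iff_dvd' (by omega)).2 ⟨1, by omega⟩
    · exact rfl
  have h4 : val v t < 2 ^ n := by rw [ht.2]; split <;> omega
  rw [val_take _ _ _ (by omega), Nat.mod_eq_of_lt h4]
  refine (h3.add_right _).trans (Nat.ModEq.trans ?_ h2.2)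
  rw [add_assoc, Nat.sub_add_cancel (by omega)]
  exact (Nat.modEq_iff_dvd' (by omega)).2 ⟨1, by omega⟩ |>.symm

theorem selectFrom (hv : Cons v G) (p : List ℕ) (j : ℕ) (l : List ℕ) (a : ℕ)
    (h : j + l.length ≤ 2 ^ p.length) :
    Sem G (selectFrom p j l a) fun r =>
      v r = if j ≤ val v p ∧ val v p < j + l.length then v (l.getD (val v p - j) 0) else v a := by
  induction l generalizing j a with
  | nil =>
    refine .pure ?_
    rw [if_neg (by simp)]
  | cons b l ih =>
    simp only [List.length_cons] at h
    refine (hv.constBits _ j).bind fun c hc => (hv.eqList p c hc.1.symm).bind fun e he =>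
      (hv.mux e b a).bind fun m hm => (ih (j + 1) m (by omega)).mono fun r hr => ?_
    rw [hr, hm, he, hc.2, Nat.mod_eq_of_lt (by omega)]
    simp only [List.length_cons, decide_eq_true_eq]
    by_cases h1 : val v p = j
    · rw [if_neg (by omega), if_pos h1, if_pos (by omega), h1]; simp
    · by_cases h2 : j + 1 ≤ val v p ∧ val v p < j + 1 + l.length
      · rw [if_pos h2, if_pos (by omega)]
        obtain ⟨i, hi⟩ := Nat.exists_eq_add_of_le h2.1
        rw [hi, show j + 1 + i - (j + 1) = i by omega, show j + 1 + i - j = i + 1 by omega]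
        simp
      · rw [if_neg h2, if_neg h1, if_neg (by omega)]

/-- A pointer selects the wire it points to, or the wire `0` if there is none. -/
theorem select (hv : Cons v G) (l p : List ℕ) (h : l.length ≤ 2 ^ p.length) (h0 : l ≠ []) :
    Sem G (select l p) fun r =>
      v r = (l.map v).getD (if val v p < l.length then val v p else 0) false := by
  refine (hv.selectFrom p 0 l _ (by omega)).mono fun r hr => ?_
  rw [hr]
  have hl : 0 < l.length := List.length_pos_iff.2 h0
  by_cases h1 : val v p < l.length
  · rw [if_pos (by omega), if_pos h1]
    simp [h1]
  · rw [if_neg (by omega), if_neg h1]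
    cases l with
    | nil => exact absurd rfl h0
    | cons a l => simp

end Cons

end Sem

/-! ### Runs of circuits -/

theorem runGates_append (gs gs' : List Gate) (ws : List Bool) :
    runGates (gs ++ gs') ws = runGates gs' (runGates gs ws) := by
  induction gs generalizing ws with
  | nil => rfl
  | cons g gs ih => exact ih _

theorem length_runGates (gs : List Gate) (ws : List Bool) :
    (runGates gs ws).length = ws.length + gs.length := by
  induction gs generalizing ws with
  | nil => rfl
  | cons g gs ih => simp only [runGates, ih, List.length_append, List.length_cons, List.length_nil]; omega

theorem runGates_getD (gs : List Gate) (ws : List Bool) {i : ℕ} (hi : i < ws.length) :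
    (runGates gs ws).getD i false = ws.getD i false := by
  induction gs generalizing ws with
  | nil => rfl
  | cons g gs ih =>
    rw [runGates, ih _ (by simp; omega), List.getD_append _ _ _ _ hi]

/-- Running a well-formed netlist yields a consistent valuation. -/
theorem Netlist.WF.cons_runGates {s : Netlist} (hs : s.WF) {x : List Bool}
    (hx : x.length = s.inputs) : Cons (fun p => (runGates s.gates x).getD p false) s := by
  rintro p op a b ⟨i, hi, rfl⟩
  have hw := hs _ _ ⟨i, hi, rfl⟩
  obtain ⟨h1, h2⟩ := List.getElem?_eq_some_iff.1 hi
  have e : s.gates = s.gates.take i ++ s.gates[i] :: s.gates.drop (i + 1) := by simp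
  have hl : (runGates (s.gates.take i) x).length = s.inputs + i := by
    rw [length_runGates, hx, List.length_take]; omega
  simp only at hw ⊢
  rw [e, runGates_append, runGates, runGates_getD _ _ (by simp [hl]),
    runGates_getD _ _ (by simp [hl]; omega), runGates_getD _ _ (by simp [hl]; omega),
    List.getD_append_right _ _ _ _ (by simp [hl]), List.getD_append _ _ _ _ (by omega),
    List.getD_append _ _ _ _ (by omega), hl, h2]
  simp [Gate.eval]

theorem Netlist.wf_nil (n : ℕ) : (⟨n, []⟩ : Netlist).WF := by
  rintro p g ⟨i, hi, _⟩
  simp at hi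

/-- The circuit that is built on `N` inputs. -/
def toCircuit (N : ℕ) (m : Build Wire) : Circuit :=
  ⟨(m.run ⟨N, []⟩).2.gates, [(m.run ⟨N, []⟩).1]⟩

theorem runs_self {α : Type} (m : Build α) (s : Netlist) :
    Runs (m.run s).2 m (m.run s).1 := ⟨s, rfl, .refl _⟩

theorem Netlist.WF.gates {s : Netlist} (h : s.WF) (i : ℕ) (hi : i < s.gates.length) :
    (s.gates[i]).left < s.inputs + i ∧ (s.gates[i]).right < s.inputs + i :=
  h _ _ ⟨i, List.getElem?_eq_getElem hi, rfl⟩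

theorem toCircuit_spec {N t : ℕ} (hN : 0 < N) {m : Build Wire} [hm : Mono m]
    (h : Good m N t fun B (p : ℕ) => p < B) :
    (toCircuit N m).WF N 1 ∧ (toCircuit N m).size ≤ t ∧
      ∀ x : List Bool, x.length = N → ∃ v, Cons v (m.run ⟨N, []⟩).2 ∧
        (∀ i < N, v i = x.getD i false) ∧
        (toCircuit N m).eval x = [v (m.run ⟨N, []⟩).1] := by
  obtain ⟨h1, h2, h3⟩ := h ⟨N, []⟩ (by simp [Netlist.width]) (by simpa [Netlist.width])
  have hi : (m.run ⟨N, []⟩).2.inputs = N := (hm.le ⟨N, []⟩).1.symm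
  have hw := h2 (Netlist.wf_nil N)
  refine ⟨⟨fun i h => by have := hw.gates i h; rwa [hi] at this, rfl, ?_⟩, ?_, fun x hx =>
    ⟨_, hw.cons_runGates (hx.trans hi.symm), fun i h => runGates_getD _ _ (hx ▸ h), rfl⟩⟩
  · simp only [toCircuit, List.mem_singleton, forall_eq]
    simpa [Netlist.width, hi] using h3
  · have h4 : (m.run ⟨N, []⟩).2.gates.length ≤ t := by simpa [Netlist.width, hi] using h1
    exact h4

/-- On a well-formed circuit, a consistent valuation computes the values of all wires. -/
theorem Cons.map_range {v : ℕ → Bool} {G : Netlist} (hv : Cons v G) (hw : G.WF) :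
    (List.range G.width).map v = runGates G.gates ((List.range G.inputs).map v) := by
  have key : ∀ k ≤ G.gates.length, (List.range (G.inputs + k)).map v =
      runGates (G.gates.take k) ((List.range G.inputs).map v) := by
    intro k hk
    induction k with
    | zero => simp [runGates]
    | succ k ih =>
      have hk' : k < G.gates.length := by omega
      have := hw.gates k hk'
      rw [← List.take_concat_get' _ _ hk', runGates_append, ← ih (by omega), ← add_assoc,
        List.range_succ, List.map_append]
      simp only [runGates, List.map_cons, List.map_nil]
      rw [hv (G.inputs + k) (G.gates[k]).op (G.gates[k]).left (G.gates[k]).right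
        ⟨k, List.getElem?_eq_getElem hk', rfl⟩]
      simp [Gate.eval, this]
  have := key _ le_rfl
  rwa [List.take_length] at this

/-! ### Descriptions of circuits -/

/-- A pointer to the wires below `j`; a pointer that is out of range is redirected to `0`. -/
def capped (j p : ℕ) : ℕ := if p < j then p else 0

/-- The `s` gates described by a bit string, if pointers have `w` bits and `j` wires precede. -/
def decodeGates (w : ℕ) : ℕ → List Bool → ℕ → List Gate
  | 0, _, _ => []
  | s + 1, d, j =>
    ⟨fun a b => d.getD (2 * a.toNat + b.toNat) false, capped j (ofBits ((d.drop 4).take w)),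
      capped j (ofBits ((d.drop (4 + w)).take w))⟩ :: decodeGates w s (d.drop (4 + 2 * w)) (j + 1)

/-- The `o` output wires described by a bit string, if there are `j` wires. -/
def decodeOuts (w j : ℕ) : ℕ → List Bool → List ℕ
  | 0, _ => []
  | o + 1, d => capped j (ofBits (d.take w)) :: decodeOuts w j o (d.drop w)

/-- The circuit with `n` inputs, `s` gates and `o` outputs that a bit string describes. -/
def decodeCircuit (n s o : ℕ) (d : List Bool) : Circuit :=
  ⟨decodeGates (Nat.size (n + s)) s d n,
    decodeOuts (Nat.size (n + s)) (n + s) o (d.drop (s * (4 + 2 * Nat.size (n + s))))⟩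

theorem length_decodeGates (w s : ℕ) (d : List Bool) (j : ℕ) :
    (decodeGates w s d j).length = s := by
  induction s generalizing d j with
  | zero => rfl
  | succ s ih => simp [decodeGates, ih]

theorem length_decodeOuts (w j o : ℕ) (d : List Bool) : (decodeOuts w j o d).length = o := by
  induction o generalizing d with
  | zero => rfl
  | succ s ih => simp [decodeOuts, ih]

theorem capped_lt {j : ℕ} (hj : 0 < j) (p : ℕ) : capped j p < j := by
  unfold capped; split <;> assumption

theorem decodeGates_wf (w s : ℕ) (d : List Bool) {j : ℕ} (hj : 0 < j) (i : ℕ)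
    (hi : i < (decodeGates w s d j).length) :
    ((decodeGates w s d j)[i]).left < j + i ∧ ((decodeGates w s d j)[i]).right < j + i := by
  induction s generalizing d j i with
  | zero => simp [decodeGates] at hi
  | succ s ih =>
    cases i with
    | zero => exact ⟨capped_lt hj _, capped_lt hj _⟩
    | succ i =>
      simp only [decodeGates, List.length_cons, Nat.add_lt_add_iff_right] at hi
      have := ih (j := j + 1) (d.drop (4 + 2 * w)) (by omega) i hi
      simp only [decodeGates, List.getElem_cons_succ]
      omega

theorem decodeOuts_lt (w : ℕ) {j : ℕ} (hj : 0 < j) (o : ℕ) (d : List Bool) :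
    ∀ i ∈ decodeOuts w j o d, i < j := by
  induction o generalizing d with
  | zero => simp [decodeOuts]
  | succ s ih =>
    simp only [decodeOuts, List.mem_cons, forall_eq_or_imp]
    exact ⟨capped_lt hj _, ih _⟩

theorem decodeCircuit_wf {n : ℕ} (hn : 0 < n) (s o : ℕ) (d : List Bool) :
    (decodeCircuit n s o d).WF n o :=
  ⟨decodeGates_wf _ _ _ hn, length_decodeOuts _ _ _ _, by
    simpa only [decodeCircuit, length_decodeGates] using
      decodeOuts_lt _ (Nat.add_pos_left hn s) _ _⟩

theorem decodeCircuit_size (n s o : ℕ) (d : List Bool) : (decodeCircuit n s o d).size = s :=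
  length_decodeGates _ _ _ _

section
variable {v : ℕ → Bool} {G : Netlist}

theorem Cons.applyTable (hv : Cons v G) (l : List ℕ) (h : l.length = 4) (a b : ℕ) :
    Sem G (applyTable l a b) fun r =>
      v r = (l.map v).getD (2 * (v a).toNat + (v b).toNat) false := by
  unfold SelfProv.applyTable
  refine (hv.mux _ _ _).bind fun x hx => (hv.mux _ _ _).bind fun y hy =>
    (hv.mux _ _ _).mono fun r hr => ?_
  rw [hr, hx, hy]
  match l, h with
  | [_, _, _, _], _ => cases v a <;> cases v b <;> simp

theorem Cons.evalGates (hv : Cons v G) (w s : ℕ) (d l : List ℕ) (hd : s * (4 + 2 * w) ≤ d.length)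
    (hl : l.length + s ≤ 2 ^ w) (h0 : l ≠ []) :
    Sem G (evalGates w s d l) fun r => r.length = l.length + s ∧
      r.map v = runGates (decodeGates w s (d.map v) l.length) (l.map v) := by
  induction s generalizing d l with
  | zero => exact .pure ⟨rfl, rfl⟩
  | succ s ih =>
    have h2 : s * (4 + 2 * w) ≤ d.length - (4 + 2 * w) := by rw [Nat.succ_mul] at hd; omega
    have h1 : 4 + 2 * w ≤ d.length := le_trans (by nlinarith) hd
    have e1 : ((d.drop 4).take w).length = w := by simp; omega
    have e2 : ((d.drop (4 + w)).take w).length = w := by simp; omega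
    refine (hv.select l _ (by rw [e1]; omega) h0).bind fun a ha =>
      (hv.select l _ (by rw [e2]; omega) h0).bind fun b hb =>
      (hv.applyTable (d.take 4) (by simp; omega) a b).bind fun c hc =>
      (ih (d.drop (4 + 2 * w)) (l ++ [c]) (by simpa using h2) (by simp; omega) (by simp)).mono
        fun r hr => ⟨by rw [hr.1]; simp; omega, ?_⟩
    rw [hr.2, decodeGates, runGates, List.map_append, List.map_drop, List.length_append]
    congr 2
    simp only [List.map_cons, List.map_nil, hc, Gate.eval, ha, hb, capped, val, List.map_take,
      List.map_drop]
    congr 1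
    have h3 : ∀ x y : Bool, 2 * x.toNat + y.toNat < 4 := by decide
    have h4 := h3 ((List.map v l).getD (if ofBits (List.take w (List.drop 4 (List.map v d))) < l.length
      then ofBits (List.take w (List.drop 4 (List.map v d))) else 0) false)
      ((List.map v l).getD (if ofBits (List.take w (List.drop (4 + w) (List.map v d))) < l.length
      then ofBits (List.take w (List.drop (4 + w) (List.map v d))) else 0) false)
    rw [List.getD_eq_getElem?_getD, List.getElem?_take_of_lt h4, ← List.getD_eq_getElem?_getD]

theorem Cons.evalOuts (hv : Cons v G) (w o : ℕ) (d l : List ℕ) (hd : o * w ≤ d.length)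
    (hl : l.length ≤ 2 ^ w) (h0 : l ≠ []) :
    Sem G (evalOuts w l o d) fun r => r.map v =
      (decodeOuts w l.length o (d.map v)).map fun i => (l.map v).getD i false := by
  induction o generalizing d with
  | zero => exact .pure rfl
  | succ o ih =>
    have h2 : o * w ≤ d.length - w := by rw [Nat.succ_mul] at hd; omega
    have h1 : w ≤ d.length := le_trans (by nlinarith) hd
    refine (hv.select l _ (by simpa [h1] using hl) h0).bind fun a ha =>
      (ih (d.drop w) (by simpa using h2)).bind fun b hb => .pure ?_
    simp only [List.map_cons, ha, hb, decodeOuts, val, List.map_take, capped, List.map_drop]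

theorem Cons.evalDesc (hv : Cons v G) (n s o : ℕ) (hn : 0 < n) (d x : List ℕ)
    (hd : d.length = descLen n s o) (hx : x.length = n) :
    Sem G (evalDesc n s o d x) fun r =>
      r.map v = (decodeCircuit n s o (d.map v)).eval (x.map v) := by
  have h1 : n + s ≤ 2 ^ Nat.size (n + s) := (Nat.lt_size_self _).le
  have h0 : x ≠ [] := by rintro rfl; simp at hx; omega
  unfold SelfProv.evalDesc
  refine (hv.evalGates _ s d x (hd ▸ Nat.le_add_right _ _) (hx ▸ h1) h0).bind fun l hl =>
    (hv.evalOuts _ o _ l (by rw [List.length_drop, hd, descLen]; omega) (by rw [hl.1, hx]; exact h1)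
      (by rintro rfl; simp at hl; omega)).mono fun r hr => ?_
  rw [hr, hl.1, hl.2, hx, List.map_drop]
  rfl

end

/-- The description of a list of gates. -/
def encodeGates (w : ℕ) : List Gate → List Bool
  | [] => []
  | g :: gs => [g.op false false, g.op false true, g.op true false, g.op true true] ++
      (bits w g.left ++ (bits w g.right ++ encodeGates w gs))

theorem length_encodeGates (w : ℕ) (gs : List Gate) :
    (encodeGates w gs).length = gs.length * (4 + 2 * w) := by
  induction gs with
  | nil => simp [encodeGates]
  | cons g gs ih => simp [encodeGates, ih]; ring

theorem decodeGates_encodeGates (w : ℕ) (gs : List Gate) (d : List Bool) (j : ℕ)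
    (h : ∀ (i : ℕ) (h : i < gs.length), (gs[i]).left < j + i ∧ (gs[i]).right < j + i)
    (hw : j + gs.length ≤ 2 ^ w) : decodeGates w gs.length (encodeGates w gs ++ d) j = gs := by
  induction gs generalizing j with
  | nil => rfl
  | cons g gs ih =>
    have h0 := h 0 (by simp)
    simp only [List.length_cons] at hw
    simp only [List.getElem_cons_zero, add_zero] at h0
    rw [List.length_cons, decodeGates]
    congr 1
    · obtain ⟨op, a, b⟩ := g
      simp only [encodeGates] at h0 ⊢
      congr 1
      · funext x y; cases x <;> cases y <;> simp
      · simp [ofBits_bits, Nat.mod_eq_of_lt (show a < 2 ^ w by omega), capped, h0.1]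
      · rw [add_comm 4 w]
        simp [ofBits_bits, Nat.mod_eq_of_lt (show b < 2 ^ w by omega), capped, h0.2]
    · have e : (encodeGates w (g :: gs) ++ d).drop (4 + 2 * w) = encodeGates w gs ++ d := by
        rw [show 4 + 2 * w = 4 + (w + w) by ring]
        simp [encodeGates, ← List.drop_drop, List.drop_append]
      rw [e]
      refine ih (j + 1) (fun i hi => ?_) (by omega)
      have := h (i + 1) (by simpa using hi)
      simp only [List.getElem_cons_succ] at this
      omega

theorem decodeOuts_flatMap (w j : ℕ) (l : List ℕ) (hl : ∀ i ∈ l, i < j) (hw : j ≤ 2 ^ w) :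
    decodeOuts w j l.length (l.flatMap (bits w)) = l := by
  induction l with
  | nil => rfl
  | cons a l ih =>
    have ha := hl a (by simp)
    rw [List.length_cons, decodeOuts, List.flatMap_cons]
    rw [List.take_left' (by simp), List.drop_left' (by simp), ofBits_bits,
      ih fun i hi => hl i (by simp [hi]), Nat.mod_eq_of_lt (by omega), capped, if_pos ha]

/-- Every circuit has a description with any larger number of gates. -/
theorem Circuit.WF.exists_desc {C : Circuit} {n o s : ℕ} (hn : 0 < n) (hC : C.WF n o)
    (hs : C.size ≤ s) : ∃ d : List Bool, d.length = descLen n s o ∧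
      ∀ x, x.length = n → (decodeCircuit n s o d).eval x = C.eval x := by
  obtain ⟨k, rfl⟩ := Nat.exists_eq_add_of_le hs
  unfold Circuit.size at *
  set gs := C.gates ++ List.replicate k ⟨fun _ _ => false, 0, 0⟩ with hgs
  have hlen : gs.length = C.gates.length + k := by simp [hgs]
  set w := Nat.size (n + (C.gates.length + k)) with hw
  have hw' : n + (C.gates.length + k) ≤ 2 ^ w := (Nat.lt_size_self _).le
  refine ⟨encodeGates w gs ++ C.outs.flatMap (bits w), ?_, fun x hx => ?_⟩
  · rw [List.length_append, length_encodeGates, hlen, descLen, ← hC.2.1]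
    congr 1
    simp only [List.length_flatMap, length_bits, List.map_const', List.sum_replicate, smul_eq_mul]
    rfl
  · have h1 : decodeGates w gs.length (encodeGates w gs ++ C.outs.flatMap (bits w)) n = gs := by
      refine decodeGates_encodeGates w gs _ n (fun i hi => ?_) (by omega)
      rcases lt_or_ge i C.gates.length with h | h
      · simp only [hgs, List.getElem_append_left h]
        exact hC.1 i h
      · simp only [hgs, List.getElem_append_right h, List.getElem_replicate]
        omega
    have h2 : (encodeGates w gs ++ C.outs.flatMap (bits w)).drop
        ((C.gates.length + k) * (4 + 2 * w)) = C.outs.flatMap (bits w) :=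
      List.drop_left' (by rw [length_encodeGates, hlen])
    have h3 := decodeOuts_flatMap w (n + (C.gates.length + k)) C.outs
      (fun i hi => (hC.2.2 i hi).trans_le (by omega)) hw'
    rw [hC.2.1] at h3
    unfold decodeCircuit Circuit.eval
    simp only [← hw]
    rw [h2, h3, ← hlen, h1]
    refine List.map_congr_left fun i hi => ?_
    rw [hgs, runGates_append, runGates_getD _ _ (by rw [length_runGates, hx]; exact hC.2.2 i hi)]

/-! ### Formulas of circuits -/

namespace Formula

@[simp] theorem eval_bigAnd (v : ℕ → Bool) (l : List Formula) :
    (bigAnd l).eval v = true ↔ ∀ A ∈ l, A.eval v = true := by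
  induction l with
  | nil => simp [bigAnd, eval]
  | cons A l ih => simp [bigAnd, eval, ih]

@[simp] theorem eval_lit (v : ℕ → Bool) (A : Formula) (b : Bool) :
    (lit A b).eval v = true ↔ A.eval v = b := by
  cases b <;> simp [lit, eval]

@[simp] theorem eval_iff (v : ℕ → Bool) (A B : Formula) :
    (iff A B).eval v = true ↔ A.eval v = B.eval v := by
  simp only [iff, eval]
  cases A.eval v <;> cases B.eval v <;> simp

@[simp] theorem eval_ofOp (v : ℕ → Bool) (op : Bool → Bool → Bool) (A B : Formula) :
    (ofOp op A B).eval v = op (A.eval v) (B.eval v) := by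
  unfold ofOp
  cases h1 : op false false <;> cases h2 : op false true <;> cases h3 : op true false <;>
    cases h4 : op true true <;> cases h5 : A.eval v <;> cases h6 : B.eval v <;>
    simp [*, bigOr, lit, eval]

end Formula

/-- The formula that defines the output wire `p` of a gate. -/
def gateFormula (p : ℕ) (g : Gate) : Formula :=
  Formula.iff (.var p) (Formula.ofOp g.op (.var g.left) (.var g.right))

/-- The formulas that define the outputs of the gates of a netlist. -/
def Netlist.formulas (s : Netlist) : List Formula :=
  s.gates.mapIdx fun i g => gateFormula (s.inputs + i) g

theorem mem_formulas {s : Netlist} {A : Formula} :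
    A ∈ s.formulas ↔ ∃ p g, s.Has p g ∧ gateFormula p g = A := by
  simp only [Netlist.formulas, List.mem_mapIdx, Netlist.Has]
  constructor
  · rintro ⟨i, hi, rfl⟩
    exact ⟨_, _, ⟨i, List.getElem?_eq_getElem hi, rfl⟩, rfl⟩
  · rintro ⟨_, g, ⟨i, hi, rfl⟩, rfl⟩
    obtain ⟨h1, rfl⟩ := List.getElem?_eq_some_iff.1 hi
    exact ⟨i, h1, rfl⟩

theorem cons_iff {s : Netlist} {v : ℕ → Bool} :
    Cons v s ↔ (Formula.bigAnd s.formulas).eval v = true := by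
  simp only [Formula.eval_bigAnd, mem_formulas]
  constructor
  · rintro h _ ⟨p, g, hp, rfl⟩
    simpa [gateFormula, Formula.eval] using h _ _ _ _ hp
  · intro h p op a b hp
    simpa [gateFormula, Formula.eval] using h _ ⟨_, _, hp, rfl⟩

theorem toFormula_eq (N : ℕ) (m : Build Wire) [hm : Mono m] : toFormula N m =
    .imp (Formula.bigAnd (m.run ⟨N, []⟩).2.formulas) (.var (m.run ⟨N, []⟩).1) := by
  unfold toFormula Netlist.formulas gateFormula
  rw [← (hm.le ⟨N, []⟩).1]

theorem toFormula_tautology {N : ℕ} {m : Build Wire} [Mono m]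
    (h : ∀ v G, Cons v G → (m.run ⟨N, []⟩).2 = G → Sem G m fun p => v p = true) :
    (toFormula N m).Tautology := by
  intro v
  rw [toFormula_eq]
  cases e : (Formula.bigAnd (m.run ⟨N, []⟩).2.formulas).eval v
  · simp [Formula.eval, e]
  · simpa [Formula.eval, e] using h v _ (cons_iff.2 e) rfl _ (runs_self _ _)

/-! ### The combinatorial design -/

section Design

theorem sum_range_mul (F : ℕ → ℕ) (a k : ℕ) :
    ∑ x ∈ Finset.range (a * k), F x =
      ∑ d ∈ Finset.range k, ∑ x ∈ Finset.range a, F (a * d + x) := by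
  induction k with
  | zero => simp
  | succ k ih => rw [Nat.mul_succ, Finset.sum_range_add, ih, Finset.sum_range_succ]

theorem agreement_comm (Q m x y : ℕ) : agreement Q m x y = agreement Q m y x := by
  unfold agreement
  simp only [eq_comm]

theorem agreement_succ {Q m d x : ℕ} (hd : d < Q) (hx : x < Q ^ m) (y : ℕ) :
    agreement Q (m + 1) (Q ^ m * d + x) y =
      agreement Q m x y + if d = y / Q ^ m % Q then 1 else 0 := by
  have hQ : 0 < Q := by omega
  unfold agreement
  rw [List.range_succ, List.filter_append, List.length_append]
  congr 1
  · congr 1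
    refine List.filter_congr fun j hj => ?_
    rw [List.mem_range] at hj
    have e : (Q ^ m * d + x) / Q ^ j % Q = x / Q ^ j % Q := by
      obtain ⟨k, rfl⟩ := Nat.exists_eq_add_of_lt hj
      have : Q ^ (j + k + 1) * d + x = x + Q ^ j * (Q * (Q ^ k * d)) := by ring
      rw [this, Nat.add_mul_div_left _ _ (pow_pos hQ j), Nat.add_mul_mod_self_left]
    rw [e]
  · have e : (Q ^ m * d + x) / Q ^ m % Q = d := by
      rw [Nat.mul_add_div (pow_pos hQ m), Nat.div_eq_of_lt hx, add_zero, Nat.mod_eq_of_lt hd]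
    rw [List.filter_singleton, e]
    by_cases h : d = y / Q ^ m % Q <;> simp [h]

/-- The sum factors over the coordinates; each of them contributes at most `(Q - 1) + Q`. -/
theorem sum_pow_agreement_le (Q m y : ℕ) :
    ∑ x ∈ Finset.range (Q ^ m), Q ^ agreement Q m x y ≤ (2 * Q) ^ m := by
  induction m with
  | zero => simp [agreement]
  | succ m ih =>
    rw [pow_succ Q m, sum_range_mul]
    calc ∑ d ∈ Finset.range Q, ∑ x ∈ Finset.range (Q ^ m), Q ^ agreement Q (m + 1) (Q ^ m * d + x) y
        ≤ ∑ d ∈ Finset.range Q, ∑ x ∈ Finset.range (Q ^ m),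
          (1 + if d = y / Q ^ m % Q then Q else 0) * Q ^ agreement Q m x y := by
          refine Finset.sum_le_sum fun d hd => Finset.sum_le_sum fun x hx => ?_
          rw [agreement_succ (Finset.mem_range.1 hd) (Finset.mem_range.1 hx), pow_add, mul_comm]
          gcongr
          split <;> simp
      _ = (∑ d ∈ Finset.range Q, (1 + if d = y / Q ^ m % Q then Q else 0)) *
          ∑ x ∈ Finset.range (Q ^ m), Q ^ agreement Q m x y := by
          rw [Finset.sum_mul]; simp only [Finset.mul_sum]
      _ ≤ (2 * Q) * (2 * Q) ^ m := by
          gcongr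
          rw [Finset.sum_add_distrib, Finset.sum_ite_eq']
          simp only [Finset.sum_const, Finset.card_range, smul_eq_mul, mul_one]
          split <;> omega
      _ = (2 * Q) ^ (m + 1) := (pow_succ' _ _).symm

/-- Few words agree with a given one in more than `a` coordinates; this is Markov's inequality for
`Q` to the power of the agreement. -/
theorem card_agreement_le (Q m a y : ℕ) :
    ((Finset.range (Q ^ m)).filter fun x => a < agreement Q m x y).card * Q ^ (a + 1) ≤
      (2 * Q) ^ m := by
  rcases Nat.eq_zero_or_pos Q with rfl | hQ
  · simp
  refine le_trans ?_ (sum_pow_agreement_le Q m y)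
  rw [← smul_eq_mul, ← Finset.sum_const]
  refine le_trans (Finset.sum_le_sum fun x hx => ?_)
    (Finset.sum_le_sum_of_subset (Finset.filter_subset (fun x => a < agreement Q m x y) _))
  exact Nat.pow_le_pow_right hQ (Finset.mem_filter.1 hx).2

/-- By a union bound, some word fits to fewer than `Q ^ (a + 1) / 2 ^ m` given ones; so the greedy
construction does not get stuck. -/
theorem exists_word {Q m a : ℕ} (hQ : 0 < Q) (W : List ℕ)
    (h : W.length * 2 ^ m < Q ^ (a + 1)) :
    ∃ x < Q ^ m, ∀ y ∈ W, agreement Q m x y ≤ a := by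
  by_contra! hc
  have h1 : Finset.range (Q ^ m) ⊆ W.toFinset.biUnion fun y =>
      (Finset.range (Q ^ m)).filter fun x => a < agreement Q m x y := by
    intro x hx
    obtain ⟨y, hy, hxy⟩ := hc x (Finset.mem_range.1 hx)
    simp only [Finset.mem_biUnion, List.mem_toFinset, Finset.mem_filter]
    exact ⟨y, hy, hx, hxy⟩
  have h2 : Q ^ m * Q ^ (a + 1) ≤ W.length * (2 * Q) ^ m := by
    calc Q ^ m * Q ^ (a + 1) ≤ (∑ y ∈ W.toFinset, ((Finset.range (Q ^ m)).filter fun x =>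
          a < agreement Q m x y).card) * Q ^ (a + 1) := by
          gcongr
          simpa using (Finset.card_le_card h1).trans Finset.card_biUnion_le
      _ ≤ ∑ y ∈ W.toFinset, (2 * Q) ^ m := by
          rw [Finset.sum_mul]
          exact Finset.sum_le_sum fun y _ => card_agreement_le Q m a y
      _ ≤ W.length * (2 * Q) ^ m := by
          rw [Finset.sum_const, smul_eq_mul]
          gcongr
          exact List.toFinset_card_le W
  rw [mul_pow, ← mul_assoc, mul_comm (Q ^ m)] at h2
  exact absurd (Nat.le_of_mul_le_mul_right h2 (pow_pos hQ m)) (not_le.2 h)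

@[simp] theorem length_designWords (Q m a N : ℕ) : (designWords Q m a N).length = N := by
  induction N with
  | zero => rfl
  | succ N ih => simp [designWords, ih]

/-- The default word `0` of the greedy construction is never used. -/
theorem designWords_pairwise {Q m a : ℕ} (hQ : 0 < Q) (N : ℕ) (h : N * 2 ^ m < Q ^ (a + 1)) :
    (designWords Q m a N).Pairwise fun x y => agreement Q m x y ≤ a := by
  induction N with
  | zero => exact .nil
  | succ N ih =>
    have hN : N * 2 ^ m < Q ^ (a + 1) := lt_of_le_of_lt (by gcongr; omega) h
    rw [designWords, List.pairwise_append]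
    refine ⟨ih hN, List.pairwise_singleton _ _, fun y hy x hx => ?_⟩
    obtain ⟨x', hx', hxW⟩ := exists_word hQ (designWords Q m a N) (by simpa using hN)
    rw [List.mem_singleton] at hx
    cases e : (List.range (Q ^ m)).find? fun x => (designWords Q m a N).all fun y =>
        agreement Q m x y ≤ a with
    | none =>
      have h1 := List.find?_eq_none.1 e x' (List.mem_range.2 hx')
      simp only [List.all_eq_true, decide_eq_true_eq] at h1
      exact absurd hxW h1
    | some u =>
      have h1 := List.find?_some e
      simp only [List.all_eq_true, decide_eq_true_eq] at h1
      rw [e, Option.getD_some] at hx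
      rw [hx, agreement_comm]
      exact h1 y hy

end Design

/-! ### The hybrid argument -/

section Hybrid

variable {Z Y : Type} [Fintype Z] [Fintype Y] {n : ℕ}

/-- The first `i` bits come from `g`, the others from `x`. -/
def hybrid (g x : Fin n → Bool) (i : ℕ) : Fin n → Bool := fun j => if (j : ℕ) < i then g j else x j

/-- The indicator function of a Boolean. -/
def ind (b : Bool) : ℝ := if b then 1 else 0

/-- Averaging over all seeds may be done by first averaging over a part `y` of the seed. -/
theorem sum_update (upd : Z → Y → Z) (rest : Z → Y) (h1 : ∀ z y, upd (upd z y) (rest z) = z)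
    (h2 : ∀ z y, rest (upd z y) = y) (F : Z → ℝ) :
    ∑ z, ∑ y, F (upd z y) = Fintype.card Y * ∑ z, F z := by
  have hinv : Function.Involutive fun p : Z × Y => (upd p.1 p.2, rest p.1) := by
    rintro ⟨z, y⟩
    simp [h1, h2]
  rw [← Fintype.sum_prod_type' (f := fun z y => F (upd z y))]
  have := Equiv.sum_comp hinv.toPerm fun p : Z × Y => F p.1
  simp only [Function.Involutive.coe_toPerm] at this
  rw [this, Fintype.sum_prod_type, Finset.mul_sum]
  simp

/-- The guess for bit `i` of the generator that is obtained from the test `T`: guess `x i`, and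
keep the guess if the test accepts. -/
def guess (T : (Fin n → Bool) → Bool) (g x : Fin n → Bool) (i : Fin n) : Bool :=
  T (hybrid g x i) == x i

theorem hybrid_succ (g x : Fin n → Bool) (i : Fin n) :
    hybrid g x (i + 1) = Function.update (hybrid g x i) i (g i) := by
  funext j
  unfold hybrid
  by_cases h : j = i
  · subst h; simp
  · have : (j : ℕ) ≠ i := fun h' => h (Fin.ext h')
    rw [Function.update_of_ne h]
    by_cases h2 : (j : ℕ) < i
    · rw [if_pos h2, if_pos (by omega)]
    · rw [if_neg h2, if_neg (by omega)]

theorem hybrid_update (g x : Fin n → Bool) (i : Fin n) (b : Bool) :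
    hybrid g (Function.update x i b) i = Function.update (hybrid g x i) i b := by
  funext j
  unfold hybrid
  by_cases h : j = i
  · subst h; simp
  · simp [Function.update_of_ne h]

/-- The gain of the test from one hybrid to the next is the advantage of the guess. -/
theorem sum_hybrid_succ (T : (Fin n → Bool) → Bool) (g : Fin n → Bool) (i : Fin n) :
    ∑ x, (ind (T (hybrid g x (i + 1))) - ind (T (hybrid g x i)) -
      ind (guess T g x i == g i) + 1 / 2) = 0 := by
  have key : ∀ x : Fin n → Bool, ind (T (hybrid g x (i + 1))) - ind (T (hybrid g x i)) -
      ind (guess T g x i == g i) + 1 / 2 =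
      (if x i = g i then 1 else -1) * (1 / 2 - ind (T (Function.update (hybrid g x i) i (g i)))) := by
    intro x
    rw [hybrid_succ, guess]
    by_cases h : x i = g i
    · have e : Function.update (hybrid g x i) i (g i) = hybrid g x i := by
        rw [← h, ← hybrid_update, Function.update_eq_self]
      rw [e, if_pos h, h]
      cases T (hybrid g x i) <;> cases g i <;> simp [ind] <;> norm_num
    · rw [if_neg h]
      have h' : x i = !g i := by cases hx : x i <;> cases hg : g i <;> simp_all
      rw [h']
      generalize T (Function.update (hybrid g x i) i (g i)) = t
      cases t <;> cases T (hybrid g x i) <;> cases g i <;> simp [ind] <;> norm_num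
  simp only [key]
  refine Finset.sum_involution (fun x _ => Function.update x i (!x i)) (fun x _ => ?_)
    (fun x _ _ h => ?_) (fun _ _ => Finset.mem_univ _) (fun x _ => by simp)
  · rw [hybrid_update, Function.update_idem, Function.update_self]
    cases x i <;> cases g i <;> simp
  · have := congrFun h i
    simp at this

/-- If no guess is good, then the generator fools the test. Here `φ` is the base function, `rest i z` is
the part of the seed `z` on which bit `i` depends, and `upd i z y` replaces this part by `y`. The guess
has to be bad for all fixed values of the other part of the seed and of the random bits `x`. -/
theorem hybrid_argument (T : (Fin n → Bool) → Bool) (gen : Z → Fin n → Bool) (φ : Y → Bool) (η : ℝ)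
    (upd : Fin n → Z → Y → Z) (rest : Fin n → Z → Y)
    (h1 : ∀ i z y, upd i (upd i z y) (rest i z) = z) (h2 : ∀ i z y, rest i (upd i z y) = y)
    (hgen : ∀ i z, gen z i = φ (rest i z)) [Nonempty Y]
    (hT : ∀ i z x, ∑ y, ind (guess T (gen (upd i z y)) x i == φ y) ≤
      (1 / 2 + η) * Fintype.card Y) :
    (2 : ℝ) ^ n * ∑ z, ind (T (gen z)) ≤
      Fintype.card Z * ∑ x, ind (T x) + n * (η * (2 ^ n * Fintype.card Z)) := by
  set D : ℕ → ℝ := fun i => ∑ z, ∑ x, ind (T (hybrid (gen z) x i)) with hD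
  have hY : (0 : ℝ) < Fintype.card Y := by exact_mod_cast Fintype.card_pos
  -- neighbouring hybrids differ little, and the sum telescopes from the uniform strings `D 0` to the
  -- outputs `D n` of the generator
  have step : ∀ i : Fin n, D (i + 1) - D i ≤ η * (2 ^ n * Fintype.card Z) := by
    intro i
    have e1 : D (i + 1) - D i =
        ∑ z, ∑ x, ind (guess T (gen z) x i == gen z i) - 2 ^ n * Fintype.card Z / 2 := by
      have : ∀ z, ∑ x, ind (T (hybrid (gen z) x (i + 1))) - ∑ x, ind (T (hybrid (gen z) x i)) =
          ∑ x, ind (guess T (gen z) x i == gen z i) - 2 ^ n / 2 := by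
        intro z
        have := sum_hybrid_succ T (gen z) i
        simp only [Finset.sum_add_distrib, Finset.sum_sub_distrib, Finset.sum_const,
          Finset.card_univ, Fintype.card_fun, Fintype.card_bool, Fintype.card_fin, nsmul_eq_mul,
          Nat.cast_pow, Nat.cast_ofNat] at this
        linarith
      simp only [hD]
      rw [← Finset.sum_sub_distrib, Finset.sum_congr rfl fun z _ => this z,
        Finset.sum_sub_distrib]
      simp
      ring
    have e2 : ∑ z, ∑ x, ind (guess T (gen z) x i == gen z i) ≤
        (1 / 2 + η) * (2 ^ n * Fintype.card Z) := by
      rw [Finset.sum_comm]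
      have : ∀ x, ∑ z, ind (guess T (gen z) x i == gen z i) ≤ (1 / 2 + η) * Fintype.card Z := by
        intro x
        have e3 := sum_update (upd i) (rest i) (h1 i) (h2 i)
          fun z => ind (guess T (gen z) x i == gen z i)
        have e4 : ∑ z, ∑ y, ind (guess T (gen (upd i z y)) x i == gen (upd i z y) i) ≤
            ∑ z : Z, (1 / 2 + η) * Fintype.card Y := by
          refine Finset.sum_le_sum fun z _ => ?_
          simp only [hgen, h2]
          exact hT i z x
        rw [e3, Finset.sum_const, nsmul_eq_mul, Finset.card_univ] at e4
        refine le_of_mul_le_mul_left ?_ hY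
        linarith
      refine (Finset.sum_le_sum fun x _ => this x).trans ?_
      simp
      linarith
    rw [e1]
    linarith
  have total : ∀ i ≤ n, D i - D 0 ≤ i * (η * (2 ^ n * Fintype.card Z)) := by
    intro i hi
    induction i with
    | zero => simp
    | succ i ih =>
      have := step ⟨i, by omega⟩
      have := ih (by omega)
      simp only at *
      push_cast
      linarith
  have := total n le_rfl
  have e0 : D 0 = Fintype.card Z * ∑ x, ind (T x) := by
    have : ∀ g x : Fin n → Bool, hybrid g x 0 = x := fun g x => by funext j; simp [hybrid]
    simp [hD, this]
  have en : D n = 2 ^ n * ∑ z, ind (T (gen z)) := by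
    have : ∀ g x : Fin n → Bool, hybrid g x n = g := fun g x => by funext j; simp [hybrid]
    simp [hD, this, Finset.mul_sum]
  linarith

end Hybrid

/-! ### Predicting the base function -/

section Predictor

/-- A decision tree for a function of a list of wires and constants. -/
def lookup : List (ℕ ⊕ Bool) → (List Bool → Bool) → Build Wire
  | [], h => const (h [])
  | .inr b :: l, h => lookup l fun u => h (b :: u)
  | .inl w :: l, h => do
    let x ← lookup l fun u => h (true :: u)
    let y ← lookup l fun u => h (false :: u)
    mux w x y

instance (l : List (ℕ ⊕ Bool)) (h : List Bool → Bool) : Mono (lookup l h) := by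
  induction l generalizing h with
  | nil => unfold lookup; infer_instance
  | cons a l ih => cases a <;> unfold lookup <;> infer_instance

theorem Cons.lookup {v : ℕ → Bool} {G : Netlist} (hv : Cons v G) (l : List (ℕ ⊕ Bool))
    (h : List Bool → Bool) : Sem G (lookup l h) fun p => v p = h (l.map (Sum.elim v id)) := by
  induction l generalizing h with
  | nil => exact hv.const _
  | cons a l ih =>
    cases a with
    | inr b => exact (ih _).mono fun p hp => hp
    | inl w =>
      refine (ih _).bind fun x hx => (ih _).bind fun y hy => (hv.mux w x y).mono fun p hp => ?_
      rw [hp, hx, hy, List.map_cons, Sum.elim_inl]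
      cases v w <;> simp

theorem good_lookup {A : ℕ} (l : List (ℕ ⊕ Bool)) (h : List Bool → Bool)
    (hl : ∀ w, .inl w ∈ l → w < A) :
    Good (lookup l h) A (4 * 2 ^ l.countP Sum.isLeft - 3) fun B (p : ℕ) => p < B := by
  induction l generalizing h A with
  | nil => exact good_const.cost (by simp)
  | cons a l ih =>
    have hl' : ∀ w, .inl w ∈ l → w < A := fun w hw => hl w (by simp [hw])
    cases a with
    | inr b => exact (ih _ hl').cost (by simp)
    | inl w =>
      have hw := hl w (by simp)
      refine ((ih _ hl').bind fun x B hB hx => (ih (A := B) _ fun w hw => (hl' w hw).trans_le hB).bind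
        fun y C hC hy => good_mux (A := C) (by omega) (by omega) hy).cost ?_
      have : 0 < 2 ^ l.countP Sum.isLeft := by positivity
      rw [List.countP_cons_of_pos rfl, pow_succ]
      omega

/-- The test `T` on lists of length `n` is computed by the builder `mk`, using at most `t` gates. -/
structure Computes (n t : ℕ) (T : List Bool → Bool) (mk : List ℕ → Build Wire) : Prop where
  mono : ∀ l, Mono (mk l)
  good : ∀ A l, Bd A n l → Good (mk l) A t fun B (p : ℕ) => p < B
  sem : ∀ v G l, Cons v G → l.length = n → Sem G (mk l) fun p => v p = T (l.map v)

theorem Computes.not {n t : ℕ} {T : List Bool → Bool} {mk : List ℕ → Build Wire}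
    (h : Computes n t T mk) : Computes n (t + 1) (fun x => !T x) fun l => mk l >>= bnot where
  mono l := by have := h.mono l; infer_instance
  good A l hl := by
    have := h.mono l
    exact (h.good A l hl).bind fun p B _ hp => good_emit hp hp
  sem v G l hv hl := (h.sem v G l hv hl).bind fun p hp => (hv.emit _ p p).mono fun r hr => by
    rw [hr, hp]

/-- The bits of a seed. -/
def seedBit {N : ℕ} (z : Fin N → Bool) (k : ℕ) : Bool := if h : k < N then z ⟨k, h⟩ else false

/-- The output bit of the generator for the word `x` on the seed `z`. -/
def nwBit {N : ℕ} (f : List Bool → Bool) (Q m x : ℕ) (z : Fin N → Bool) : Bool :=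
  f ((List.range m).map fun l => seedBit z (Q * l + x / Q ^ l % Q))

/-- Replace the part of the seed that belongs to the word `x` by `y`. -/
def seedUpd {Q m : ℕ} (x : ℕ) (z : Fin (Q * m) → Bool) (y : Fin m → Bool) : Fin (Q * m) → Bool :=
  fun k => if (k : ℕ) % Q = x / Q ^ ((k : ℕ) / Q) % Q then
    y ⟨(k : ℕ) / Q, Nat.div_lt_of_lt_mul k.2⟩ else z k

theorem seed_index {Q m l : ℕ} (hQ : 0 < Q) (hl : l < m) (x : ℕ) :
    Q * l + x / Q ^ l % Q < Q * m ∧ (Q * l + x / Q ^ l % Q) / Q = l ∧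
      (Q * l + x / Q ^ l % Q) % Q = x / Q ^ l % Q := by
  have h := Nat.mod_lt (x / Q ^ l) hQ
  refine ⟨?_, ?_, ?_⟩
  · calc Q * l + x / Q ^ l % Q < Q * l + Q := by omega
      _ = Q * (l + 1) := by ring
      _ ≤ Q * m := Nat.mul_le_mul_left _ hl
  · rw [Nat.mul_add_div hQ, Nat.div_eq_of_lt h, add_zero]
  · rw [Nat.mul_add_mod, Nat.mod_mod]

theorem seedBit_upd {Q m l : ℕ} (hQ : 0 < Q) (hl : l < m) (x x' : ℕ) (z : Fin (Q * m) → Bool)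
    (y : Fin m → Bool) : seedBit (seedUpd x z y) (Q * l + x' / Q ^ l % Q) =
      if x' / Q ^ l % Q = x / Q ^ l % Q then y ⟨l, hl⟩ else
        seedBit z (Q * l + x' / Q ^ l % Q) := by
  obtain ⟨h1, h2, h3⟩ := seed_index hQ hl x'
  simp only [seedBit, h1, dif_pos, seedUpd, h2, h3]

/-- The part of the seed that belongs to the word `x`. -/
def seedPart {Q m : ℕ} (x : ℕ) (z : Fin (Q * m) → Bool) : Fin m → Bool :=
  fun l => seedBit z (Q * l + x / Q ^ (l : ℕ) % Q)

theorem seedPart_upd {Q m : ℕ} (hQ : 0 < Q) (x : ℕ) (z : Fin (Q * m) → Bool) (y : Fin m → Bool) :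
    seedPart x (seedUpd x z y) = y := by
  funext l
  rw [seedPart, seedBit_upd hQ l.2, if_pos rfl]

theorem seedUpd_part {Q m : ℕ} (x : ℕ) (z : Fin (Q * m) → Bool) (y : Fin m → Bool) :
    seedUpd x (seedUpd x z y) (seedPart x z) = z := by
  funext k
  by_cases h : (k : ℕ) % Q = x / Q ^ ((k : ℕ) / Q) % Q
  · have e : Q * ((k : ℕ) / Q) + x / Q ^ ((k : ℕ) / Q) % Q = k := by
      rw [← h, Nat.div_add_mod]
    simp only [seedUpd, if_pos h, seedPart, e, seedBit, k.2, dif_pos]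
  · simp only [seedUpd, if_neg h]

theorem nwBit_eq {Q m : ℕ} (f : List Bool → Bool) (x : ℕ) (z : Fin (Q * m) → Bool) :
    nwBit f Q m x z = f (List.ofFn (seedPart x z)) := by
  unfold nwBit seedPart
  congr 1
  apply List.ext_getElem <;> simp

/-- The predictor for the base function `f` that the hybrid argument yields, on `m` input wires. The
seed `z` outside of the `i`-th set and the random bits `x` are hard-wired. -/
def predictor (f : List Bool → Bool) (Q m : ℕ) (mk : List ℕ → Build Wire) (W : List ℕ) (i : ℕ)
    (z : Fin (Q * m) → Bool) (x : ℕ → Bool) : Build Wire := do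
  -- the bits `j < i` of the generator depend on few of the input wires, as the seed is fixed elsewhere
  let l ← (List.range W.length).mapM fun j =>
    if j < i then
      lookup ((List.range m).map fun l =>
        if W.getD j 0 / Q ^ l % Q = W.getD i 0 / Q ^ l % Q then .inl l
        else .inr (seedBit z (Q * l + W.getD j 0 / Q ^ l % Q))) f
    else const (x j)
  let t ← mk l
  emit (fun a _ => a == x i) t t


theorem Sem.mapM {G : Netlist} {v : ℕ → Bool} {α : Type} (f : α → Build Wire) [∀ a, Mono (f a)]
    (g : α → Bool) (l : List α) (h : ∀ a ∈ l, Sem G (f a) fun p => v p = g a) :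
    Sem G (l.mapM f) fun r => r.map v = l.map g := by
  induction l with
  | nil => rw [List.mapM_nil]; exact .pure rfl
  | cons a l ih =>
    rw [List.mapM_cons]
    exact (h a (by simp)).bind fun p hp => (ih fun b hb => h b (by simp [hb])).bind
      fun r hr => .pure (by simp [hp, hr])

instance (c : Prop) [Decidable c] (a b : Build Wire) [Mono a] [Mono b] :
    Mono (if c then a else b) := by split <;> infer_instance

variable {f : List Bool → Bool} {Q m n t a : ℕ} {T : List Bool → Bool} {mk : List ℕ → Build Wire}
  {W : List ℕ}

instance (i : ℕ) (z : Fin (Q * m) → Bool) (x : ℕ → Bool) [∀ l, Mono (mk l)] :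
    Mono (predictor f Q m mk W i z x) := by unfold predictor; infer_instance

/-- The output bits of the generator for the words `W`. -/
def nwBits (f : List Bool → Bool) (Q m n : ℕ) (W : List ℕ) (z : Fin (Q * m) → Bool) :
    Fin n → Bool := fun j => nwBit f Q m (W.getD j 0) z

theorem predictor_sem (hT : Computes n t T mk) (hW : W.length = n) (hQ : 0 < Q) (i : Fin n)
    (z : Fin (Q * m) → Bool) (x : Fin n → Bool) (y : Fin m → Bool) {v : ℕ → Bool} {G : Netlist}
    (hv : Cons v G) (hy : ∀ l : Fin m, v l = y l) :
    Sem G (predictor f Q m mk W i z (seedBit x)) fun p =>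
      v p = guess (fun x => T (List.ofFn x)) (nwBits f Q m n W (seedUpd (W.getD i 0) z y)) x i := by
  have hmono := hT.mono
  set g := nwBits f Q m n W (seedUpd (W.getD i 0) z y) with hg
  unfold predictor
  have hbit : ∀ j ∈ List.range W.length, Sem G (if j < i then
      lookup ((List.range m).map fun l =>
        if W.getD j 0 / Q ^ l % Q = W.getD i 0 / Q ^ l % Q then .inl l
        else .inr (seedBit z (Q * l + W.getD j 0 / Q ^ l % Q))) f
      else const (seedBit x j)) fun p => v p = seedBit (hybrid g x i) j := by
    intro j hj
    rw [List.mem_range, hW] at hj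
    split
    · next h =>
      refine (hv.lookup _ f).mono fun p hp => ?_
      rw [hp, seedBit, dif_pos hj, hybrid, if_pos h, hg, nwBits, nwBit, List.map_map]
      congr 1
      refine List.map_congr_left fun l hl => ?_
      rw [List.mem_range] at hl
      rw [seedBit_upd hQ hl, Function.comp_apply]
      split
      · exact hy ⟨l, hl⟩
      · rfl
    · next h =>
      refine (hv.const _).mono fun p hp => ?_
      rw [hp, seedBit, dif_pos hj, seedBit, dif_pos hj, hybrid, if_neg h]
  refine (Sem.mapM _ _ _ hbit).bind fun l hl => ?_
  have hlen : l.length = n := by simpa [hW] using congrArg List.length hl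
  refine (hT.sem v G l hv hlen).bind fun p hp => (hv.emit _ p p).mono fun r hr => ?_
  rw [hr, hp, hl, guess, hW]
  have e1 : (List.range n).map (seedBit (hybrid g x i)) = List.ofFn (hybrid g x i) := by
    apply List.ext_getElem
    · simp
    · intro j h1 h2
      simp only [List.length_map, List.length_range] at h1
      simp [seedBit, h1]
  rw [e1]
  simp [seedBit]

theorem predictor_good (hT : Computes n t T mk) (hW : W.length = n)
    (hpair : W.Pairwise fun x y => agreement Q m x y ≤ a) (i : Fin n)
    (z : Fin (Q * m) → Bool) (x : ℕ → Bool) :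
    Good (predictor f Q m mk W i z x) m (n * (4 * 2 ^ a) + t + 1) fun B (p : ℕ) => p < B := by
  have hmono := hT.mono
  unfold predictor
  have h2a : 0 < 2 ^ a := by positivity
  have hbit : ∀ j ∈ List.range W.length, ∀ B, m ≤ B → Good (if j < i then
      lookup ((List.range m).map fun l =>
        if W.getD j 0 / Q ^ l % Q = W.getD i 0 / Q ^ l % Q then .inl l
        else .inr (seedBit z (Q * l + W.getD j 0 / Q ^ l % Q))) f
      else const (x j)) B (4 * 2 ^ a) fun C (p : ℕ) => p < C := by
    intro j hj B hB
    rw [List.mem_range] at hj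
    split
    · next h =>
      refine (good_lookup _ f fun w hw => ?_).cost ?_
      · obtain ⟨l, hl, e⟩ := List.mem_map.1 hw
        split at e
        · cases e; exact (List.mem_range.1 hl).trans_le hB
        · cases e
      · have e : ((List.range m).map fun l =>
            if W.getD j 0 / Q ^ l % Q = W.getD i 0 / Q ^ l % Q then (.inl l : ℕ ⊕ Bool)
            else .inr (seedBit z (Q * l + W.getD j 0 / Q ^ l % Q))).countP Sum.isLeft =
            agreement Q m (W.getD j 0) (W.getD i 0) := by
          rw [List.countP_map, List.countP_eq_length_filter, agreement]
          congr 1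
          refine List.filter_congr fun l _ => ?_
          rw [Function.comp_apply]
          split
          · next h => rw [decide_eq_true h]; rfl
          · next h => rw [decide_eq_false h]; rfl
        rw [e]
        have h3 : agreement Q m (W.getD j 0) (W.getD i 0) ≤ a := by
          have hi : (i : ℕ) < W.length := hW.symm ▸ i.2
          rw [List.getD_eq_getElem _ _ hj, List.getD_eq_getElem _ _ hi]
          exact List.pairwise_iff_getElem.1 hpair j i hj hi h
        have := Nat.pow_le_pow_right (n := 2) two_pos h3
        omega
    · exact good_const.cost (by omega)
  exact ((good_mapM _ _ _ hbit).bind fun l B hB hl =>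
    (hT.good B l (by rwa [List.length_range, hW] at hl)).bind fun p C hC hp =>
      good_emit hp hp).cost (by rw [List.length_range, hW]; omega)

theorem card_filter_eq_sum_ind {α : Type} [Fintype α] (p : α → Prop) [DecidablePred p]
    (b : α → Bool) (h : ∀ x, p x ↔ b x = true) :
    ((Finset.univ.filter p).card : ℝ) = ∑ x, ind (b x) := by
  simp only [ind, Finset.sum_boole]
  congr 2
  ext x
  simp [h]

/-- Seeds as numbers and seeds as functions are the same. -/
theorem sum_seeds (N : ℕ) (F : (Fin N → Bool) → ℝ) :
    ∑ z ∈ Finset.range (2 ^ N), F (fun i => z.testBit i) = ∑ z, F z := by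
  refine Finset.sum_nbij' (fun z i => z.testBit i) (fun z => ofBits (List.ofFn z))
    (fun _ _ => Finset.mem_univ _) (fun z _ => ?_) (fun z hz => ?_) (fun z _ => ?_)
    (fun _ _ => rfl)
  · simpa using ofBits_lt (List.ofFn z)
  · rw [Finset.mem_range] at hz
    have e : List.ofFn (fun i : Fin N => z.testBit i) = bits N z := by
      apply List.ext_getElem <;> simp [bits]
    rw [e, ofBits_bits, Nat.mod_eq_of_lt hz]
  · funext i
    simp [testBit_ofBits]

/-- If the base function is hard on average, then the Nisan–Wigderson generator fools every test of
small circuit complexity. The term `4 * 2 ^ a` is the size of a decision tree for one output bit of the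
generator, which shares at most `a` inputs with the bit that is to be predicted. -/
theorem nw_fools (hT : Computes n t T mk) {η : ℝ} (hm : 0 < m) (hQ : 0 < Q)
    (hQa : n * 2 ^ m < Q ^ (a + 1))
    (hard : ∀ C : Circuit, C.WF m 1 → C.size ≤ n * (4 * 2 ^ a) + t + 1 →
      ¬ C.Approximates f m (1 / 2 + η)) :
    (2 : ℝ) ^ n * (((List.range (2 ^ (Q * m))).map (nwGen f Q m a n)).countP T : ℝ) ≤
      2 ^ (Q * m) * ∑ x : Fin n → Bool, ind (T (List.ofFn x)) + n * (η * (2 ^ n * 2 ^ (Q * m))) := by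
  have hmono := hT.mono
  set W := designWords Q m a n with hWdef
  have hW : W.length = n := length_designWords _ _ _ _
  have hpair := designWords_pairwise hQ n hQa
  have key := hybrid_argument (fun x => T (List.ofFn x)) (nwBits f Q m n W)
    (fun y : Fin m → Bool => f (List.ofFn y)) η (fun i z y => seedUpd (W.getD i 0) z y)
    (fun i z => seedPart (W.getD i 0) z) (fun i z y => seedUpd_part _ z y)
    (fun i z y => seedPart_upd hQ _ z y) (fun i z => nwBit_eq f _ z) ?_
  · simp only [Fintype.card_fun, Fintype.card_bool, Fintype.card_fin, Nat.cast_pow,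
      Nat.cast_ofNat] at key
    refine le_trans (le_of_eq ?_) key
    congr 1
    rw [← sum_seeds (Q * m) fun z => ind (T (List.ofFn (nwBits f Q m n W z))),
      List.countP_eq_length_filter, ← List.countP_eq_length_filter, List.countP_map]
    simp only [ind, Finset.sum_boole]
    congr 1
    rw [List.countP_eq_length_filter]
    have e : ∀ z ∈ List.range (2 ^ (Q * m)), (T ∘ nwGen f Q m a n) z =
        decide (T (List.ofFn (nwBits f Q m n W fun i => z.testBit i)) = true) := by
      intro z _
      rw [Function.comp_apply, Bool.decide_eq_true]
      congr 1
      apply List.ext_getElem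
      · simp [nwGen, designSets]
      · intro j h1 h2
        simp only [List.length_ofFn] at h2
        simp only [nwGen, designSets, List.map_map, List.getElem_map, List.getElem_ofFn,
          Function.comp_apply, nwBits, nwBit]
        rw [List.getD_eq_getElem _ _ (hW.symm ▸ h2)]
        congr 1
        refine List.map_congr_left fun l hl => ?_
        obtain ⟨h3, _⟩ := seed_index hQ (List.mem_range.1 hl) (W[j]'(hW.symm ▸ h2))
        rw [Function.comp_apply, seedBit, dif_pos h3]
    rw [List.filter_congr e]
    rfl
  · intro i z x
    have h1 := toCircuit_spec hm (predictor_good (f := f) hT hW hpair i z (seedBit x))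
    have h2 := hard _ h1.1 h1.2.1
    rw [Circuit.Approximates, not_le, div_lt_iff₀ (by positivity)] at h2
    rw [card_filter_eq_sum_ind _ fun y => guess (fun x => T (List.ofFn x))
      (nwBits f Q m n W (seedUpd (W.getD i 0) z y)) x i == f (List.ofFn y)] at h2
    · simpa using h2.le
    · intro y
      obtain ⟨v, hv, hy, he⟩ := h1.2.2 (List.ofFn y) (by simp)
      have := predictor_sem (f := f) hT hW hQ i z x y hv
        (fun l => by rw [hy l l.2]; simp) _ (runs_self _ _)
      rw [he, this]
      simp

end Predictor

/-! ### The hardness formulas are tautologies -/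

theorem ofFn_testBit (n z : ℕ) : List.ofFn (fun i : Fin n => z.testBit i) = bits n z := by
  apply List.ext_getElem <;> simp [bits]

/-- The number of `n`-bit strings that pass a test. -/
def uniformCount (n : ℕ) (T : List Bool → Bool) : ℕ :=
  (List.range (2 ^ n)).countP fun z => T (bits n z)

theorem sum_ind_eq_uniformCount (n : ℕ) (T : List Bool → Bool) :
    ∑ x : Fin n → Bool, ind (T (List.ofFn x)) = uniformCount n T := by
  rw [← sum_seeds n fun x => ind (T (List.ofFn x)), uniformCount, List.countP_eq_length_filter]
  simp only [ofFn_testBit, ind, Finset.sum_boole]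
  congr 1
  have e : ∀ z ∈ List.range (2 ^ n), T (bits n z) = decide (T (bits n z) = true) := by simp
  rw [List.filter_congr e]
  rfl

theorem countP_not_add {α : Type} (p : α → Bool) (l : List α) :
    l.countP (fun x => !p x) + l.countP p = l.length := by
  have := List.length_eq_countP_add_countP p (l := l)
  simp only [Bool.not_eq_true] at this
  rw [this, add_comm]
  congr 1
  exact List.countP_congr fun x _ => by simp

theorem countP_map_val (v : ℕ → Bool) (l : List ℕ) : l.countP v = (l.map v).countP id := by
  rw [List.countP_map]; rfl

/-- The formula is a tautology if each circuit of size exactly `s` makes at least `t` errors. -/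
theorem ttFormula_tautology (f : List Bool → Bool) {n s t : ℕ} (hn : 0 < n)
    (h : ∀ C : Circuit, C.WF n 1 → C.size = s →
      t ≤ uniformCount n fun x => xor ((C.eval x).headD false) (f x)) :
    (ttFormula f n s t).Tautology := by
  refine toFormula_tautology fun v G hv _ => ?_
  set C := decodeCircuit n s 1 ((List.range (descLen n s 1)).map v) with hC
  have hsem : ∀ y ∈ List.range (2 ^ n), Sem G (do
      let x ← constBits n y
      let out ← evalDesc n s 1 (List.range (descLen n s 1)) x
      let c ← const (f (bits n y))
      bxor (out.headD 0) c) fun p =>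
        v p = xor ((C.eval (bits n y)).headD false) (f (bits n y)) := by
    intro y hy
    refine (hv.constList (bits n y)).bind fun x hx =>
      (hv.evalDesc n s 1 hn _ x (by simp) (by simpa using congrArg List.length hx)).bind
      fun out hout => (hv.const _).bind fun c hc => (hv.emit _ _ _).mono fun p hp => ?_
    rw [← hC, hx] at hout
    have hl : out.length = 1 := by
      have := congrArg List.length hout
      simpa [Circuit.eval, (decodeCircuit_wf hn s 1 _).2.1, hC] using this
    rw [hp, hc, ← hout]
    match out, hl with
    | [a], _ => simp
  refine (Sem.mapM _ _ _ hsem).bind fun errs herrs => (hv.count _ errs).bind fun k hk =>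
    (hv.constBits _ _).bind fun c hc => (hv.geq k c (by rw [hk.1, hc.1])).mono fun p hp => ?_
  have h1 := h C (decodeCircuit_wf hn _ _ _) (decodeCircuit_size _ _ _ _)
  have h2 : errs.countP v = uniformCount n fun x => xor ((C.eval x).headD false) (f x) := by
    rw [countP_map_val, herrs, List.countP_map]; rfl
  have h3 : uniformCount n (fun x => xor ((C.eval x).headD false) (f x)) ≤ 2 ^ n :=
    List.countP_le_length.trans (by simp)
  have h4 : 2 ^ (n + 1) = 2 * 2 ^ n := pow_succ' 2 n
  have h5 : 0 < 2 ^ n := by positivity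
  rw [hp, hk.2, hc.2, h2, Nat.mod_eq_of_lt (by omega), Nat.mod_eq_of_lt (by omega)]
  simpa using h1

/-- Fewer than `(1/2 - 1/2^(ε n)) 2^n` errors would be an approximation that is too good. -/
theorem ttAxiom_tautology {ε : ℝ} {f : List Bool → Bool} {n : ℕ} (hn : 0 < n)
    (h : ∀ C : Circuit, C.WF n 1 → (C.size : ℝ) ≤ 2 ^ (ε * n) →
      ¬ C.Approximates f n (1 / 2 + 1 / 2 ^ (ε * n))) : (ttAxiom ε f n).Tautology := by
  have hpos : (0 : ℝ) < 2 ^ (ε * n) := by positivity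
  refine ttFormula_tautology f hn fun C hC hs => ?_
  · have h1 := h C hC (by rw [hs]; exact Nat.floor_le hpos.le)
    rw [Circuit.Approximates, not_le, div_lt_iff₀ (by positivity)] at h1
    rw [card_filter_eq_sum_ind _ fun x => (!(xor ((C.eval (List.ofFn x)).headD false)
      (f (List.ofFn x))))] at h1
    · rw [sum_ind_eq_uniformCount n fun x => !(xor ((C.eval x).headD false) (f x))] at h1
      have h2 := countP_not_add (fun z => xor ((C.eval (bits n z)).headD false) (f (bits n z)))
        (List.range (2 ^ n))
      rw [List.length_range] at h2
      have h3 : (uniformCount n (fun x => !(xor ((C.eval x).headD false) (f x))) : ℝ) +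
          uniformCount n (fun x => xor ((C.eval x).headD false) (f x)) = 2 ^ n := by
        unfold uniformCount
        exact_mod_cast h2
      rw [Nat.ceil_le]
      linarith
    · intro x
      have hl : (C.eval (List.ofFn x)).length = 1 := by simp [Circuit.eval, hC.2.1]
      match C.eval (List.ofFn x), hl with
      | [a], _ => cases a <;> cases f (List.ofFn x) <;> simp

/-! ### The random self-reduction of the discrete logarithm -/

/-- `q` is a prime and `g < q` generates the multiplicative group modulo `q`. -/
def IsGen (q g : ℕ) : Prop :=
  q.Prime ∧ ∃ u : (ZMod q)ˣ, (u : ZMod q).val = g ∧ ∀ x : (ZMod q)ˣ, x ∈ Subgroup.zpowers u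

/-- The test `x ∈ ℤ_q^× ∧ g ^ C(x) = x`. -/
def dlogHolds (q g : ℕ) (C : Circuit) (x : List Bool) : Bool :=
  decide (0 < ofBits x ∧ ofBits x < q) && decide (g ^ ofBits (C.eval x) % q = ofBits x)

/-- The test `1 ≤ r < q ∧ g ^ C(b g ^ r) = b g ^ r`; for `b` in the group, it is equivalent to the test
`1 ≤ r < q ∧ g ^ (C(b g ^ r) - r) = b` of the reduction. -/
def shiftHolds (q g : ℕ) (C : Circuit) (n b : ℕ) (r : List Bool) : Bool :=
  decide (0 < ofBits r ∧ ofBits r < q) &&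
    dlogHolds q g C (bits n (b * g ^ ofBits r % q))

section
variable {q g : ℕ}

theorem IsGen.lt (h : IsGen q g) : 1 < q ∧ g < q := by
  obtain ⟨hq, u, rfl, _⟩ := h
  have := Fact.mk hq
  exact ⟨hq.one_lt, ZMod.val_lt _⟩

theorem mod_eq_iff {x y : ℕ} (hy : y < q) : x % q = y ↔ (x : ZMod q) = y := by
  rw [ZMod.natCast_eq_natCast_iff', Nat.mod_eq_of_lt hy]

theorem IsGen.shift (h : IsGen q g) {a r l b : ℕ} (hbq : b < q)
    (hal : a + r ≡ l [MOD (q - 1)]) : g ^ a % q = b ↔ g ^ l % q = b * g ^ r % q := by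
  obtain ⟨hq, u, rfl, _⟩ := h
  have := Fact.mk hq
  rw [mod_eq_iff hbq, ← ZMod.natCast_eq_natCast_iff' _ _ q]
  push_cast
  rw [ZMod.natCast_zmod_val]
  have e : u ^ (a + r) = u ^ l := by
    have h1 : u ^ (q - 1) = 1 := ZMod.units_pow_card_sub_one_eq_one q u
    exact pow_eq_pow_of_modEq hal h1
  have e' : (u : ZMod q) ^ l = (u : ZMod q) ^ a * (u : ZMod q) ^ r := by
    rw [← pow_add]; exact_mod_cast (congrArg Units.val e).symm
  rw [e']
  have hu : (u : ZMod q) ^ r ≠ 0 := pow_ne_zero _ u.ne_zero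
  exact (mul_left_inj' hu).symm

theorem IsGen.pow_mod_pos (h : IsGen q g) (a : ℕ) : 0 < g ^ a % q := by
  obtain ⟨hq, u, rfl, _⟩ := h
  have := Fact.mk hq
  rw [Nat.pos_iff_ne_zero, Ne, mod_eq_iff hq.pos]
  push_cast
  rw [ZMod.natCast_zmod_val]
  exact pow_ne_zero _ u.ne_zero

theorem IsGen.shift_pos (h : IsGen q g) {b : ℕ} (hb : 0 < b) (hbq : b < q) (r : ℕ) :
    0 < b * g ^ r % q := by
  rw [Nat.pos_iff_ne_zero]
  intro h0
  have h1 := h.pow_mod_pos r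
  rcases h.1.dvd_mul.1 (Nat.dvd_of_mod_eq_zero h0) with h2 | h2
  · exact absurd (Nat.le_of_dvd hb h2) (by omega)
  · rw [Nat.mod_eq_zero_of_dvd h2] at h1
    omega

/-- The map `r ↦ b g ^ r` is onto. -/
theorem IsGen.exists_shift (h : IsGen q g) {b z : ℕ} (hb : 0 < b) (hbq : b < q) (hz : 0 < z)
    (hzq : z < q) : ∃ r, 0 < r ∧ r < q ∧ b * g ^ r % q = z := by
  obtain ⟨hq, u, rfl, hu⟩ := h
  have := Fact.mk hq
  have hq1 := hq.one_lt
  have hunit : ∀ x : ℕ, 0 < x → x < q → (x : ZMod q) ≠ 0 := by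
    intro x hx hxq
    rw [Ne, ZMod.natCast_eq_zero_iff]
    exact fun hd => absurd (Nat.le_of_dvd hx hd) (by omega)
  set w : (ZMod q)ˣ := (Units.mk0 _ (hunit b hb hbq))⁻¹ * Units.mk0 _ (hunit z hz hzq)
  obtain ⟨k, hk, hkw⟩ := ((isOfFinOrder_of_finite u).mem_zpowers_iff_mem_range_orderOf).1 (hu w)
    |> fun h => by simpa using h
  have hcard : orderOf u ≤ q - 1 := by
    have := orderOf_le_card_univ (x := u)
    rwa [ZMod.card_units_eq_totient, Nat.totient_prime hq] at this
  have key : ∀ r : ℕ, u ^ r = w → b * (u : ZMod q).val ^ r % q = z := by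
    intro r hr
    rw [mod_eq_iff hzq]
    push_cast
    rw [ZMod.natCast_zmod_val, ← Units.val_pow_eq_pow_val, hr]
    simp only [w, Units.val_mul, Units.val_inv_eq_inv_val, Units.val_mk0]
    rw [mul_inv_cancel_left₀ (hunit b hb hbq)]
  rcases Nat.eq_zero_or_pos k with rfl | hk0
  · refine ⟨q - 1, by omega, by omega, key _ ?_⟩
    rw [ZMod.units_pow_card_sub_one_eq_one q u, ← hkw, pow_zero]
  · exact ⟨k, hk0, by omega, key _ hkw⟩

/-- The self-reduction succeeds for a random `r` at least as often as the circuit for a random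
`n`-bit string. -/
theorem IsGen.count_le (h : IsGen q g) {n b : ℕ} (hqn : q ≤ 2 ^ n) (C : Circuit) (hb : 0 < b)
    (hbq : b < q) :
    uniformCount n (dlogHolds q g C) ≤ uniformCount n (shiftHolds q g C n b) := by
  have e : ∀ T : List Bool → Bool, uniformCount n T =
      ((Finset.range (2 ^ n)).filter fun z => T (bits n z) = true).card := by
    intro T
    rw [uniformCount, List.countP_eq_length_filter]
    have e : ∀ z ∈ List.range (2 ^ n), T (bits n z) = decide (T (bits n z) = true) := by simp
    rw [List.filter_congr e]
    rfl
  rw [e, e]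
  refine Finset.card_le_card_of_surjOn (fun r => b * g ^ r % q) fun z hz => ?_
  simp only [Finset.coe_filter, Finset.mem_range, Set.mem_ofPred_eq, Set.mem_image] at hz ⊢
  obtain ⟨hz1, hz2⟩ := hz
  have hz3 : 0 < z ∧ z < q := by
    have := hz2
    simp only [dlogHolds, Bool.and_eq_true, decide_eq_true_eq, ofBits_bits,
      Nat.mod_eq_of_lt hz1] at this
    exact this.1
  obtain ⟨r, hr, hrq, hrz⟩ := h.exists_shift hb hbq hz3.1 hz3.2
  refine ⟨r, ⟨by omega, ?_⟩, hrz⟩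
  simp [shiftHolds, ofBits_bits, Nat.mod_eq_of_lt (hrq.trans_le hqn), hrz, hr, hrq, hz2]

end

section
variable {v : ℕ → Bool} {G : Netlist} {n q g s : ℕ}

theorem map_eq_bits {v : ℕ → Bool} {l : List ℕ} {n : ℕ} (h : l.length = n) :
    l.map v = bits n (val v l) := by
  rw [val, ← h, ← List.length_map (f := v), bits_ofBits]

theorem Cons.dlogTest (hv : Cons v G) (hn : 0 < n) (hqn : q ≤ 2 ^ n) (hq : 1 < q) (hg : g < q)
    (d b : List ℕ) (hd : d.length = descLen n s n) (hb : b.length = n) :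
    Sem G (dlogTest n q g s d b) fun p =>
      v p = dlogHolds q g (decodeCircuit n s n (d.map v)) (b.map v) := by
  refine (hv.evalDesc n s n hn d b hd hb).bind fun l hl => (hv.powMod n q g hqn hq hg l).bind
    fun y hy => (hv.eqList y b (by rw [hy.1, hb])).bind fun e he =>
    (hv.inGroup n q hqn b hb).bind fun i hi => (hv.emit _ _ _).mono fun p hp => ?_
  rw [hp, he, hi, hy.2, dlogHolds, ← hl]
  rfl

set_option synthInstance.maxSize 1000 in
theorem Cons.reducedTest (hv : Cons v G) (hn : 0 < n) (hqn : q ≤ 2 ^ n) (hqn' : 2 ^ (n - 1) < q)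
    (hg : IsGen q g) (d b r : List ℕ) (hd : d.length = descLen n s n) (hb : b.length = n)
    (hr : r.length = n) (hb0 : 0 < val v b) (hbq : val v b < q) :
    Sem G (reducedTest n q g s d b r) fun p =>
      v p = shiftHolds q g (decodeCircuit n s n (d.map v)) n (val v b) (r.map v) := by
  obtain ⟨h1, h2⟩ := hg.lt
  have h2n : 2 ^ n ≤ 2 * (q - 1) := by
    have : 2 ^ n = 2 * 2 ^ (n - 1) := by rw [← pow_succ']; congr 1; omega
    omega
  unfold SelfProv.reducedTest
  by_cases hr' : 0 < val v r ∧ val v r < q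
  · refine (hv.powMod n q g hqn h1 h2 r).bind fun t ht =>
      (hv.mulMod n q hqn b t hb hbq).bind fun h hh => (hv.evalDesc n s n hn d h hd hh.1).bind
      fun l hl => ?_
    have hll : l.length = n := by
      simpa [Circuit.eval, (decodeCircuit_wf hn s n _).2.1] using congrArg List.length hl
    refine (hv.subExp n q hqn h2n l r hll hr hr'.1 hr'.2).bind
      fun a ha => (hv.powMod n q g hqn h1 h2 a).bind fun y hy =>
      (hv.eqList y b (by rw [hy.1, hb])).bind fun e he =>
      (hv.inGroup n q hqn r hr).bind fun i hi => (hv.emit _ _ _).mono fun p hp => ?_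
    have hval : val v h = val v b * g ^ val v r % q := by rw [hh.2, ht.2, Nat.mul_mod_mod]
    have hlt : val v h < q := hval ▸ Nat.mod_lt _ (by omega)
    have hpos := hg.shift_pos hb0 hbq (val v r)
    rw [hp, he, hi, hy.2, shiftHolds, dlogHolds]
    change _ = (decide (0 < val v r ∧ val v r < q) && _)
    congr 1
    rw [show ofBits (r.map v) = val v r from rfl, ← hval, ofBits_bits,
      Nat.mod_eq_of_lt (hlt.trans_le hqn), ← map_eq_bits hh.1, ← hl,
      decide_eq_true (show 0 < val v h ∧ val v h < q from ⟨hval ▸ hpos, hlt⟩), Bool.true_and]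
    congr 1
    rw [eq_iff_iff, hg.shift hbq ha.2, hval]
    rfl
  · refine Sem.bind (Q := fun _ => True) (fun _ _ => trivial) fun t _ =>
      Sem.bind (Q := fun _ => True) (fun _ _ => trivial) fun h _ =>
      Sem.bind (Q := fun _ => True) (fun _ _ => trivial) fun l _ =>
      Sem.bind (Q := fun _ => True) (fun _ _ => trivial) fun a _ =>
      Sem.bind (Q := fun _ => True) (fun _ _ => trivial) fun y _ =>
      Sem.bind (Q := fun _ => True) (fun _ _ => trivial) fun e _ =>
      (hv.inGroup n q hqn r hr).bind fun i hi => (hv.emit _ _ _).mono fun p hp => ?_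
    rw [hp, hi, shiftHolds]
    change _ = (decide (0 < val v r ∧ val v r < q) && _)
    rw [decide_eq_false hr']
    rfl

set_option synthInstance.maxSize 1000 in
/-- If `b = 0`, then every test of the reduction fails, as powers of `g` do not vanish. -/
theorem Cons.reducedTest_zero (hv : Cons v G) (hqn : q ≤ 2 ^ n) (hg : IsGen q g)
    (d b r : List ℕ) (hb : b.length = n) (hb0 : val v b = 0) :
    Sem G (SelfProv.reducedTest n q g s d b r) fun p => v p = false := by
  obtain ⟨h1, h2⟩ := hg.lt
  refine Sem.bind (Q := fun _ => True) (fun _ _ => trivial) fun t _ =>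
      Sem.bind (Q := fun _ => True) (fun _ _ => trivial) fun h _ =>
      Sem.bind (Q := fun _ => True) (fun _ _ => trivial) fun l _ =>
      Sem.bind (Q := fun _ => True) (fun _ _ => trivial) fun a _ =>
      (hv.powMod n q g hqn h1 h2 a).bind fun y hy =>
      (hv.eqList y b (by rw [hy.1, hb])).bind fun e he =>
      Sem.bind (Q := fun _ => True) (fun _ _ => trivial) fun i hi =>
      (hv.emit _ _ _).mono fun p hp => ?_
  have := hg.pow_mod_pos (val v a)
  rw [hp, he, hy.2, hb0, decide_eq_false (by omega), Bool.and_false]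

end

/-! ### The self-reducibility formulas are tautologies -/

/-- For all tests with at most `t` gates, the probability of accepting a random member of `xs` exceeds
that of accepting a random `n`-bit string by at most `1 / n`. As this is also required of the negated
tests, it is a bound on the difference. -/
def Fools (n t : ℕ) (xs : List (List Bool)) : Prop :=
  (∀ x ∈ xs, x.length = n) ∧ ∀ T mk, Computes n t T mk →
    n * 2 ^ n * xs.countP T ≤ n * xs.length * uniformCount n T + 2 ^ n * xs.length

theorem Computes.cost {n t t' : ℕ} {T : List Bool → Bool} {mk : List ℕ → Build Wire}
    (h : Computes n t T mk) (ht : t ≤ t') : Computes n t' T mk :=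
  ⟨h.mono, fun A l hl => by have := h.mono l; exact (h.good A l hl).cost ht, h.sem⟩

/-- A bound on the size of the tests of the discrete logarithm. -/
def testCost (n s : ℕ) : ℕ :=
  descLen n s n + n + (evalCost n s n + 132 * n ^ 3 + 200 * n ^ 2 + 100 * n + 100) + 1

section
variable {n q g s : ℕ}

theorem computes_dlogTest (hn : 0 < n) (hqn : q ≤ 2 ^ n) (hg : IsGen q g) (δ : List Bool)
    (hδ : δ.length = descLen n s n) :
    Computes n (testCost n s) (dlogHolds q g (decodeCircuit n s n δ)) fun l => do
      let d ← constList δ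
      dlogTest n q g s d l where
  mono l := inferInstance
  good A l hl := ((good_constList δ).bind fun d B hB hd =>
    good_dlogTest q g s (hδ ▸ hd) (hl.le hB) hn).cost (by rw [hδ, testCost]; ring_nf; omega)
  sem v G l hv hl := (hv.constList δ).bind fun d hd =>
    (hv.dlogTest hn hqn hg.lt.1 hg.lt.2 d l (by simpa [hδ] using congrArg List.length hd)
      hl).mono fun p hp => by rw [hp, hd]

theorem computes_reducedTest (hn : 0 < n) (hqn : q ≤ 2 ^ n) (hqn' : 2 ^ (n - 1) < q)
    (hg : IsGen q g) (δ : List Bool) (hδ : δ.length = descLen n s n) {b : ℕ} (hb0 : 0 < b)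
    (hbq : b < q) :
    Computes n (testCost n s) (fun r => !shiftHolds q g (decodeCircuit n s n δ) n b r)
      fun l => (do
        let d ← constList δ
        let b ← constBits n b
        reducedTest n q g s d b l) >>= bnot := by
  refine Computes.not (t := descLen n s n + (n +
      (evalCost n s n + 132 * n ^ 3 + 200 * n ^ 2 + 100 * n + 100))) ?_ |>.cost
      (by rw [testCost]; omega)
  exact {
    mono := fun l => inferInstance
    good := fun A l hl => ((good_constList δ).bind fun d B hB hd =>
      (good_constBits n b).bind fun b C hC hb =>
      good_reducedTest q g s ((hδ ▸ hd).le hC) hb (hl.le (hB.trans hC)) hn).cost (by rw [hδ])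
    sem := fun v G l hv hl => (hv.constList δ).bind fun d hd => (hv.constBits n b).bind
      fun b' hb => by
        rw [Nat.mod_eq_of_lt (hbq.trans_le hqn)] at hb
        refine (hv.reducedTest hn hqn hqn' hg d b' l (by simpa [hδ] using congrArg List.length hd)
          hb.1 hl (by omega) (by omega)).mono fun p hp => by rw [hp, hd, hb.2] }

/-- The self-reduction succeeds on the outputs of the generator almost as often as the circuit; the
error of `1 / n` is made once for the circuit and once for the (negated) test of the reduction. -/
theorem fools_self (hn : 0 < n) (hqn : q ≤ 2 ^ n) (hqn' : 2 ^ (n - 1) < q)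
    (hg : IsGen q g) {xs : List (List Bool)} (hxs : Fools n (testCost n s) xs) (δ : List Bool)
    (hδ : δ.length = descLen n s n) {b : ℕ} (hb0 : 0 < b) (hbq : b < q) :
    n * 2 ^ n * xs.countP (dlogHolds q g (decodeCircuit n s n δ)) ≤
      n * 2 ^ n * xs.countP (shiftHolds q g (decodeCircuit n s n δ) n b) +
        2 * 2 ^ n * xs.length := by
  have h1 := hxs.2 _ _ (computes_dlogTest hn hqn hg δ hδ)
  have h2 := hxs.2 _ _ (computes_reducedTest hn hqn hqn' hg δ hδ hb0 hbq)
  have h3 := hg.count_le hqn (decodeCircuit n s n δ) hb0 hbq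
  have h4 := countP_not_add (shiftHolds q g (decodeCircuit n s n δ) n b) xs
  have h5 : uniformCount n (fun r => !shiftHolds q g (decodeCircuit n s n δ) n b r) +
      uniformCount n (shiftHolds q g (decodeCircuit n s n δ) n b) = 2 ^ n := by
    have := countP_not_add (fun z => shiftHolds q g (decodeCircuit n s n δ) n b (bits n z))
      (List.range (2 ^ n))
    rw [List.length_range] at this
    exact this
  set A := xs.countP (dlogHolds q g (decodeCircuit n s n δ))
  set B := xs.countP (shiftHolds q g (decodeCircuit n s n δ) n b)
  set B' := xs.countP fun x => !shiftHolds q g (decodeCircuit n s n δ) n b x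
  set U := uniformCount n (dlogHolds q g (decodeCircuit n s n δ))
  set V := uniformCount n (shiftHolds q g (decodeCircuit n s n δ) n b)
  set V' := uniformCount n fun r => !shiftHolds q g (decodeCircuit n s n δ) n b r
  set L := xs.length
  have h6 : n * L * U ≤ n * L * V := Nat.mul_le_mul_left _ h3
  have h7 : n * 2 ^ n * B' + n * 2 ^ n * B = n * 2 ^ n * L := by rw [← mul_add, h4]
  have h8 : n * L * V' + n * L * V = n * L * 2 ^ n := by rw [← mul_add, h5]
  have h9 : n * L * 2 ^ n = n * 2 ^ n * L := by ring
  have h10 : 2 * 2 ^ n * L = 2 ^ n * L + 2 ^ n * L := by ring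
  omega

instance (n q g s : ℕ) (desc : List Wire) (xs : List (List Bool)) :
    Mono (xs.mapM fun x => do
      let x' ← constList x
      dlogTest n q g s desc x') := inferInstance

instance (n q g s : ℕ) (desc b : List Wire) (xs : List (List Bool)) :
    Mono (xs.mapM fun x => do
      let r ← constList x
      reducedTest n q g s desc b r) := inferInstance

/-- The wire for the premise `P T ≤ 2 ^ n k₁` of the self-reducibility formula. -/
def premWire (n q g s : ℕ) (xs : List (List Bool)) (P desc : List Wire) : Build Wire := do
  let tests₁ ← xs.mapM fun x => do
    let x' ← constList x
    dlogTest n q g s desc x'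
  let k₁ ← count (2 * n + Nat.size xs.length + 4) tests₁
  let lhs₁ ← mulConst (2 * n + Nat.size xs.length + 4) (2 ^ n) k₁
  let rhs₁ ← mulConst (2 * n + Nat.size xs.length + 4) xs.length P
  geq lhs₁ rhs₁

/-- The wire for the conclusion `P n T ≤ 2 n 2 ^ n k₂ + 3 * 2 ^ n T` of the self-reducibility formula,
where `k₂` is the number of true wires in `tests`. -/
def conclWire (n T : ℕ) (P tests : List Wire) : Build Wire := do
  let k₂ ← count (2 * n + Nat.size T + 4) tests
  let u ← mulConst (2 * n + Nat.size T + 4) (2 * n * 2 ^ n) k₂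
  let v ← constBits (2 * n + Nat.size T + 4) (3 * 2 ^ n * T)
  let lhs₂ ← add u v
  let rhs₂ ← mulConst (2 * n + Nat.size T + 4) (n * T) P
  geq lhs₂ rhs₂

instance (n q g s : ℕ) (xs : List (List Bool)) (P desc : List Wire) :
    Mono (premWire n q g s xs P desc) := by unfold premWire; infer_instance

instance (n T : ℕ) (P tests : List Wire) :
    Mono (conclWire n T P tests) := by unfold conclWire; infer_instance

/-- The construction of the self-reducibility formula, for given wires. The formula is split up in
this way since its premise does not depend on `b`, and its conclusion depends on `b` only by way of
the tests. -/
def selfBody (n q g s : ℕ) (xs : List (List Bool)) (P b desc : List Wire) : Build Wire := do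
  let prem ← premWire n q g s xs P desc
  let bG ← inGroup n q b
  let tests₂ ← xs.mapM fun x => do
    let r ← constList x
    reducedTest n q g s desc b r
  let concl ← conclWire n xs.length P tests₂
  let hyp ← band prem bG
  emit (fun x y => !x || y) hyp concl

instance (n q g s : ℕ) (xs : List (List Bool)) (P b desc : List Wire) :
    Mono (selfBody n q g s xs P b desc) := by unfold selfBody; infer_instance

theorem selfFormula_eq (n q g s : ℕ) (xs : List (List Bool)) :
    selfFormula n q g s xs = toFormula (2 * n + descLen n s n)
      (selfBody n q g s xs (List.range n) ((List.range n).map (n + ·))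
        ((List.range (descLen n s n)).map (2 * n + ·))) := by
  simp only [selfFormula, selfBody, premWire, conclWire, bind_assoc]

variable {v : ℕ → Bool} {G : Netlist}

theorem Cons.premWire (hv : Cons v G) (hn : 0 < n) (hqn : q ≤ 2 ^ n) (hq : 1 < q) (hg : g < q)
    {xs : List (List Bool)} (hxs : ∀ x ∈ xs, x.length = n) (P d : List ℕ) (hP : P.length = n)
    (hd : d.length = descLen n s n) :
    Sem G (premWire n q g s xs P d) fun p => v p = decide (val v P * xs.length ≤
      2 ^ n * xs.countP (dlogHolds q g (decodeCircuit n s n (d.map v)))) := by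
  have hsem : ∀ x ∈ xs, Sem G (do
      let x' ← SelfProv.constList x
      SelfProv.dlogTest n q g s d x') fun p =>
        v p = dlogHolds q g (decodeCircuit n s n (d.map v)) x := fun x hx =>
    (hv.constList x).bind fun x' hx' => (hv.dlogTest hn hqn hq hg d x' hd
      (by rw [← hxs x hx, ← hx', List.length_map])).mono fun p hp => by rw [hp, hx']
  unfold SelfProv.premWire
  refine (Sem.mapM _ _ _ hsem).bind fun tests ht => (hv.count _ tests).bind fun k hk =>
    (hv.mulConst _ _ k).bind fun l hl => (hv.mulConst _ _ P).bind fun r hr =>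
    (hv.geq l r (by rw [hl.1, hr.1])).mono fun p hp => ?_
  set c := xs.countP (dlogHolds q g (decodeCircuit n s n (d.map v))) with hc
  have h1 : tests.countP v = c := by
    rw [countP_map_val, ht, List.countP_map, hc]; rfl
  have hcT : c ≤ xs.length := List.countP_le_length
  have hT : xs.length < 2 ^ Nat.size xs.length := Nat.lt_size_self _
  have hPn : val v P < 2 ^ n := hP ▸ val_lt v P
  have hw : 2 ^ (2 * n + Nat.size xs.length + 4) = 16 * (2 ^ n * (2 ^ n * 2 ^ Nat.size xs.length)) := by
    ring
  have hn1 : 1 ≤ 2 ^ n := Nat.one_le_two_pow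
  have hpos : 0 < 2 ^ n * (2 ^ n * 2 ^ Nat.size xs.length) := by positivity
  have h2 : c * 2 ^ n ≤ 2 ^ n * (2 ^ n * 2 ^ Nat.size xs.length) := by
    rw [mul_comm]
    exact Nat.mul_le_mul_left _ ((hcT.trans hT.le).trans (Nat.le_mul_of_pos_left _ hn1))
  have h3 : c < 2 ^ (2 * n + Nat.size xs.length + 4) := by
    have := Nat.le_mul_of_pos_right c hn1
    omega
  have h4 : c * 2 ^ n < 2 ^ (2 * n + Nat.size xs.length + 4) := by omega
  have h5 : val v P * xs.length < 2 ^ (2 * n + Nat.size xs.length + 4) := by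
    have : val v P * xs.length ≤ 2 ^ n * (2 ^ n * 2 ^ Nat.size xs.length) :=
      Nat.mul_le_mul hPn.le (hT.le.trans (Nat.le_mul_of_pos_left _ hn1))
    omega
  rw [hp, hl.2, hr.2, hk.2, h1, Nat.mod_eq_of_lt h3, Nat.mod_eq_of_lt h4, Nat.mod_eq_of_lt h5,
    mul_comm c]

theorem Cons.conclWire (hv : Cons v G) {T : ℕ} (P tests : List ℕ) (hP : P.length = n)
    (ht : tests.length = T) :
    Sem G (conclWire n T P tests) fun p => v p = decide (n * T * val v P ≤
      2 * n * 2 ^ n * tests.countP v + 3 * 2 ^ n * T) := by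
  unfold SelfProv.conclWire
  refine (hv.count _ tests).bind fun k hk => (hv.mulConst _ _ k).bind fun u hu =>
    (hv.constBits _ _).bind fun c hc => (hv.add u c (by rw [hu.1, hc.1])).bind fun l hl =>
    (hv.mulConst _ _ P).bind fun r hr =>
    (hv.geq l r (by rw [hl.1, hr.1, hc.1])).mono fun p hp => ?_
  have hcT : tests.countP v ≤ T := ht ▸ List.countP_le_length
  have hT : T < 2 ^ Nat.size T := Nat.lt_size_self _
  have hPn : val v P < 2 ^ n := hP ▸ val_lt v P
  have hw : 2 ^ (2 * n + Nat.size T + 4) = 16 * (2 ^ n * (2 ^ n * 2 ^ Nat.size T)) := by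
    ring
  have hnn : n < 2 ^ n := Nat.lt_two_pow_self
  have h1 : 2 * n * 2 ^ n * tests.countP v ≤ 2 * (2 ^ n * (2 ^ n * 2 ^ Nat.size T)) := by
    calc 2 * n * 2 ^ n * tests.countP v ≤ 2 * 2 ^ n * 2 ^ n * 2 ^ Nat.size T := by
          gcongr; omega
      _ = _ := by ring
  have h2 : 3 * 2 ^ n * T ≤ 3 * (2 ^ n * (2 ^ n * 2 ^ Nat.size T)) := by
    calc 3 * 2 ^ n * T = 3 * 2 ^ n * 1 * T := by ring
      _ ≤ 3 * 2 ^ n * 2 ^ n * 2 ^ Nat.size T := by gcongr; exact Nat.one_le_two_pow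
      _ = _ := by ring
  have h3 : val v P * (n * T) ≤ 2 ^ n * (2 ^ n * 2 ^ Nat.size T) := by gcongr
  have hpos : 0 < 2 ^ n * (2 ^ n * 2 ^ Nat.size T) := by positivity
  have h4 : tests.countP v < 2 ^ (2 * n + Nat.size T + 4) := by
    have : 2 ^ Nat.size T ≤ 2 ^ n * (2 ^ n * 2 ^ Nat.size T) := by
      rw [← mul_assoc]; exact Nat.le_mul_of_pos_left _ (by positivity)
    omega
  have m1 : 2 * n * 2 ^ n * tests.countP v % 2 ^ (2 * n + Nat.size T + 4) =
      2 * n * 2 ^ n * tests.countP v := Nat.mod_eq_of_lt (by omega)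
  have m2 : 3 * 2 ^ n * T % 2 ^ (2 * n + Nat.size T + 4) = 3 * 2 ^ n * T :=
    Nat.mod_eq_of_lt (by omega)
  have m3 : (2 * n * 2 ^ n * tests.countP v + 3 * 2 ^ n * T) % 2 ^ (2 * n + Nat.size T + 4) =
      2 * n * 2 ^ n * tests.countP v + 3 * 2 ^ n * T := Nat.mod_eq_of_lt (by omega)
  have m4 : val v P * (n * T) % 2 ^ (2 * n + Nat.size T + 4) = val v P * (n * T) :=
    Nat.mod_eq_of_lt (by omega)
  rw [hp, hr.2, hl.2, hc.1, hc.2, hu.2, hk.2, Nat.mod_eq_of_lt h4, mul_comm (tests.countP v),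
    m1, m2, m3, m4, mul_comm (val v P)]

theorem selfFormula_tautology (hn : 0 < n) (hqn : q ≤ 2 ^ n) (hqn' : 2 ^ (n - 1) < q)
    (hg : IsGen q g) {xs : List (List Bool)} (hxs : Fools n (testCost n s) xs) :
    (selfFormula n q g s xs).Tautology := by
  rw [selfFormula_eq]
  refine toFormula_tautology fun v G hv _ => ?_
  set P := List.range n
  set b := (List.range n).map (n + ·) with hb
  set d := (List.range (descLen n s n)).map (2 * n + ·) with hd
  have hbl : b.length = n := by simp [hb]
  have hdl : d.length = descLen n s n := by simp [hd]
  have hPl : P.length = n := by simp [P]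
  set C := decodeCircuit n s n (d.map v) with hC
  refine (hv.premWire hn hqn hg.lt.1 hg.lt.2 hxs.1 P d hPl hdl).bind fun p hp =>
    (hv.inGroup n q hqn b hbl).bind fun i hi => ?_
  by_cases hbq : 0 < val v b ∧ val v b < q
  · have hsem : ∀ x ∈ xs, Sem G (do
        let x' ← constList x
        reducedTest n q g s d b x') fun p => v p = shiftHolds q g C n (val v b) x := fun x hx =>
      (hv.constList x).bind fun x' hx' => (hv.reducedTest hn hqn hqn' hg d b x' hdl hbl
        (by rw [← hxs.1 x hx, ← hx', List.length_map]) hbq.1 hbq.2).mono fun p hp => by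
          rw [hp, hx']
    refine (Sem.mapM _ _ _ hsem).bind fun tests ht =>
      (hv.conclWire P tests hPl (by simpa using congrArg List.length ht)).bind fun c hc =>
      Sem.bind (m := band p i) (hv.emit _ _ _) fun h hh => (hv.emit _ _ _).mono fun o ho => ?_
    have h1 : tests.countP v = xs.countP (shiftHolds q g C n (val v b)) := by
      rw [countP_map_val, ht, List.countP_map]; rfl
    have h2 := fools_self hn hqn hqn' hg hxs (d.map v) (by simpa using hdl) hbq.1 hbq.2
    rw [ho, hh, hp, hi, hc, h1, ← hC]
    rw [← hC] at h2
    simp only [Bool.or_eq_true, Bool.not_eq_true', Bool.and_eq_false_iff, decide_eq_false_iff_not,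
      decide_eq_true_eq]
    by_cases h3 : val v P * xs.length ≤ 2 ^ n * xs.countP (dlogHolds q g C)
    · right
      have h4 := Nat.mul_le_mul_left n h3
      -- the formula claims less than `fools_self`: it has a factor `1/2`, and `3/2` in place of `2`
      nlinarith [Nat.zero_le (n * 2 ^ n * xs.countP (shiftHolds q g C n (val v b))),
        Nat.zero_le (2 ^ n * xs.length)]
    · exact .inl (.inl h3)
  · refine Sem.bind (Q := fun _ => True) (fun _ _ => trivial) fun t _ =>
      Sem.bind (Q := fun _ => True) (fun _ _ => trivial) fun c _ =>
      Sem.bind (m := band p i) (hv.emit _ _ _) fun h hh => (hv.emit _ _ _).mono fun o ho => ?_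
    rw [ho, hh, hi, decide_eq_false hbq, Bool.and_false]
    rfl

end

/-! ### Polynomial bounds -/

/-- A function with a polynomial bound on the positive integers. -/
def PolyBounded (f : ℕ → ℕ) : Prop := ∃ e, ∀ n, 1 ≤ n → f n ≤ e * n ^ e

namespace PolyBounded

variable {f g : ℕ → ℕ}

theorem mono (hg : PolyBounded g) (h : ∀ n, 1 ≤ n → f n ≤ g n) : PolyBounded f :=
  hg.imp fun _ he n hn => (h n hn).trans (he n hn)

theorem const (a : ℕ) : PolyBounded fun _ => a :=
  ⟨a, fun _ hn => Nat.le_mul_of_pos_right _ (pow_pos hn _)⟩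

theorem id : PolyBounded fun n => n := ⟨1, fun n _ => by simp⟩

theorem add (hf : PolyBounded f) (hg : PolyBounded g) : PolyBounded fun n => f n + g n := by
  obtain ⟨a, ha⟩ := hf
  obtain ⟨b, hb⟩ := hg
  refine ⟨a + b, fun n hn => ?_⟩
  calc f n + g n ≤ a * n ^ a + b * n ^ b := Nat.add_le_add (ha n hn) (hb n hn)
    _ ≤ a * n ^ (a + b) + b * n ^ (a + b) := by gcongr <;> omega
    _ = (a + b) * n ^ (a + b) := by ring

theorem mul (hf : PolyBounded f) (hg : PolyBounded g) : PolyBounded fun n => f n * g n := by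
  obtain ⟨a, ha⟩ := hf
  obtain ⟨b, hb⟩ := hg
  refine ⟨a * b + a + b, fun n hn => ?_⟩
  calc f n * g n ≤ (a * n ^ a) * (b * n ^ b) := Nat.mul_le_mul (ha n hn) (hb n hn)
    _ = (a * b) * n ^ (a + b) := by ring
    _ ≤ (a * b + a + b) * n ^ (a * b + a + b) := by gcongr <;> omega

theorem pow (hf : PolyBounded f) (k : ℕ) : PolyBounded fun n => f n ^ k := by
  induction k with
  | zero => simpa using const 1
  | succ k ih => simpa only [pow_succ] using ih.mul hf

theorem size (hf : PolyBounded f) : PolyBounded fun n => Nat.size (f n) :=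
  hf.mono fun _ _ => Nat.size_le.2 Nat.lt_two_pow_self

theorem descLen (hf : PolyBounded f) (hg : PolyBounded g) :
    PolyBounded fun n => descLen n (f n) (g n) :=
  (hf.mul ((const 4).add ((const 2).mul (id.add hf).size))).add (hg.mul (id.add hf).size)

theorem evalCost (hf : PolyBounded f) (hg : PolyBounded g) :
    PolyBounded fun n => evalCost n (f n) (g n) :=
  (hf.mul (((const 2).mul ((id.add hf).mul (((const 3).mul (id.add hf).size).add (const 4)))).add
    (const 9))).add (hg.mul ((id.add hf).mul (((const 3).mul (id.add hf).size).add (const 4))))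

theorem testCost (hf : PolyBounded f) : PolyBounded fun n => testCost n (f n) :=
  (((hf.descLen id).add id).add (((((hf.evalCost id).add ((const 132).mul (id.pow 3))).add
    ((const 200).mul (id.pow 2))).add ((const 100).mul id)).add (const 100))).add (const 1)

/-- So there are polynomially many seeds of length `O(log n)`. -/
theorem two_pow_clog (d : ℕ) : PolyBounded fun n => 2 ^ (d * Nat.clog 2 n) := by
  refine mono (((const 2).mul id).pow d) fun n hn => ?_
  rw [mul_comm d, pow_mul]
  gcongr
  rcases Nat.lt_or_ge 1 n with h | h
  · have h1 := Nat.pow_pred_clog_lt_self one_lt_two h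
    have h2 : 0 < Nat.clog 2 n := Nat.clog_pos one_lt_two h
    calc 2 ^ Nat.clog 2 n = 2 * 2 ^ (Nat.clog 2 n).pred := by
          rw [← pow_succ', Nat.pred_eq_sub_one, Nat.sub_add_cancel h2]
      _ ≤ 2 * n := by omega
  · have : n = 1 := by omega
    subst this
    simp

end PolyBounded

/-! ### The parameters of the generator -/

theorem Circuit.Approximates.anti {C : Circuit} {f : List Bool → Bool} {n : ℕ} {γ γ' : ℝ}
    (h : C.Approximates f n γ) (hγ : γ' ≤ γ) : C.Approximates f n γ' := hγ.trans h

/-- The condition for the existence of the design: `Q = 2 ^ ⌈4 / ε⌉` is so large that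
`Q ^ (ε m / 2) ≥ 2 ^ (2 m)`. -/
theorem design_bound {ε : ℝ} (hε : 0 < ε) {n m : ℕ} (hnm : n ≤ 2 ^ m) :
    n * 2 ^ m < nwRatio ε ^ (⌊ε * m / 2⌋₊ + 1) := by
  have h1 : 2 * m < ⌈4 / ε⌉₊ * (⌊ε * m / 2⌋₊ + 1) := by
    have h2 : ε * m / 2 < (⌊ε * m / 2⌋₊ : ℝ) + 1 := Nat.lt_floor_add_one _
    have h3 : 4 / ε ≤ (⌈4 / ε⌉₊ : ℝ) := Nat.le_ceil _
    have h4 : (0 : ℝ) < 4 / ε := by positivity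
    have h5 : (2 * m : ℝ) < ⌈4 / ε⌉₊ * (⌊ε * m / 2⌋₊ + 1) := by
      calc (2 * m : ℝ) = 4 / ε * (ε * m / 2) := by field_simp; ring
        _ < 4 / ε * (⌊ε * m / 2⌋₊ + 1) := by gcongr
        _ ≤ _ := by gcongr
    exact_mod_cast h5
  calc n * 2 ^ m ≤ 2 ^ m * 2 ^ m := Nat.mul_le_mul_right _ hnm
    _ = 2 ^ (2 * m) := by rw [two_mul, pow_add]
    _ < 2 ^ (⌈4 / ε⌉₊ * (⌊ε * m / 2⌋₊ + 1)) := Nat.pow_lt_pow_right one_lt_two h1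
    _ = nwRatio ε ^ (⌊ε * m / 2⌋₊ + 1) := by rw [nwRatio, pow_mul]

/-- For a base function that is hard on average, the generator fools the tests of the discrete
logarithm, provided that the constant `c` is large enough compared to `k` and `1 / ε`. -/
theorem exists_fools {ε : ℝ} (hε : 0 < ε) {f : List Bool → Bool} (hard : HardOnAverage ε f)
    (k : ℕ) : ∃ c₀ : ℕ, ∀ c ≥ c₀, ∃ n₁ : ℕ, ∀ n ≥ n₁,
      Fools n (testCost n (n ^ k)) (nwOutputs ε c f n) := by
  obtain ⟨e, he⟩ := ((PolyBounded.id.pow k).testCost).add (PolyBounded.const 1)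
  obtain ⟨m₀, hm₀⟩ := Filter.eventually_atTop.1 hard
  -- with this `c`, even the square root `y` of the hardness `2 ^ (ε m)` is at least `n ^ (e + 2)`
  refine ⟨⌈2 * (e + 2) / ε⌉₊ + 1, fun c hc => ⟨2 ^ m₀ + 5 + e, fun n hn => ?_⟩⟩
  set m := c * Nat.clog 2 n with hm
  have hc' : 2 * (e + 2) / ε ≤ (c : ℝ) :=
    (Nat.le_ceil _).trans (by exact_mod_cast (Nat.le_succ _).trans hc)
  have hc1 : 1 ≤ c := le_trans (by omega) hc
  have h2m : 0 < 2 ^ m₀ := by positivity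
  have hn1 : 1 ≤ n := by omega
  have hnclog : n ≤ 2 ^ Nat.clog 2 n := Nat.le_pow_clog one_lt_two n
  have hclog : m₀ ≤ Nat.clog 2 n := by
    by_contra! h
    have := Nat.pow_le_pow_right two_pos h.le
    omega
  have hmm : Nat.clog 2 n ≤ m := Nat.le_mul_of_pos_left _ hc1
  have hnm : n ≤ 2 ^ m := hnclog.trans (Nat.pow_le_pow_right two_pos hmm)
  have hm0 : 0 < m := by
    rcases Nat.eq_zero_or_pos m with h | h
    · rw [h] at hnm; omega
    · exact h
  set y : ℝ := 2 ^ (ε * m / 2) with hy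
  have hy2 : (2 : ℝ) ^ (ε * m) = y * y := by
    rw [hy, ← Real.rpow_add two_pos]; congr 1; ring
  have hyn : (n : ℝ) ^ (e + 2) ≤ y := by
    have h1 : ((e + 2 : ℕ) * Nat.clog 2 n : ℝ) ≤ ε * m / 2 := by
      rw [hm]
      push_cast
      rw [div_le_iff₀ hε] at hc'
      have : (0 : ℝ) ≤ Nat.clog 2 n := by positivity
      nlinarith
    calc (n : ℝ) ^ (e + 2) ≤ (2 ^ Nat.clog 2 n) ^ (e + 2) := by
          gcongr; exact_mod_cast hnclog
      _ = (2 : ℝ) ^ ((e + 2 : ℕ) * Nat.clog 2 n : ℝ) := by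
          rw [← pow_mul, mul_comm, ← Nat.cast_mul, Real.rpow_natCast]
      _ ≤ y := Real.rpow_le_rpow_of_exponent_le one_le_two h1
  have hnR : (5 : ℝ) + e ≤ n := by exact_mod_cast (by omega : 5 + e ≤ n)
  have heR : (0 : ℝ) ≤ e := by positivity
  have hn0 : (0 : ℝ) < n := by linarith
  have hyn2 : (n : ℝ) ^ 2 ≤ y := le_trans (pow_le_pow_right₀ (by linarith) (by omega)) hyn
  have hy0 : (0 : ℝ) < y := by positivity
  have hay : (2 : ℝ) ^ ⌊ε * m / 2⌋₊ ≤ y := by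
    rw [hy, ← Real.rpow_natCast]
    exact Real.rpow_le_rpow_of_exponent_le one_le_two (Nat.floor_le (by positivity))
  have hsize : ((n * (4 * 2 ^ ⌊ε * m / 2⌋₊) + testCost n (n ^ k) + 1 : ℕ) : ℝ) ≤ 2 ^ (ε * m) := by
    have h1 : ((testCost n (n ^ k) + 1 : ℕ) : ℝ) ≤ e * n ^ e := by exact_mod_cast he n hn1
    push_cast at h1 ⊢
    have h2 : (n : ℝ) * (4 * 2 ^ ⌊ε * m / 2⌋₊) ≤ n * (4 * y) := by gcongr
    have h3 : (e : ℝ) * n ^ e ≤ n * y := by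
      calc (e : ℝ) * n ^ e ≤ n * n ^ (e + 2) := by
            gcongr
            · omega
            · linarith
            · omega
        _ ≤ n * y := by gcongr
    rw [hy2]
    nlinarith
  -- advantage `1 / n ^ 2` for each of the `n` bits of the generator makes a total error of `1 / n`
  have hη : (1 : ℝ) / 2 ^ (ε * m) ≤ 1 / n ^ 2 := by
    refine one_div_le_one_div_of_le (by positivity) ?_
    rw [hy2]
    have : 1 ≤ y := by nlinarith
    nlinarith
  refine ⟨fun x hx => ?_, fun T mk hT => ?_⟩
  · obtain ⟨z, _, rfl⟩ := List.mem_map.1 hx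
    simp [nwGen, designSets]
  · have h1 := nw_fools (f := f) (η := 1 / n ^ 2) (Q := nwRatio ε) (m := m)
      (a := ⌊ε * m / 2⌋₊) hT hm0 (by unfold nwRatio; positivity) (design_bound hε hnm)
      fun C hC hs ha => hm₀ m (hclog.trans hmm) C hC (le_trans (by exact_mod_cast hs) hsize)
        (ha.anti (by linarith))
    rw [sum_ind_eq_uniformCount] at h1
    have h2 : (nwOutputs ε c f n).length = 2 ^ (nwRatio ε * m) := by simp [nwOutputs, hm]
    rw [h2]
    have h3 : (n : ℝ) * 2 ^ n * ((nwOutputs ε c f n).countP T : ℝ) ≤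
        n * 2 ^ (nwRatio ε * m) * uniformCount n T + 2 ^ n * 2 ^ (nwRatio ε * m) := by
      have h4 := mul_le_mul_of_nonneg_left h1 hn0.le
      have h5 : (n : ℝ) * (n * (1 / n ^ 2 * (2 ^ n * 2 ^ (nwRatio ε * m)))) =
          2 ^ n * 2 ^ (nwRatio ε * m) := by field_simp
      rw [mul_add, h5] at h4
      calc _ = (n : ℝ) * (2 ^ n * ((nwOutputs ε c f n).countP T : ℝ)) := by ring
        _ ≤ _ := h4
        _ = _ := by ring
    exact_mod_cast h3

theorem length_nwOutputs_poly (ε : ℝ) (c : ℕ) (f : List Bool → Bool) :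
    PolyBounded fun n => (nwOutputs ε c f n).length :=
  (PolyBounded.two_pow_clog (nwRatio ε * c)).mono fun n _ => by
    simp [nwOutputs, mul_assoc]

/-! ### Pratt certificates -/

theorem dvd_of_prime_factors {l : List ℕ} (hl : ∀ p ∈ l, p.Prime) {r : ℕ} (hr : r.Prime)
    (h : r ∣ l.prod) : r ∈ l := by
  obtain ⟨p, hp, hrp⟩ := (hr.prime.dvd_prod_iff).1 h
  rwa [(Nat.prime_dvd_prime_iff_eq hr (hl p hp)).1 hrp]

/-- The order of `g` is `e.q - 1`, since it divides `e.q - 1` but none of its maximal proper divisors;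
so `e.q` is a prime, by the criterion of Lucas, and `g` is a generator. -/
theorem CertEntry.Checks.isGen {e : CertEntry} (h : e.Checks) (hf : ∀ p ∈ e.factors, p.Prime) :
    IsGen e.q e.g := by
  obtain ⟨h1, h2, h3, h4, h5⟩ := h
  have hq1 : 1 % e.q = 1 := Nat.mod_eq_of_lt h1
  have h6 : (e.g : ZMod e.q) ^ (e.q - 1) = 1 := by
    have := (mod_eq_iff h1).1 h4
    push_cast at this
    exact this
  have h7 : ∀ r : ℕ, r.Prime → r ∣ e.q - 1 → (e.g : ZMod e.q) ^ ((e.q - 1) / r) ≠ 1 := by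
    intro r hr hd
    have h8 := h5 r (dvd_of_prime_factors hf hr (h3 ▸ hd))
    rw [Ne, mod_eq_iff h1] at h8
    push_cast at h8
    exact h8
  have hp := lucas_primality e.q _ h6 h7
  have := Fact.mk hp
  have hord : orderOf (e.g : ZMod e.q) = e.q - 1 :=
    orderOf_eq_of_pow_and_pow_div_prime (by omega) h6 h7
  have hg0 : (e.g : ZMod e.q) ≠ 0 := by
    intro h0
    rw [h0, zero_pow (by omega)] at h6
    exact zero_ne_one h6
  refine ⟨hp, Units.mk0 _ hg0, ?_, fun x => ?_⟩
  · simp [ZMod.val_natCast, Nat.mod_eq_of_lt h2]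
  · have hcard : Nat.card (Subgroup.zpowers (Units.mk0 _ hg0)) = Nat.card (ZMod e.q)ˣ := by
      rw [Nat.card_zpowers, ← orderOf_units, Units.val_mk0, hord, Nat.card_eq_fintype_card,
        ZMod.card_units_eq_totient, Nat.totient_prime hp]
    rw [(Subgroup.card_eq_iff_eq_top _).1 hcard]
    trivial

theorem Cert.Valid.isGen {π : Cert} (h : π.Valid) : ∀ e ∈ π, IsGen e.q e.g := by
  induction π with
  | nil => simp
  | cons e es ih =>
    obtain ⟨h1, h2, h3⟩ := h
    have ih := ih h3
    intro e' he'
    rcases List.mem_cons.1 he' with rfl | he'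
    · refine h1.isGen fun p hp => ?_
      obtain ⟨e'', he'', rfl⟩ := h2 p hp
      exact (ih e'' he'').1
    · exact ih e' he'

theorem Cert.Certifies.isGen {π : Cert} {q g : ℕ} (h : π.Certifies q g) : IsGen q g := by
  obtain ⟨h1, e, es, rfl, rfl, rfl⟩ := h
  exact h1.isGen e (by simp)

theorem Cert.Valid.append {π π' : Cert} (h : π.Valid) (h' : π'.Valid) :
    Cert.Valid (π ++ π') := by
  induction π with
  | nil => exact h'
  | cons e es ih =>
    obtain ⟨h1, h2, h3⟩ := h
    exact ⟨h1, fun p hp => (h2 p hp).imp fun e' he' => ⟨List.mem_append_left _ he'.1, he'.2⟩,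
      ih h3⟩

theorem IsGen.checks {q g : ℕ} (h : IsGen q g) :
    (⟨q, g, (q - 1).primeFactorsList⟩ : CertEntry).Checks := by
  obtain ⟨h1, h2⟩ := h.lt
  obtain ⟨hq, u, rfl, hu⟩ := h
  have := Fact.mk hq
  have hpow : ∀ j : ℕ, (u : ZMod q).val ^ j % q = 1 ↔ u ^ j = 1 := by
    intro j
    rw [mod_eq_iff h1]
    push_cast
    rw [ZMod.natCast_zmod_val, ← Units.val_pow_eq_pow_val, Units.val_eq_one]
  refine ⟨h1, h2, Nat.prod_primeFactorsList (by omega), ?_, fun p hp => ?_⟩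
  · exact (hpow _).2 (ZMod.units_pow_card_sub_one_eq_one q u)
  · simp only
    rw [Ne, hpow]
    intro h0
    have hord : orderOf u = q - 1 := by
      rw [orderOf_eq_card_of_forall_mem_zpowers hu, Nat.card_eq_fintype_card,
        ZMod.card_units_eq_totient, Nat.totient_prime hq]
    have hp' := Nat.prime_of_mem_primeFactorsList hp
    have h3 := orderOf_dvd_of_pow_eq_one h0
    rw [hord] at h3
    have h4 : (q - 1) / p < q - 1 := Nat.div_lt_self (by omega) hp'.one_lt
    have h5 : 0 < (q - 1) / p :=
      Nat.div_pos (Nat.le_of_dvd (by omega) (Nat.dvd_of_mem_primeFactorsList hp)) hp'.pos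
    exact absurd (Nat.le_of_dvd h5 h3) (by omega)

theorem exists_isGen {p : ℕ} (hp : p.Prime) : ∃ g, IsGen p g := by
  have := Fact.mk hp
  obtain ⟨u, hu⟩ := IsCyclic.exists_generator (α := (ZMod p)ˣ)
  exact ⟨_, hp, u, rfl, hu⟩

/-- Certificates for all primes of a list, with few entries. In `2 ^ (π.length + 1) ≤ p ^ 2` the
summand `1` makes the induction in `IsGen.exists_cert` work. -/
theorem exists_certs {l : List ℕ} (h : ∀ p ∈ l, ∃ π : Cert, π.Valid ∧ (∃ e ∈ π, e.q = p) ∧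
    2 ^ (π.length + 1) ≤ p ^ 2 ∧ ∀ e ∈ π, e.q ≤ p ∧ IsGen e.q e.g ∧
      e.factors = (e.q - 1).primeFactorsList) :
    ∃ π : Cert, π.Valid ∧ (∀ p ∈ l, ∃ e ∈ π, e.q = p) ∧ 2 ^ (π.length + l.length) ≤ l.prod ^ 2 ∧
      ∀ e ∈ π, (∃ p ∈ l, e.q ≤ p) ∧ IsGen e.q e.g ∧ e.factors = (e.q - 1).primeFactorsList := by
  induction l with
  | nil => exact ⟨[], trivial, by simp, by simp, by simp⟩
  | cons p l ih =>
    obtain ⟨π, h1, h2, h3, h4⟩ := h p (by simp)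
    obtain ⟨π', h1', h2', h3', h4'⟩ := ih fun p hp => h p (by simp [hp])
    refine ⟨π ++ π', h1.append h1', ?_, ?_, ?_⟩
    · intro r hr
      rcases List.mem_cons.1 hr with rfl | hr
      · exact h2.imp fun e he => ⟨List.mem_append_left _ he.1, he.2⟩
      · exact (h2' r hr).imp fun e he => ⟨List.mem_append_right _ he.1, he.2⟩
    · rw [List.prod_cons, mul_pow, List.length_append, List.length_cons,
        show π.length + π'.length + (l.length + 1) = (π.length + 1) + (π'.length + l.length) by ring,
        pow_add]
      exact Nat.mul_le_mul h3 h3'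
    · intro e he
      rcases List.mem_append.1 he with he | he
      · exact ⟨⟨p, by simp, (h4 e he).1⟩, (h4 e he).2⟩
      · exact ⟨(h4' e he).1.imp fun p hp => ⟨by simp [hp.1], hp.2⟩, (h4' e he).2⟩

/-- A Pratt certificate of `q` has fewer than `2 log q` entries. -/
theorem IsGen.exists_cert {q : ℕ} : ∀ {g : ℕ}, IsGen q g → ∃ π : Cert, π.Certifies q g ∧
    2 ^ (π.length + 1) ≤ q ^ 2 ∧ ∀ e ∈ π, e.q ≤ q ∧ IsGen e.q e.g ∧
      e.factors = (e.q - 1).primeFactorsList := by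
  induction q using Nat.strong_induction_on with
  | _ q ih =>
    intro g hg
    obtain ⟨hq1, _⟩ := hg.lt
    have hfac : ∀ p ∈ (q - 1).primeFactorsList, p ≤ q - 1 := fun p hp =>
      Nat.le_of_dvd (by omega) (Nat.dvd_of_mem_primeFactorsList hp)
    obtain ⟨π, h1, h2, h3, h4⟩ := exists_certs (l := (q - 1).primeFactorsList) fun p hp => by
      obtain ⟨g', hg'⟩ := exists_isGen (Nat.prime_of_mem_primeFactorsList hp)
      obtain ⟨π, ⟨h1, e, es, rfl, h5, _⟩, h3, h4⟩ := ih p (by have := hfac p hp; omega) hg'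
      exact ⟨_, h1, ⟨e, by simp, h5⟩, h3, h4⟩
    rw [Nat.prod_primeFactorsList (by omega)] at h3
    refine ⟨⟨q, g, (q - 1).primeFactorsList⟩ :: π, ⟨⟨hg.checks, h2, h1⟩, _, _, rfl, rfl, rfl⟩,
      ?_, ?_⟩
    · rw [List.length_cons]
      by_cases h5 : 2 ≤ (q - 1).primeFactorsList.length
      · calc 2 ^ (π.length + 1 + 1) ≤ 2 ^ (π.length + (q - 1).primeFactorsList.length) :=
              Nat.pow_le_pow_right two_pos (by omega)
          _ ≤ (q - 1) ^ 2 := h3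
          _ ≤ q ^ 2 := Nat.pow_le_pow_left (by omega) 2
      · -- `q - 1` is `1` or a prime, so `q` is `2` or `3`
        have h6 : q = 2 ∨ q = 3 := by
          by_contra! h7
          have h8 : ¬ (2 ∣ q) := fun h =>
            h7.1 ((Nat.prime_dvd_prime_iff_eq Nat.prime_two hg.1).1 h).symm
          obtain ⟨r, hr⟩ : 2 ∣ q - 1 := by omega
          have h9 : (q - 1).primeFactorsList.length = 1 + r.primeFactorsList.length := by
            have := (Nat.perm_primeFactorsList_mul (two_ne_zero) (show r ≠ 0 by omega)).length_eq
            rw [hr, this, List.length_append, Nat.primeFactorsList_prime Nat.prime_two]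
            rfl
          have h10 : r.primeFactorsList = [] := List.length_eq_zero_iff.1 (by omega)
          rw [Nat.primeFactorsList_eq_nil] at h10
          omega
        rcases h6 with rfl | rfl
        · have : π = [] := by
            by_contra hne
            obtain ⟨e, he⟩ := List.exists_mem_of_ne_nil _ hne
            obtain ⟨⟨p, hp, _⟩, _⟩ := h4 e he
            simp at hp
          subst this
          norm_num
        · have hl : (3 - 1).primeFactorsList.length = 1 := by
            rw [show 3 - 1 = 2 by rfl, Nat.primeFactorsList_prime Nat.prime_two]; rfl
          rw [hl] at h3
          calc 2 ^ (π.length + 1 + 1) = 2 * 2 ^ (π.length + 1) := pow_succ' _ _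
            _ ≤ 2 * (3 - 1) ^ 2 := Nat.mul_le_mul_left _ h3
            _ ≤ 3 ^ 2 := by norm_num
    · intro e he
      rcases List.mem_cons.1 he with rfl | he
      · exact ⟨le_rfl, hg, rfl⟩
      · obtain ⟨⟨p, hp, hep⟩, h5⟩ := h4 e he
        exact ⟨hep.trans ((hfac p hp).trans (by omega)), h5⟩

theorem IsGen.exists_small_cert {q g n : ℕ} (h : IsGen q g) (hn : q ≤ 2 ^ n) :
    ∃ π : Cert, π.Certifies q g ∧ π.size ≤ 2 * n * (1 + (n + 1) + (n + 1) + n * (1 + (n + 1))) := by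
  obtain ⟨π, h1, h2, h3⟩ := h.exists_cert
  refine ⟨π, h1, ?_⟩
  have hlen : π.length ≤ 2 * n := by
    have : 2 ^ (π.length + 1) ≤ 2 ^ (2 * n) := by
      calc 2 ^ (π.length + 1) ≤ q ^ 2 := h2
        _ ≤ (2 ^ n) ^ 2 := Nat.pow_le_pow_left hn 2
        _ = 2 ^ (2 * n) := by rw [← pow_mul, mul_comm]
    have := (Nat.pow_le_pow_iff_right one_lt_two).1 this
    omega
  have hsz : ∀ x, x ≤ 2 ^ n → Nat.size x ≤ n + 1 := fun x hx =>
    Nat.size_le.2 (hx.trans_lt (Nat.pow_lt_pow_right one_lt_two (Nat.lt_succ_self n)))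
  unfold Cert.size
  refine (List.sum_le_card_nsmul _ (1 + (n + 1) + (n + 1) + n * (1 + (n + 1))) ?_).trans ?_
  · intro x hx
    obtain ⟨e, he, rfl⟩ := List.mem_map.1 hx
    obtain ⟨h4, h5, h6⟩ := h3 e he
    have h7 := h5.lt
    have h8 := hsz e.q (h4.trans hn)
    have h9 := hsz e.g (by omega)
    have h10 : (e.factors.map fun p => 1 + Nat.size p).sum ≤ n * (1 + (n + 1)) := by
      refine (List.sum_le_card_nsmul _ (1 + (n + 1)) ?_).trans ?_
      · intro y hy
        obtain ⟨p, hp, rfl⟩ := List.mem_map.1 hy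
        rw [h6] at hp
        have := Nat.le_of_dvd (by omega) (Nat.dvd_of_mem_primeFactorsList hp)
        have := hsz p (by omega)
        omega
      · rw [List.length_map, smul_eq_mul, h6]
        refine Nat.mul_le_mul_right _ ?_
        have h11 : 2 ^ (e.q - 1).primeFactorsList.length ≤ 2 ^ n := by
          calc 2 ^ (e.q - 1).primeFactorsList.length
              ≤ (e.q - 1).primeFactorsList.prod := List.pow_card_le_prod _ _ fun p hp =>
                (Nat.prime_of_mem_primeFactorsList hp).two_le
            _ = e.q - 1 := Nat.prod_primeFactorsList (by omega)
            _ ≤ 2 ^ n := by omega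
        exact (Nat.pow_le_pow_iff_right one_lt_two).1 h11
    omega
  · rw [List.length_map, smul_eq_mul]
    exact Nat.mul_le_mul_right _ hlen

/-! ### Soundness of the proof system -/

namespace Formula

theorem eval_subst (v : ℕ → Bool) (σ : ℕ → Formula) (A : Formula) :
    (A.subst σ).eval v = A.eval fun i => (σ i).eval v := by
  induction A <;> simp_all [subst, eval]

theorem eval_congr {v w : ℕ → Bool} {A : Formula} (h : ∀ i ∈ A.vars, v i = w i) :
    A.eval v = A.eval w := by
  induction A <;> simp_all [vars, eval]

theorem Tautology.subst {A : Formula} (h : A.Tautology) (σ : ℕ → Formula) :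
    (A.subst σ).Tautology := fun v => by rw [eval_subst]; exact h _

theorem subst_subst (σ τ : ℕ → Formula) (A : Formula) :
    (A.subst σ).subst τ = A.subst fun i => (σ i).subst τ := by
  induction A <;> simp_all [Formula.subst]

theorem size_subst_le {σ : ℕ → Formula} {s : ℕ} (hs : 1 ≤ s) (h : ∀ i, (σ i).size ≤ s)
    (A : Formula) : (A.subst σ).size ≤ A.size * s := by
  induction A with
  | var i => simpa [Formula.subst, size] using h i
  | bot => simpa [Formula.subst, size] using hs
  | top => simpa [Formula.subst, size] using hs
  | neg A ih => simp only [Formula.subst, size]; nlinarith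
  | and A B ihA ihB => simp only [Formula.subst, size]; nlinarith
  | or A B ihA ihB => simp only [Formula.subst, size]; nlinarith
  | imp A B ihA ihB => simp only [Formula.subst, size]; nlinarith

end Formula

/-- If the axioms are tautologies, so is every formula that has a proof: a valuation of the goal
extends to the extension variables such that all lines become true. -/
theorem PSystem.IsProof.tautology {S : PSystem} {π : List Line} {A : Formula} (h : S.IsProof π A)
    (htt : ∀ n, S.n₀ ≤ n → (ttAxiom S.ε S.f n).Tautology)
    (hself : ∀ n q g, S.n₀ ≤ n → 2 ^ (n - 1) < q → q ≤ 2 ^ n → IsGen q g →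
      (selfAxiom S.ε S.k S.c S.f n q g).Tautology) : A.Tautology := by
  intro v
  have key : ∀ k ≤ π.length, ∃ w : ℕ → Bool, (∀ i ∈ A.vars, v i = w i) ∧
      ∀ B ∈ (π.take k).map Line.formula, B.eval w = true := by
    intro k hk
    induction k with
    | zero => exact ⟨v, fun _ _ => rfl, by simp⟩
    | succ k ih =>
      obtain ⟨w, hw, hB⟩ := ih (by omega)
      have hk' : k < π.length := by omega
      have hl := h.1 k hk'
      rw [← List.take_concat_get' _ _ hk', List.map_append]
      suffices H : ∃ w : ℕ → Bool, (∀ i ∈ A.vars, v i = w i) ∧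
          (∀ B ∈ (π.take k).map Line.formula, B.eval w = true) ∧
          (π[k]).formula.eval w = true by
        obtain ⟨w, h1, h2, h3⟩ := H
        refine ⟨w, h1, fun B hB => ?_⟩
        rcases List.mem_append.1 hB with h | h
        · exact h2 B h
        · rw [List.map_singleton, List.mem_singleton] at h
          rw [h, h3]
      unfold Line.Correct at hl
      split at hl
      · obtain ⟨r, hr, σ, hσ, e⟩ := hl
        refine ⟨w, hw, hB, ?_⟩
        rw [e, Formula.eval_subst]
        exact S.frege.sound r hr _ fun C hC => by
          rw [← Formula.eval_subst]; exact hB _ (hσ C hC)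
      · rename_i p C _
        obtain ⟨e, hC, hp, hpA⟩ := hl
        have hne : ∀ D : Formula, p ∉ D.vars → ∀ i ∈ D.vars,
            w i = Function.update w p (C.eval w) i := fun D hD i hi => by
          rw [Function.update_of_ne]; rintro rfl; exact hD hi
        refine ⟨Function.update w p (C.eval w), fun i hi => (hw i hi).trans (hne A hpA i hi),
          fun B h => ?_, ?_⟩
        · rw [← Formula.eval_congr (hne B (hp B h)), hB B h]
        · rw [e, Formula.eval_iff, ← Formula.eval_congr (hne C hC)]
          simp [Formula.eval]
      · obtain ⟨hn, σ, e⟩ := hl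
        exact ⟨w, hw, hB, by rw [e]; exact (htt _ hn).subst σ w⟩
      · obtain ⟨hn, hq, hq', hc, σ, e⟩ := hl
        exact ⟨w, hw, hB, by rw [e]; exact (hself _ _ _ hn hq hq' hc.isGen).subst σ w⟩
  obtain ⟨w, hw, hB⟩ := key _ le_rfl
  rw [Formula.eval_congr hw]
  refine hB A ?_
  rw [List.take_length]
  exact List.mem_of_getLast? h.2

/-! ### Frege derivations -/

/-- The formulas of `L` are derived, in this order, from the hypotheses `Γ` by Frege rules. -/
inductive Seq (F : FregeSystem) (Γ : Set Formula) : List Formula → Prop where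
  | nil : Seq F Γ []
  | snoc {L : List Formula} (h : Seq F Γ L) (r : FregeRule) (hr : r ∈ F.rules) (σ : ℕ → Formula)
      (hp : ∀ A ∈ r.prems, A.subst σ ∈ Γ ∨ A.subst σ ∈ L) : Seq F Γ (L ++ [r.concl.subst σ])

/-- The number of symbols of a list of formulas. -/
def listSize (L : List Formula) : ℕ := (L.map Formula.size).sum

section
variable {F : FregeSystem} {Γ Γ' : Set Formula} {L L' : List Formula} {A B : Formula}

theorem Seq.append (h : Seq F Γ L) (h' : Seq F Γ' L') (hΓ : ∀ A ∈ Γ', A ∈ Γ ∨ A ∈ L) :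
    Seq F Γ (L ++ L') := by
  induction h' with
  | nil => simpa using h
  | snoc _ r hr σ hp ih =>
    rw [← List.append_assoc]
    refine ih.snoc r hr σ fun A hA => ?_
    rcases hp A hA with h1 | h1
    · exact (hΓ _ h1).imp_right (List.mem_append_left _)
    · exact .inr (List.mem_append_right _ h1)

theorem Seq.subst (h : Seq F Γ L) (τ : ℕ → Formula) :
    Seq F ((Formula.subst τ) '' Γ) (L.map (Formula.subst τ)) := by
  induction h with
  | nil => exact .nil
  | snoc _ r hr σ hp ih =>
    rw [List.map_append, List.map_singleton, Formula.subst_subst]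
    refine ih.snoc r hr _ fun A hA => ?_
    rw [← Formula.subst_subst]
    exact (hp A hA).imp (Set.mem_image_of_mem _) (List.mem_map_of_mem)

theorem Seq.exists_last (h : Seq F Γ L) (hA : A ∈ L) :
    ∃ L', Seq F Γ (L' ++ [A]) ∧ listSize (L' ++ [A]) ≤ listSize L := by
  induction h with
  | nil => simp at hA
  | snoc h r hr σ hp ih =>
    rcases List.mem_append.1 hA with h1 | h1
    · obtain ⟨L', h2, h3⟩ := ih h1
      exact ⟨L', h2, h3.trans (by simp [listSize])⟩
    · rw [List.mem_singleton] at h1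
      rw [h1]
      exact ⟨_, h.snoc r hr σ hp, le_rfl⟩

theorem Derives.exists_seq {Δ : List Formula} (h : Derives F.rules Δ A) :
    ∃ L, Seq F {B | B ∈ Δ} L ∧ (A ∈ Δ ∨ A ∈ L) := by
  induction h with
  | hyp h => exact ⟨[], .nil, .inl h⟩
  | rule r hr σ _ ih =>
    have key : ∀ l : List Formula, (∀ A ∈ l, A ∈ r.prems) →
        ∃ L, Seq F {B | B ∈ Δ} L ∧ ∀ A ∈ l, A.subst σ ∈ Δ ∨ A.subst σ ∈ L := by
      intro l hl
      induction l with
      | nil => exact ⟨[], .nil, by simp⟩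
      | cons A l ihl =>
        obtain ⟨L, h1, h2⟩ := ihl fun B hB => hl B (by simp [hB])
        obtain ⟨L', h3, h4⟩ := ih A (hl A (by simp))
        refine ⟨L ++ L', h1.append h3 fun A hA => .inl hA, fun B hB => ?_⟩
        rcases List.mem_cons.1 hB with rfl | hB
        · exact h4.imp_right (List.mem_append_right _)
        · exact (h2 B hB).imp_right (List.mem_append_left _)
    obtain ⟨L, h1, h2⟩ := key r.prems fun _ h => h
    exact ⟨_, h1.snoc r hr σ h2, .inr (by simp)⟩

/-- `A` can be derived from `Γ` with at most `κ` symbols. -/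
def Drv (F : FregeSystem) (κ : ℕ) (Γ : Set Formula) (A : Formula) : Prop :=
  ∃ L, Seq F Γ L ∧ (A ∈ Γ ∨ A ∈ L) ∧ listSize L ≤ κ

/-- A sound schematic rule is derivable, at a cost linear in the sizes of the formulas that are
substituted. -/
theorem FregeSystem.exists_rule (F : FregeSystem) {Δ : List Formula} {B : Formula}
    (h : ∀ v, (∀ A ∈ Δ, A.eval v = true) → B.eval v = true) :
    ∃ K, ∀ K' ≥ K, ∀ s ≥ 1, ∀ σ : ℕ → Formula, (∀ i, (σ i).size ≤ s) →
      Drv F (K' * s) {A | A ∈ Δ.map (Formula.subst σ)} (B.subst σ) := by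
  obtain ⟨L, h1, h2⟩ := (F.complete Δ B h).exists_seq
  refine ⟨listSize L, fun K' hK s hs σ hσ => ⟨L.map (Formula.subst σ), ?_, ?_, ?_⟩⟩
  · have e : {A | A ∈ Δ.map (Formula.subst σ)} = Formula.subst σ '' {A | A ∈ Δ} := by
      ext; simp
    rw [e]
    exact h1.subst σ
  · exact h2.imp (List.mem_map_of_mem) (List.mem_map_of_mem)
  · refine le_trans ?_ (Nat.mul_le_mul_right s hK)
    clear h1 h2 hK
    induction L with
    | nil => simp [listSize]
    | cons A L ih =>
      have := Formula.size_subst_le hs hσ A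
      simp only [listSize, List.map_cons, List.sum_cons] at ih ⊢
      nlinarith

/-- The formulas that can be reached from `Γ` by steps of cost at most `κ` within `U`. Derivations of
polynomial size are found without writing them down: if `U` is small, then everything that can be
reached has a short derivation, however often the formulas in between are used. -/
inductive Reach (F : FregeSystem) (κ : ℕ) (Γ : Set Formula) (U : Finset Formula) :
    Formula → Prop where
  | base {A : Formula} (h : A ∈ Γ) : Reach F κ Γ U A
  | step {A : Formula} (Δ : Set Formula) (h : ∀ B ∈ Δ, Reach F κ Γ U B) (hA : A ∈ U)
      (hd : Drv F κ Δ A) : Reach F κ Γ U A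

open Classical in
/-- Everything that can be reached within `U` has a derivation in which every member of `U` is
derived at most once. -/
theorem Reach.drv {κ : ℕ} {U : Finset Formula} (h : Reach F κ Γ U A) :
    Drv F (U.card * κ) Γ A := by
  let P : Finset Formula → Prop := fun V => ∃ L, Seq F Γ L ∧ (∀ B ∈ V, B ∈ Γ ∨ B ∈ L) ∧
    listSize L ≤ V.card * κ
  have hne : (U.powerset.filter P).Nonempty :=
    ⟨∅, by simp only [Finset.mem_filter, Finset.empty_mem_powerset, true_and]
           exact ⟨[], .nil, by simp, by simp [listSize]⟩⟩
  obtain ⟨V, hV, hmax⟩ := Finset.exists_max_image _ Finset.card hne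
  simp only [Finset.mem_filter, Finset.mem_powerset] at hV hmax
  obtain ⟨hVU, L, hL, hVL, hs⟩ := hV
  suffices H : A ∈ Γ ∨ A ∈ L from
    ⟨L, hL, H, hs.trans (Nat.mul_le_mul_right _ (Finset.card_le_card hVU))⟩
  induction h with
  | base h => exact .inl h
  | @step A Δ h hA hd ih =>
    by_contra hcon
    obtain ⟨L', h1, h2, h3⟩ := hd
    have hAV : A ∉ V := fun hAV => hcon (hVL A hAV)
    have := hmax (insert A V) ⟨Finset.insert_subset hA hVU, L ++ L', hL.append h1 ih, ?_, ?_⟩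
    · rw [Finset.card_insert_of_notMem hAV] at this
      omega
    · intro B hB
      rcases Finset.mem_insert.1 hB with rfl | hB
      · rcases h2 with h2 | h2
        · exact (ih _ h2).imp_right (List.mem_append_left _)
        · exact .inr (List.mem_append_right _ h2)
      · exact (hVL B hB).imp_right (List.mem_append_left _)
    · rw [Finset.card_insert_of_notMem hAV, Nat.succ_mul]
      simp only [listSize, List.map_append, List.sum_append] at hs h3 ⊢
      omega

end

/-- Every line of `π` is correct, for a proof of `A`. -/
def PSystem.Lines (S : PSystem) (A : Formula) (π : List Line) : Prop :=
  ∀ (i : ℕ) (h : i < π.length), (π[i]).Correct S A ((π.take i).map Line.formula)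

section
variable {S : PSystem} {π : List Line} {A : Formula}

theorem PSystem.Lines.snoc (h : S.Lines A π) {l : Line}
    (hl : l.Correct S A (π.map Line.formula)) : S.Lines A (π ++ [l]) := by
  intro i hi
  rcases Nat.lt_or_ge i π.length with h1 | h1
  · rw [List.getElem_append_left h1, List.take_append_of_le_length h1.le]
    exact h i h1
  · have : i = π.length := by simp at hi; omega
    subst this
    simpa using hl

theorem Seq.lines {L : List Formula} (hπ : S.Lines A π)
    (h : Seq S.frege {B | B ∈ π.map Line.formula} L) :
    S.Lines A (π ++ L.map fun B => ⟨B, .rule⟩) := by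
  induction h with
  | nil => simpa using hπ
  | snoc _ r hr σ hp ih =>
    rw [List.map_append, ← List.append_assoc]
    refine ih.snoc ⟨r, hr, σ, fun B hB => ?_, rfl⟩
    rw [List.map_append, List.mem_append, List.map_map]
    refine (hp B hB).imp_right fun h => ?_
    simpa [Function.comp_def] using h

theorem proofSize_rules (L : List Formula) :
    proofSize (L.map fun B => ⟨B, .rule⟩) = listSize L := by
  simp only [proofSize, listSize, List.map_map]
  rfl

/-- A Frege derivation from a single correct line yields a proof. -/
theorem PSystem.exists_proof_of_line {κ : ℕ} {l : Line} (hl : l.Correct S A [])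
    (h : Drv S.frege κ {l.formula} A) :
    ∃ π, S.IsProof π A ∧ proofSize π ≤ l.size + κ := by
  have h1 : S.Lines A [l] := PSystem.Lines.snoc (π := []) (fun i hi => by simp at hi) hl
  obtain ⟨L, hL, hA, hs⟩ := h
  rcases hA with hA | hA
  · rw [Set.mem_singleton_iff] at hA
    exact ⟨[l], ⟨h1, by simp [hA]⟩, by simp [proofSize]⟩
  · obtain ⟨L', hL', hs'⟩ := hL.exists_last hA
    have e : ({l.formula} : Set Formula) = {B | B ∈ [l].map Line.formula} := by ext; simp
    rw [e] at hL'
    refine ⟨_, ⟨hL'.lines h1, ?_⟩, ?_⟩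
    · simp only [List.map_append, List.map_cons, List.map_nil, ← List.append_assoc,
        List.getLast?_concat]
    · have := proofSize_rules (L' ++ [A])
      simp only [proofSize, List.map_append, List.sum_append] at this ⊢
      simp only [List.map_cons, List.map_nil, List.sum_cons, List.sum_nil] at this ⊢
      omega

/-- Completeness: the Frege system alone proves all tautologies. -/
theorem PSystem.exists_proof (S : PSystem) (h : A.Tautology) : ∃ π, S.IsProof π A := by
  obtain ⟨L, hL, hA⟩ := (S.frege.complete [] A fun v _ => h v).exists_seq
  have hA : A ∈ L := hA.resolve_left (by simp)
  obtain ⟨L', hL', -⟩ := hL.exists_last hA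
  have h0 : S.Lines A [] := fun i hi => by simp at hi
  refine ⟨_, hL'.lines (π := []) h0, ?_⟩
  simp only [List.map_append, List.map_cons, List.map_nil, ← List.append_assoc,
    List.getLast?_concat]

end

end SelfProv

namespace SelfProv

/-! ### Derived rules -/

namespace Formula

theorem subst_lit (σ : ℕ → Formula) (A : Formula) (b : Bool) :
    (lit A b).subst σ = lit (A.subst σ) b := by cases b <;> rfl

theorem subst_iff (σ : ℕ → Formula) (A B : Formula) :
    (iff A B).subst σ = iff (A.subst σ) (B.subst σ) := rfl

theorem subst_bigOr (σ : ℕ → Formula) (l : List Formula) :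
    (bigOr l).subst σ = bigOr (l.map (Formula.subst σ)) := by
  induction l with
  | nil => rfl
  | cons A l ih => simp [bigOr, Formula.subst, ih]

theorem subst_bigAnd (σ : ℕ → Formula) (l : List Formula) :
    (bigAnd l).subst σ = bigAnd (l.map (Formula.subst σ)) := by
  induction l with
  | nil => rfl
  | cons A l ih => simp [bigAnd, Formula.subst, ih]

theorem subst_ofOp (σ : ℕ → Formula) (op : Bool → Bool → Bool) (A B : Formula) :
    (ofOp op A B).subst σ = ofOp op (A.subst σ) (B.subst σ) := by
  simp only [ofOp, subst_bigOr, List.map_map]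
  congr 1
  refine List.map_congr_left fun u _ => ?_
  simp [Formula.subst, subst_lit]

theorem subst_gateFormula (σ : ℕ → Formula) (p : ℕ) (g : Gate) :
    (gateFormula p g).subst σ = iff (σ p) (ofOp g.op (σ g.left) (σ g.right)) := by
  simp only [gateFormula, subst_iff, subst_ofOp, Formula.subst]

end Formula

open Formula

/-- The cost of deriving any instance of the rule is at most `K` times the sizes of the formulas
that are substituted. -/
def RuleBound (F : FregeSystem) (K : ℕ) (Δ : List Formula) (B : Formula) : Prop :=
  ∀ K' ≥ K, ∀ s ≥ 1, ∀ σ : ℕ → Formula, (∀ i, (σ i).size ≤ s) →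
    Drv F (K' * s) {A | A ∈ Δ.map (Formula.subst σ)} (B.subst σ)

/-- A common bound for finitely many rules; the index `ι` ranges over the instances of
a rule for different gates. -/
theorem FregeSystem.exists_rules (F : FregeSystem) {ι : Type} [Fintype ι] (Δ : ι → List Formula)
    (B : ι → Formula) (h : ∀ i v, (∀ A ∈ Δ i, A.eval v = true) → (B i).eval v = true) :
    ∃ K, ∀ i, RuleBound F K (Δ i) (B i) := by
  choose K hK using fun i => F.exists_rule (h i)
  refine ⟨∑ i, K i, fun i K' h => hK i K' (le_trans ?_ h)⟩
  exact Finset.single_le_sum (f := K) (fun _ _ => Nat.zero_le _) (Finset.mem_univ i)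

/-- The set `R` of formulas is closed under the following rules, as long as the conclusion belongs
to `U` and the context has size at most `s`. All formulas are implications whose premise `X` is the
context. -/
structure Logic (U : Finset Formula) (s : ℕ) (R : Formula → Prop) : Prop where
  pos : 1 ≤ s
  cut : ∀ {X A B : Formula}, X.size ≤ s → A.size ≤ s → B.size ≤ s → imp X B ∈ U →
    R (imp X A) → R (imp A B) → R (imp X B)
  refl : ∀ {X : Formula}, X.size ≤ s → imp X X ∈ U → R (imp X X)
  top : ∀ {X : Formula}, X.size ≤ s → imp X .top ∈ U → R (imp X .top)
  andl : ∀ {X A B : Formula}, X.size ≤ s → A.size ≤ s → B.size ≤ s → imp X A ∈ U →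
    R (imp X (.and A B)) → R (imp X A)
  andr : ∀ {X A B : Formula}, X.size ≤ s → A.size ≤ s → B.size ≤ s → imp X B ∈ U →
    R (imp X (.and A B)) → R (imp X B)
  andi : ∀ {X A B : Formula}, X.size ≤ s → A.size ≤ s → B.size ≤ s → imp X (.and A B) ∈ U →
    R (imp X A) → R (imp X B) → R (imp X (.and A B))
  cases : ∀ {X A B : Formula}, X.size ≤ s → A.size ≤ s → B.size ≤ s → imp X B ∈ U →
    R (imp (.and X (lit A true)) B) → R (imp (.and X (lit A false)) B) → R (imp X B)
  gate : ∀ {X : Formula} {p a b : ℕ} {op : Bool → Bool → Bool} {α β : Bool}, X.size ≤ s →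
    imp X (lit (var p) (op α β)) ∈ U → R (imp X (gateFormula p ⟨op, a, b⟩)) →
    R (imp X (lit (var a) α)) → R (imp X (lit (var b) β)) → R (imp X (lit (var p) (op α β)))
  const : ∀ {X : Formula} {p a b : ℕ} {γ : Bool}, X.size ≤ s →
    imp X (lit (var p) γ) ∈ U → R (imp X (gateFormula p ⟨fun _ _ => γ, a, b⟩)) →
    R (imp X (lit (var p) γ))
  cong : ∀ {X : Formula} {p a b p' a' b' : ℕ} {op : Bool → Bool → Bool}, X.size ≤ s →
    imp X (iff (var p) (var p')) ∈ U → R (imp X (gateFormula p ⟨op, a, b⟩)) →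
    R (imp X (gateFormula p' ⟨op, a', b'⟩)) → R (imp X (iff (var a) (var a'))) →
    R (imp X (iff (var b) (var b'))) → R (imp X (iff (var p) (var p')))
  constCong : ∀ {X : Formula} {p a b p' a' b' : ℕ} {γ : Bool}, X.size ≤ s →
    imp X (iff (var p) (var p')) ∈ U → R (imp X (gateFormula p ⟨fun _ _ => γ, a, b⟩)) →
    R (imp X (gateFormula p' ⟨fun _ _ => γ, a', b'⟩)) → R (imp X (iff (var p) (var p')))
  transfer : ∀ {X : Formula} {a b : ℕ} {α : Bool}, X.size ≤ s →
    imp X (lit (var b) α) ∈ U → R (imp X (iff (var a) (var b))) → R (imp X (lit (var a) α)) →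
    R (imp X (lit (var b) α))
  iffRefl : ∀ {X : Formula} {a : ℕ}, X.size ≤ s →
    imp X (iff (var a) (var a)) ∈ U → R (imp X (iff (var a) (var a)))
  iffTrans : ∀ {X : Formula} {a b c : ℕ}, X.size ≤ s →
    imp X (iff (var a) (var c)) ∈ U → R (imp X (iff (var a) (var b))) →
    R (imp X (iff (var b) (var c))) → R (imp X (iff (var a) (var c)))
  mux : ∀ {X : Formula} {t a b x y p : ℕ} {β : Bool}, X.size ≤ s →
    imp X (iff (var (if β then a else b)) (var p)) ∈ U →
    R (imp X (gateFormula x ⟨fun x y => x && y, t, a⟩)) →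
    R (imp X (gateFormula y ⟨fun x y => !x && y, t, b⟩)) →
    R (imp X (gateFormula p ⟨fun x y => x || y, x, y⟩)) → R (imp X (lit (var t) β)) →
    R (imp X (iff (var (if β then a else b)) (var p)))
  refute : ∀ {X : Formula} {p i h c o : ℕ}, X.size ≤ s → imp X (lit (var i) false) ∈ U →
    R (imp X (gateFormula h ⟨fun x y => x && y, p, i⟩)) →
    R (imp X (gateFormula o ⟨fun x y => !x || y, h, c⟩)) →
    R (imp X (lit (var p) true)) → R (imp X (lit (var c) false)) →
    R (imp X (lit (var o) true)) → R (imp X (lit (var i) false))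
  andGate : ∀ {X : Formula} {t i e : ℕ}, X.size ≤ s → imp X (lit (var e) true) ∈ U →
    R (imp X (gateFormula t ⟨fun x y => x && y, i, e⟩)) → R (imp X (lit (var t) true)) →
    R (imp X (lit (var e) true))
  impGate : ∀ {X : Formula} {o i e : ℕ}, X.size ≤ s → imp X (lit (var o) true) ∈ U →
    R (imp X (gateFormula o ⟨fun x y => !x || y, i, e⟩)) →
    R (imp X (lit (var i) false)) ∨ R (imp X (lit (var e) true)) → R (imp X (lit (var o) true))

theorem RuleBound.reach {F : FregeSystem} {K K' s : ℕ} {Δ : List Formula} {B B' : Formula}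
    {Γ : Set Formula} {U : Finset Formula} (h : RuleBound F K Δ B) (hK : K ≤ K') (hs : 1 ≤ s)
    (l : List Formula) (hl : ∀ A ∈ l, A.size ≤ s)
    (hB : B.subst (fun i => l.getD i .top) = B') (hU : B' ∈ U)
    (hΔ : ∀ A ∈ Δ, Reach F (K' * s) Γ U (A.subst fun i => l.getD i .top)) :
    Reach F (K' * s) Γ U B' := by
  subst hB
  refine .step _ (fun A hA => ?_) hU (h K' hK s hs (fun i => l.getD i .top) fun i => ?_)
  · obtain ⟨C, hC, rfl⟩ := List.mem_map.1 hA
    exact hΔ C hC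
  · rcases Nat.lt_or_ge i l.length with hi | hi
    · rw [List.getD_eq_getElem _ _ hi]; exact hl _ (List.getElem_mem _)
    · rw [List.getD_eq_default _ _ hi]; exact hs

/-- Within a Frege system, the derived rules have a cost that is linear in the size of the
context. -/
theorem FregeSystem.exists_logic (F : FregeSystem) : ∃ K, ∀ s ≥ 1, ∀ (Γ : Set Formula)
    (U : Finset Formula), Logic U s (Reach F (K * s) Γ U) := by
  obtain ⟨k1, h1⟩ := F.exists_rules (ι := Unit)
    (fun _ => [imp (var 0) (var 1), imp (var 1) (var 2)]) (fun _ => imp (var 0) (var 2))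
    fun _ v => by simp [eval]; cases v 0 <;> cases v 1 <;> simp
  obtain ⟨k2, h2⟩ := F.exists_rules (ι := Unit) (fun _ => []) (fun _ => imp (var 0) (var 0))
    fun _ v => by simp [eval]
  obtain ⟨k3, h3⟩ := F.exists_rules (ι := Unit) (fun _ => []) (fun _ => imp (var 0) .top)
    fun _ v => by simp [eval]
  obtain ⟨k4, h4⟩ := F.exists_rules (ι := Unit) (fun _ => [imp (var 0) (.and (var 1) (var 2))])
    (fun _ => imp (var 0) (var 1)) fun _ v => by simp [eval]; cases v 0 <;> simp; tauto
  obtain ⟨k5, h5⟩ := F.exists_rules (ι := Unit) (fun _ => [imp (var 0) (.and (var 1) (var 2))])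
    (fun _ => imp (var 0) (var 2)) fun _ v => by simp [eval]; cases v 0 <;> simp
  obtain ⟨k6, h6⟩ := F.exists_rules (ι := Unit)
    (fun _ => [imp (var 0) (var 1), imp (var 0) (var 2)])
    (fun _ => imp (var 0) (.and (var 1) (var 2)))
    fun _ v => by simp [eval]; cases v 0 <;> simp; tauto
  obtain ⟨k7, h7⟩ := F.exists_rules (ι := Unit)
    (fun _ => [imp (.and (var 0) (lit (var 1) true)) (var 2),
      imp (.and (var 0) (lit (var 1) false)) (var 2)]) (fun _ => imp (var 0) (var 2))
    fun _ v => by simp [eval, lit]; cases v 0 <;> cases v 1 <;> simp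
  obtain ⟨k8, h8⟩ := F.exists_rules (ι := (Bool → Bool → Bool) × Bool × Bool)
    (fun i => [imp (var 0) (gateFormula 1 ⟨i.1, 2, 3⟩), imp (var 0) (lit (var 2) i.2.1),
      imp (var 0) (lit (var 3) i.2.2)]) (fun i => imp (var 0) (lit (var 1) (i.1 i.2.1 i.2.2)))
    fun i v => by
      simp [eval, gateFormula]; cases v 0 <;> simp
      intro h1 h2 h3; rw [h1, h2, h3]
  obtain ⟨k9, h9⟩ := F.exists_rules (ι := Bool)
    (fun i => [imp (var 0) (gateFormula 1 ⟨fun _ _ => i, 2, 3⟩)])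
    (fun i => imp (var 0) (lit (var 1) i))
    fun i v => by simp [eval, gateFormula]
  obtain ⟨k10, h10⟩ := F.exists_rules (ι := Bool → Bool → Bool)
    (fun i => [imp (var 0) (gateFormula 1 ⟨i, 2, 3⟩), imp (var 0) (gateFormula 4 ⟨i, 5, 6⟩),
      imp (var 0) (iff (var 2) (var 5)), imp (var 0) (iff (var 3) (var 6))])
    (fun i => imp (var 0) (iff (var 1) (var 4)))
    fun i v => by
      simp [eval, gateFormula]; cases v 0 <;> simp
      intro h1 h2 h3 h4; rw [h1, h2, h3, h4]
  obtain ⟨k11, h11⟩ := F.exists_rules (ι := Bool)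
    (fun i => [imp (var 0) (gateFormula 1 ⟨fun _ _ => i, 2, 3⟩),
      imp (var 0) (gateFormula 4 ⟨fun _ _ => i, 5, 6⟩)])
    (fun i => imp (var 0) (iff (var 1) (var 4)))
    fun i v => by
      simp [eval, gateFormula]; cases v 0 <;> simp
      intro h1 h2; rw [h1, h2]
  obtain ⟨k12, h12⟩ := F.exists_rules (ι := Bool)
    (fun i => [imp (var 0) (iff (var 1) (var 2)), imp (var 0) (lit (var 1) i)])
    (fun i => imp (var 0) (lit (var 2) i))
    fun i v => by
      simp [eval]; cases v 0 <;> simp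
      intro h1 h2; rw [← h1, h2]
  obtain ⟨k13, h13⟩ := F.exists_rules (ι := Unit) (fun _ => [])
    (fun _ => imp (var 0) (iff (var 1) (var 1))) fun _ v => by simp [eval]
  obtain ⟨k14, h14⟩ := F.exists_rules (ι := Unit)
    (fun _ => [imp (var 0) (iff (var 1) (var 2)), imp (var 0) (iff (var 2) (var 3))])
    (fun _ => imp (var 0) (iff (var 1) (var 3)))
    fun _ v => by
      simp [eval]; cases v 0 <;> simp
      intro h1 h2; rw [h1, h2]
  obtain ⟨k15, h15⟩ := F.exists_rules (ι := Bool)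
    (fun i => [imp (var 0) (gateFormula 4 ⟨fun x y => x && y, 1, 2⟩),
      imp (var 0) (gateFormula 5 ⟨fun x y => !x && y, 1, 3⟩),
      imp (var 0) (gateFormula 6 ⟨fun x y => x || y, 4, 5⟩), imp (var 0) (lit (var 1) i)])
    (fun i => imp (var 0) (iff (if i then var 2 else var 3) (var 6)))
    fun i v => by
      simp [eval, gateFormula]; cases v 0 <;> simp
      intro h1 h2 h3 h4; rw [h3, h1, h2, h4]; cases i <;> simp [eval]
  obtain ⟨k16, h16⟩ := F.exists_rules (ι := Unit)
    (fun _ => [imp (var 0) (gateFormula 3 ⟨fun x y => x && y, 1, 2⟩),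
      imp (var 0) (gateFormula 5 ⟨fun x y => !x || y, 3, 4⟩), imp (var 0) (lit (var 1) true),
      imp (var 0) (lit (var 4) false), imp (var 0) (lit (var 5) true)])
    (fun _ => imp (var 0) (lit (var 2) false))
    fun i v => by
      simp only [List.mem_cons, List.not_mem_nil, or_false, forall_eq_or_imp, forall_eq, eval,
        gateFormula, Bool.or_eq_true, Bool.not_eq_true', eval_iff, eval_ofOp, eval_lit]
      cases v 0 <;> simp
      intro h1 h2 h3 h4 h5; simp_all
  obtain ⟨k17, h17⟩ := F.exists_rules (ι := Unit)
    (fun _ => [imp (var 0) (gateFormula 1 ⟨fun x y => x && y, 2, 3⟩),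
      imp (var 0) (lit (var 1) true)]) (fun _ => imp (var 0) (lit (var 3) true))
    fun i v => by
      simp only [List.mem_cons, List.not_mem_nil, or_false, forall_eq_or_imp, forall_eq, eval,
        gateFormula, Bool.or_eq_true, Bool.not_eq_true', eval_iff, eval_ofOp, eval_lit]
      cases v 0 <;> simp
      intro h1 h2; simp_all
  obtain ⟨k18, h18⟩ := F.exists_rules (ι := Unit)
    (fun _ => [imp (var 0) (gateFormula 1 ⟨fun x y => !x || y, 2, 3⟩),
      imp (var 0) (lit (var 2) false)]) (fun _ => imp (var 0) (lit (var 1) true))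
    fun i v => by
      simp only [List.mem_cons, List.not_mem_nil, or_false, forall_eq_or_imp, forall_eq, eval,
        gateFormula, Bool.or_eq_true, Bool.not_eq_true', eval_iff, eval_ofOp, eval_lit]
      cases v 0 <;> simp
      intro h1 h2; simp_all
  obtain ⟨k19, h19⟩ := F.exists_rules (ι := Unit)
    (fun _ => [imp (var 0) (gateFormula 1 ⟨fun x y => !x || y, 2, 3⟩),
      imp (var 0) (lit (var 3) true)]) (fun _ => imp (var 0) (lit (var 1) true))
    fun i v => by
      simp only [List.mem_cons, List.not_mem_nil, or_false, forall_eq_or_imp, forall_eq, eval,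
        gateFormula, Bool.or_eq_true, Bool.not_eq_true', eval_iff, eval_ofOp, eval_lit]
      cases v 0 <;> simp
      intro h1 h2; simp_all
  refine ⟨k1 + k2 + k3 + k4 + k5 + k6 + k7 + k8 + k9 + k10 + k11 + k12 + k13 + k14 + k15 + k16 +
    k17 + k18 + k19, fun s hs Γ U => ?_⟩
  have hv : ∀ i, (var i).size ≤ s := fun _ => hs
  constructor
  case pos => exact hs
  case cut =>
    intro X A B hX hA hB hU d1 d2
    exact (h1 ()).reach (by omega) hs [X, A, B] (by simp [hX, hA, hB]) rfl hU
      (by simp [Formula.subst, d1, d2])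
  case refl =>
    intro X hX hU
    exact (h2 ()).reach (by omega) hs [X] (by simp [hX]) rfl hU (by simp)
  case top =>
    intro X hX hU
    exact (h3 ()).reach (by omega) hs [X] (by simp [hX]) rfl hU (by simp)
  case andl =>
    intro X A B hX hA hB hU d1
    exact (h4 ()).reach (by omega) hs [X, A, B] (by simp [hX, hA, hB]) rfl hU
      (by simp [Formula.subst, d1])
  case andr =>
    intro X A B hX hA hB hU d1
    exact (h5 ()).reach (by omega) hs [X, A, B] (by simp [hX, hA, hB]) rfl hU
      (by simp [Formula.subst, d1])
  case andi =>
    intro X A B hX hA hB hU d1 d2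
    exact (h6 ()).reach (by omega) hs [X, A, B] (by simp [hX, hA, hB]) rfl hU
      (by simp [Formula.subst, d1, d2])
  case cases =>
    intro X A B hX hA hB hU d1 d2
    exact (h7 ()).reach (by omega) hs [X, A, B] (by simp [hX, hA, hB]) rfl hU
      (by simp [Formula.subst, subst_lit, d1, d2])
  case gate =>
    intro X p a b op α β hX hU d1 d2 d3
    exact (h8 (op, α, β)).reach (by omega) hs [X, var p, var a, var b] (by simp [hX, hv])
      (by simp [Formula.subst, subst_lit]) hU
      (by simpa [Formula.subst, subst_lit, subst_gateFormula] using ⟨d1, d2, d3⟩)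
  case const =>
    intro X p a b γ hX hU d1
    exact (h9 γ).reach (by omega) hs [X, var p, var a, var b] (by simp [hX, hv])
      (by simp [Formula.subst, subst_lit]) hU
      (by
        simp only [List.mem_singleton, forall_eq, Formula.subst, subst_gateFormula]
        exact d1)
  case cong =>
    intro X p a b p' a' b' op hX hU d1 d2 d3 d4
    exact (h10 op).reach (by omega) hs [X, var p, var a, var b, var p', var a', var b']
      (by simp [hX, hv]) rfl hU
      (by simpa [Formula.subst, subst_iff, subst_gateFormula] using ⟨d1, d2, d3, d4⟩)
  case constCong =>
    intro X p a b p' a' b' γ hX hU d1 d2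
    exact (h11 γ).reach (by omega) hs [X, var p, var a, var b, var p', var a', var b']
      (by simp [hX, hv]) rfl hU
      (by simpa [Formula.subst, subst_iff, subst_gateFormula] using ⟨d1, d2⟩)
  case transfer =>
    intro X a b α hX hU d1 d2
    exact (h12 α).reach (by omega) hs [X, var a, var b] (by simp [hX, hv])
      (by simp [Formula.subst, subst_lit]) hU
      (by simpa [Formula.subst, subst_lit, subst_iff] using ⟨d1, d2⟩)
  case iffRefl =>
    intro X a hX hU
    exact (h13 ()).reach (by omega) hs [X, var a] (by simp [hX, hv]) rfl hU (by simp)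
  case iffTrans =>
    intro X a b c hX hU d1 d2
    exact (h14 ()).reach (by omega) hs [X, var a, var b, var c] (by simp [hX, hv]) rfl hU
      (by simpa [Formula.subst, subst_iff] using ⟨d1, d2⟩)
  case mux =>
    intro X t a b x y p β hX hU d1 d2 d3 d4
    exact (h15 β).reach (by omega) hs [X, var t, var a, var b, var x, var y, var p]
      (by simp [hX, hv]) (by cases β <;> rfl) hU
      (by simpa [Formula.subst, subst_lit, subst_gateFormula] using ⟨d1, d2, d3, d4⟩)
  case refute =>
    intro X p i h c o hX hU d1 d2 d3 d4 d5
    exact (h16 ()).reach (by omega) hs [X, var p, var i, var h, var c, var o]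
      (by simp [hX, hv]) rfl hU
      (by simpa [Formula.subst, subst_lit, subst_gateFormula] using ⟨d1, d2, d3, d4, d5⟩)
  case andGate =>
    intro X t i e hX hU d1 d2
    exact (h17 ()).reach (by omega) hs [X, var t, var i, var e]
      (by simp [hX, hv]) rfl hU
      (by simpa [Formula.subst, subst_lit, subst_gateFormula] using ⟨d1, d2⟩)
  case impGate =>
    rintro X o i e hX hU d1 (d2 | d2)
    · exact (h18 ()).reach (by omega) hs [X, var o, var i, var e]
        (by simp [hX, hv]) rfl hU
        (by simpa [Formula.subst, subst_lit, subst_gateFormula] using ⟨d1, d2⟩)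
    · exact (h19 ()).reach (by omega) hs [X, var o, var i, var e]
        (by simp [hX, hv]) rfl hU
        (by simpa [Formula.subst, subst_lit, subst_gateFormula] using ⟨d1, d2⟩)

end SelfProv

namespace SelfProv

open List (Forall₂)

/-! ### The wires of the self-reducibility formula -/

theorem Netlist.Has.lt {G : Netlist} {p : ℕ} {g : Gate} (h : G.Has p g) : p < G.width := by
  obtain ⟨i, hi, rfl⟩ := h
  exact Nat.add_lt_add_left (List.getElem?_eq_some_iff.1 hi).1 _

/-- The exponent `C(b g ^ r) - r` that the test of the reduction tries out. -/
def reducedExp (n q g s : ℕ) (desc b r : List Wire) : Build (List Wire) := do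
  let t ← powMod n q g r
  let h ← mulMod n q b t
  let l ← evalDesc n s n desc h
  subExp n q l r

theorem reducedTest_eq (n q g s : ℕ) (desc b r : List Wire) :
    reducedTest n q g s desc b r = (do
      let a ← reducedExp n q g s desc b r
      let y ← powMod n q g a
      let e ← eqList y b
      let i ← inGroup n q r
      band i e) := by
  simp only [reducedTest, reducedExp, bind_assoc]

section
variable {R : ℕ → ℕ → Prop} {G G' : Netlist} {v : ℕ → Bool} {n q g s : ℕ}

theorem Cons.subExp_length (hv : Cons v G) (hqn : q ≤ 2 ^ n) (l r : List ℕ) (hl : l.length = n)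
    (hr : r.length = n) : Sem G (SelfProv.subExp n q l r) fun a => a.length = n := by
  have h1 : q - 1 < 2 ^ (n + 1) := by
    have : 0 < 2 ^ n := by positivity
    rw [pow_succ]; omega
  refine (hv.const false).bind fun z _ =>
    (hv.condSub (q - 1) (l ++ [z]) (by simpa [hl] using h1)).bind fun l' hl' =>
    (hv.constBits (n + 1) (q - 1)).bind fun c hc => (hv.sub c (r ++ [z]) (by simp [hc.1, hr])).bind
    fun r' hr' => (hv.add l' r'.1 (by simp [hl'.1, hr'.1, hl, hr])).bind fun s hs =>
    (hv.condSub (q - 1) s (by simpa [hs.1, hr'.1, hr] using h1)).bind fun t ht => .pure ?_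
  simp [ht.1, hs.1, hr'.1, hr]

/-- If `b = 0`, then the exponent has `n` bits, whatever `r` is. -/
theorem Cons.reducedExp_length (hv : Cons v G) (hn : 0 < n) (hqn : q ≤ 2 ^ n) (hg : IsGen q g)
    (d b r : List ℕ) (hd : d.length = descLen n s n) (hb : b.length = n) (hr : r.length = n)
    (hb0 : val v b = 0) : Sem G (SelfProv.reducedExp n q g s d b r) fun a => a.length = n := by
  obtain ⟨h1, h2⟩ := hg.lt
  refine (hv.powMod n q g hqn h1 h2 r).bind fun t _ =>
    (hv.mulMod n q hqn b t hb (by omega)).bind fun h hh =>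
    (hv.evalDesc n s n hn d h hd hh.1).bind fun l hl => hv.subExp_length hqn l r ?_ hr
  simpa [Circuit.eval, (decodeCircuit_wf hn s n _).2.1] using congrArg List.length hl

theorem Closed.reducedExp (hR : Closed R G G') {d d' b b' r r' : List ℕ}
    (hd : Forall₂ R d d') (hlen : descLen n s n ≤ d.length) (hb : Forall₂ R b b')
    (hr : Forall₂ R r r') (hlen' : ∀ t, Sem G (SelfProv.mulMod n q b t) fun h => h ≠ []) :
    Par G G' (SelfProv.reducedExp n q g s d b r) (SelfProv.reducedExp n q g s d' b' r') (Forall₂ R) := by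
  refine (hR.powMod n q g hr).bind fun t t' ht => Par.bind
    (Q := fun h h' => Forall₂ R h h' ∧ h ≠ [])
    (fun h h' hh hh' => ⟨hR.mulMod n q hb ht h h' hh hh', hlen' t h hh⟩) fun h h' hh =>
    (hR.evalDesc n s n hd hlen hh.1 hh.2).bind fun l l' hl => hR.subExp n q hl hr

theorem Closed.premWire (hR : Closed R G G') {xs : List (List Bool)} (hxs : ∀ x ∈ xs, x ≠ [])
    {P P' d d' : List ℕ} (hP : Forall₂ R P P') (hd : Forall₂ R d d')
    (hlen : descLen n s n ≤ d.length) :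
    Par G G' (SelfProv.premWire n q g s xs P d) (SelfProv.premWire n q g s xs P' d') R := by
  refine (Par.mapM _ _ xs fun x hx => ?_).bind fun t t' ht => (hR.count _ ht).bind
    fun k k' hk => (hR.mulConst _ _ hk).bind fun l l' hl => (hR.mulConst _ _ hP).bind
    fun r r' hr => hR.geq hl hr
  refine Par.bind (Q := fun r r' => Forall₂ R r r' ∧ r ≠ []) (fun r r' h h' => ?_) fun r r' hr =>
    hR.dlogTest n q g s hd hlen hr.1 hr.2
  refine ⟨hR.constList x r r' h h', fun h0 => hxs x hx ?_⟩
  subst h0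
  cases x with
  | nil => rfl
  | cons b x =>
    obtain ⟨_, _, h⟩ := h.bind
    obtain ⟨_, _, h⟩ := h.bind
    cases h.pure

theorem Closed.conclWire (hR : Closed R G G') (T : ℕ) {P P' t t' : List ℕ}
    (hP : Forall₂ R P P') (ht : Forall₂ R t t') :
    Par G G' (SelfProv.conclWire n T P t) (SelfProv.conclWire n T P' t') R :=
  (hR.count _ ht).bind fun _ _ hk => (hR.mulConst _ _ hk).bind fun _ _ hu =>
    (hR.constBits _ _).bind fun _ _ hc => (hR.add hu hc).bind fun _ _ hl =>
    (hR.mulConst _ _ hP).bind fun _ _ hr => hR.geq hl hr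

/-- The parts of a test of the reduction: it is the conjunction of `1 ≤ r < q` and `g ^ a = b`, for
some list `a` of wires. -/
theorem exists_exponent (hv : Cons v G) (hn : 0 < n) (hqn : q ≤ 2 ^ n) (hg : IsGen q g)
    {d b : List ℕ} (hd : d.length = descLen n s n) (hb : b.length = n) (hb0 : val v b = 0)
    (hdG : ∀ w ∈ d, w < G.width) (hbG : ∀ w ∈ b, w < G.width) {x : List Bool} (hx : x.length = n)
    {t : ℕ} (h : Runs G (do
      let r ← constList x
      reducedTest n q g s d b r) t) :
    t < G.width ∧ ∃ a : List ℕ, Bd G.width n a ∧ ∃ y e i, Runs G (powMod n q g a) y ∧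
      Runs G (eqList y b) e ∧ G.Has t ⟨fun x y => x && y, i, e⟩ := by
  obtain ⟨r, hr, h⟩ := h.bind
  rw [reducedTest_eq] at h
  obtain ⟨a, ha, h⟩ := h.bind
  obtain ⟨y, hy, h⟩ := h.bind
  obtain ⟨e, he, h⟩ := h.bind
  obtain ⟨i, -, h⟩ := h.bind
  have hrl : r.length = n := by
    have := congrArg List.length (hv.constList x r hr)
    rwa [List.length_map, hx] at this
  have hR : Closed (fun p _ => p < G.width) G G := fun p _ _ _ _ _ _ hp _ _ => hp.lt
  have refl : ∀ l : List ℕ, (∀ w ∈ l, w < G.width) →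
      Forall₂ (fun p _ => p < G.width) l l := fun l hl => List.forall₂_same.2 hl
  have hmul : ∀ t, Sem G (mulMod n q b t) fun h => h ≠ [] := fun t =>
    (hv.mulMod n q hqn b t hb (by have := hg.lt; omega)).mono fun l hl h0 => by
      rw [h0] at hl
      exact absurd hl.1.symm hn.ne'
  have h1 := hR.reducedExp (refl d hdG) hd.ge (refl b hbG) (hR.constList x r r hr hr) hmul a a ha ha
  exact ⟨h.emit.lt, a, ⟨hv.reducedExp_length hn hqn hg d b r hd hb hrl hb0 a ha,
    List.forall₂_same.1 h1⟩, y, e, i, hy, he, h.emit⟩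

end

section
variable {A n : ℕ}

/-- A bound on the number of gates of `selfBody`. -/
def selfCost (n s T : ℕ) : ℕ :=
  let w := 2 * n + Nat.size T + 4
  2 * (T * testCost n s) + 2 * (T * (6 * w) + w) + 2 * (w * (10 * w + 2) + w) +
    2 * (n * (10 * w + 2) + w) + 18 * w + 8 * n + 30

theorem good_premWire (q g s : ℕ) {xs : List (List Bool)} (hxs : ∀ x ∈ xs, x.length = n)
    (hn : 0 < n) {P d : List ℕ} (hP : Bd A n P) (hd : Bd A (descLen n s n) d) :
    Good (premWire n q g s xs P d) A
      (xs.length * testCost n s +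
        (xs.length * (6 * (2 * n + Nat.size xs.length + 4)) + (2 * n + Nat.size xs.length + 4)) +
        ((2 * n + Nat.size xs.length + 4) * (10 * (2 * n + Nat.size xs.length + 4) + 2) +
          (2 * n + Nat.size xs.length + 4)) +
        (n * (10 * (2 * n + Nat.size xs.length + 4) + 2) + (2 * n + Nat.size xs.length + 4)) +
        (6 * (2 * n + Nat.size xs.length + 4) + 1)) fun B (p : ℕ) => p < B := by
  have h1 : ∀ x ∈ xs, ∀ B, A ≤ B → Good (do
      let x' ← constList x
      dlogTest n q g s d x') B (testCost n s) fun C (p : ℕ) => p < C := fun x hx B hB =>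
    ((good_constList x).bind fun r C hC hr =>
      good_dlogTest q g s ((hd.le hB).le hC) (hxs x hx ▸ hr) hn).cost (by
        rw [hxs x hx, testCost]; ring_nf; omega)
  exact ((good_mapM _ _ xs h1).bind fun t B hB ht => (good_count _ ht).bind fun k C hC hk =>
    (good_mulConst _ _ hk).bind fun l D hD hl =>
    (good_mulConst _ _ (((hP.le hB).le hC).le hD)).bind fun r E hE hr =>
    good_geq (hl.le hE) hr).cost (by omega)

theorem good_conclWire (T : ℕ) {P t : List ℕ} (hP : Bd A n P) (ht : Bd A T t) :
    Good (conclWire n T P t) A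
      ((T * (6 * (2 * n + Nat.size T + 4)) + (2 * n + Nat.size T + 4)) +
        ((2 * n + Nat.size T + 4) * (10 * (2 * n + Nat.size T + 4) + 2) +
          (2 * n + Nat.size T + 4)) +
        (n * (10 * (2 * n + Nat.size T + 4) + 2) + (2 * n + Nat.size T + 4)) +
        (12 * (2 * n + Nat.size T + 4) + 2)) fun B (p : ℕ) => p < B :=
  ((good_count _ ht).bind fun _ _ hC hk => (good_mulConst _ _ hk).bind fun _ _ hD hu =>
    (good_constBits _ _).bind fun _ _ hE hc => (good_add (hu.le hE) hc).bind fun _ _ hF hl =>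
    (good_mulConst _ _ ((((hP.le hC).le hD).le hE).le hF)).bind fun _ _ hH hr =>
    good_geq (hl.le hH) hr).cost (by omega)

theorem good_selfBody (q g s : ℕ) {xs : List (List Bool)} (hxs : ∀ x ∈ xs, x.length = n)
    (hn : 0 < n) {P b d : List ℕ} (hP : Bd A n P) (hb : Bd A n b) (hd : Bd A (descLen n s n) d) :
    Good (selfBody n q g s xs P b d) A (selfCost n s xs.length) fun B (p : ℕ) => p < B := by
  unfold selfBody
  refine ((good_premWire q g s hxs hn hP hd).bind fun p B hB hp =>
    (good_inGroup q (hb.le hB)).bind fun i C hC hi =>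
    (good_mapM (t := testCost n s) _ xs fun x hx D hD => ?_).bind fun t D hD ht =>
    (good_conclWire xs.length (((hP.le hB).le hC).le hD) ht).bind fun c E hE hc =>
    Good.bind (m := band p i) (t := 1) (t' := 1) (good_emit (by omega) (by omega))
      fun h H hH hh => good_emit hh (by omega)).cost ?_
  · exact ((good_constList x).bind fun r E hE hr =>
      good_reducedTest q g s ((((hd.le hB).le hC).le hD).le hE) ((((hb.le hB).le hC).le hD).le hE)
        (hxs x hx ▸ hr) hn).cost (by rw [hxs x hx, testCost]; omega)
  · simp only [selfCost]
    omega

/-! ### The circuit for the discrete logarithm -/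

/-- Given a list of tests together with candidates, the candidate of the first successful test. -/
def selectOut (n : ℕ) : List (Wire × List Wire) → Build (List Wire)
  | [] => constBits n 0
  | t :: ts => do
    let r ← selectOut n ts
    muxList t.1 t.2 r

instance (n : ℕ) (ts : List (Wire × List Wire)) : Mono (selectOut n ts) := by
  induction ts with
  | nil => unfold selectOut; infer_instance
  | cons t ts ih => unfold selectOut; infer_instance

theorem good_selectOut {ts : List (Wire × List Wire)} (h : ∀ t ∈ ts, t.1 < A ∧ Bd A n t.2) :
    Good (selectOut n ts) A (ts.length * (3 * n) + n) fun B r => Bd B n r := by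
  induction ts with
  | nil => exact (good_constBits n 0).cost (by omega)
  | cons t ts ih =>
    obtain ⟨h1, h2⟩ := h t (by simp)
    exact ((ih fun t ht => h t (by simp [ht])).bind fun r B hB hr =>
      good_muxList (h1.trans_le hB) (h2.le hB) hr).cost
        (by rw [List.length_cons, Nat.succ_mul]; ring_nf; omega)

/-- The part of `dlogFormula` that follows the circuit with outputs `outs`. -/
def dlogBody (n q g : ℕ) (outs : List Wire) : Build Wire := do
  let y ← powMod n q g outs
  let e ← eqList y (List.range n)
  let i ← inGroup n q (List.range n)
  emit (fun x y => !x || y) i e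

instance (n q g : ℕ) (outs : List Wire) : Mono (dlogBody n q g outs) := by
  unfold dlogBody; infer_instance

/-- The netlist of `dlogFormula`. -/
def dlogNet (n q g : ℕ) (D : Circuit) : Netlist := ((dlogBody n q g D.outs).run ⟨n, D.gates⟩).2

/-- The output wire of `dlogFormula`. -/
def dlogOut (n q g : ℕ) (D : Circuit) : Wire := ((dlogBody n q g D.outs).run ⟨n, D.gates⟩).1

theorem dlogNet_le (n q g : ℕ) (D : Circuit) :
    Netlist.Le ⟨n, D.gates⟩ (dlogNet n q g D) := Mono.le _

theorem dlogFormula_eq (n q g : ℕ) (D : Circuit) : dlogFormula n q g D =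
    .imp (Formula.bigAnd (dlogNet n q g D).formulas) (.var (dlogOut n q g D)) := by
  have h := (dlogNet_le n q g D).1
  simp only at h
  unfold Netlist.formulas
  rw [← h]
  rfl

theorem dlogNet_runs (n q g : ℕ) (D : Circuit) :
    Runs (dlogNet n q g D) (dlogBody n q g D.outs) (dlogOut n q g D) := runs_self _ _

theorem range_bd {n B : ℕ} (h : n ≤ B) : Bd B n (List.range n) :=
  ⟨List.length_range, fun _ hx => (List.mem_range.1 hx).trans_le h⟩

/-- A bound on the number of gates of `dlogBody`. -/
def dlogCost (n : ℕ) : ℕ := n * (66 * n ^ 2 + 78 * n) + n + (2 * n + 1) + (8 * n + 13) + 1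

theorem Circuit.WF.dlogNet_width {D : Circuit} {n : ℕ} (hD : D.WF n n) (hn : 0 < n) (q g : ℕ) :
    (dlogNet n q g D).width ≤ n + D.size + dlogCost n ∧
      dlogOut n q g D < (dlogNet n q g D).width := by
  have h1 : Bd (n + D.size) n D.outs := ⟨hD.2.1, hD.2.2⟩
  have h2 : Bd (n + D.size) n (List.range n) := range_bd (by omega)
  have h3 : Good (dlogBody n q g D.outs) (n + D.size) (dlogCost n) fun B (p : ℕ) => p < B :=
    ((good_powMod q g h1).bind fun y B hB hy => (good_eqList hy (h2.le hB)).bind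
      fun e C hC he => (good_inGroup q ((h2.le hB).le hC)).bind fun i E hE hi =>
      good_emit hi (he.trans_le hE)).cost (by rw [dlogCost]; omega)
  obtain ⟨h4, -, h5⟩ := h3 ⟨n, D.gates⟩ le_rfl (by simp only [Netlist.width]; omega)
  exact ⟨h4, h5⟩

/-- If `D` computes discrete logarithms, then the formula that says so is a tautology. -/
theorem dlogFormula_tautology {n q g : ℕ} {D : Circuit} (hD : D.WF n n)
    (hqn : q ≤ 2 ^ n) (hg : IsGen q g)
    (h : ∀ z, 0 < z → z < q → g ^ ofBits (D.eval (bits n z)) % q = z) :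
    (dlogFormula n q g D).Tautology := by
  intro v
  rw [dlogFormula_eq]
  cases e : (Formula.bigAnd (dlogNet n q g D).formulas).eval v
  · simp [Formula.eval, e]
  simp only [Formula.eval, e, Bool.not_true, Bool.false_or]
  have hv : Cons v (dlogNet n q g D) := cons_iff.2 e
  refine Sem.bind (hv.powMod n q g hqn hg.lt.1 hg.lt.2 D.outs) (fun y hy =>
    (hv.eqList y (List.range n) (by simp [hy.1])).bind fun e he =>
    (hv.inGroup n q hqn (List.range n) (by simp)).bind fun i hi =>
    (hv.emit (fun x y => !x || y) i e).mono (Q' := fun p => v p = true) fun p hp => ?_) _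
    (dlogNet_runs n q g D)
  rw [hp, hi, he, hy.2]
  set z := val v (List.range n) with hz
  have hzb : (List.range n).map v = bits n z := map_eq_bits (by simp)
  have hw : Netlist.WF ⟨n, D.gates⟩ := by
    rintro p g ⟨i, hi, rfl⟩
    obtain ⟨h1, rfl⟩ := List.getElem?_eq_some_iff.1 hi
    exact hD.1 i h1
  have hv' : Cons v ⟨n, D.gates⟩ := fun p op a b hp => hv p op a b ((dlogNet_le n q g D).has hp)
  have hout : D.outs.map v = D.eval (bits n z) := by
    have h1 := hv'.map_range hw
    simp only [hzb] at h1
    unfold Circuit.eval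
    refine List.map_congr_left fun j hj => ?_
    rw [← h1]
    have hj : j < Netlist.width ⟨n, D.gates⟩ := hD.2.2 j hj
    simp [hj]
  by_cases hzq : 0 < z ∧ z < q
  · have := h z hzq.1 hzq.2
    rw [← hout] at this
    simp [val, this, hzq]
  · simp [hzq]

end

end SelfProv

namespace SelfProv

open List (Forall₂)
open Formula

/-! ### Derivations about netlists -/

theorem size_lit (p : ℕ) (b : Bool) : (lit (var p) b).size ≤ 2 := by cases b <;> simp [lit, size]

theorem size_gateFormula (p : ℕ) (g : Gate) : (gateFormula p g).size ≤ 55 := by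
  have h : (ofOp g.op (var g.left) (var g.right)).size ≤ 25 := by
    unfold ofOp
    cases h1 : g.op false false <;> cases h2 : g.op false true <;>
      cases h3 : g.op true false <;> cases h4 : g.op true true <;> simp [*, bigOr, lit, size]
  simp only [gateFormula, Formula.iff, size]
  omega

theorem size_bigAnd {l : List Formula} (h : ∀ A ∈ l, A.size ≤ 55) :
    (bigAnd l).size ≤ 56 * l.length + 1 := by
  induction l with
  | nil => simp [bigAnd, size]
  | cons A l ih =>
    have h1 := h A (by simp)
    have h2 := ih fun B hB => h B (by simp [hB])
    simp only [bigAnd, size, List.length_cons]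
    omega

theorem Netlist.length_formulas (G : Netlist) : G.formulas.length = G.gates.length := by
  simp [Netlist.formulas]

/-- The context "`H`, and all tests in `l` fail". -/
def failCtx (ρ : ℕ → ℕ) (H : Formula) : List Wire → Formula
  | [] => H
  | t :: l => .and (failCtx ρ H l) (lit (var (ρ t)) false)

/-- The context "`H`, and the head of `l` succeeds, but the other tests in `l` fail". -/
def hitCtx (ρ : ℕ → ℕ) (H : Formula) : List Wire → Formula
  | [] => H
  | t :: l => .and (failCtx ρ H l) (lit (var (ρ t)) true)

theorem size_failCtx (ρ : ℕ → ℕ) (H : Formula) (l : List Wire) :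
    (failCtx ρ H l).size = H.size + 3 * l.length := by
  induction l with
  | nil => rfl
  | cons t l ih =>
    simp only [failCtx, size, ih, List.length_cons]
    simp only [lit, size, Bool.false_eq_true, if_false]
    omega

theorem size_hitCtx (ρ : ℕ → ℕ) (H : Formula) (l : List Wire) :
    (hitCtx ρ H l).size ≤ H.size + 3 * l.length := by
  cases l with
  | nil => rfl
  | cons t l =>
    simp only [hitCtx, size, size_failCtx, List.length_cons, lit, if_true]
    omega

open Classical in
/-- The set `R` of derived formulas, in which the contexts range over `C` and the conclusions over
`V`, allows reasoning about the wires of `G`. -/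
structure Arena (G : Netlist) (s : ℕ) (C V : Finset Formula) (R : Formula → Prop) : Prop where
  logic : Logic (Finset.image₂ imp C V) s R
  sizeC : ∀ X ∈ C, X.size ≤ s
  sizeV : ∀ B ∈ V, B.size ≤ s
  sub : C ⊆ V
  lit : ∀ p < G.width, ∀ b, lit (var p) b ∈ V
  iff : ∀ p < G.width, ∀ p' < G.width, iff (var p) (var p') ∈ V
  gates : ∀ A ∈ G.formulas, A ∈ V

namespace Arena

variable {G G₁ : Netlist} {s : ℕ} {C V : Finset Formula} {R : Formula → Prop} {X : Formula}
  {ρ : ℕ → ℕ}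

/-- In the context `X`, the gates of `G` are known. -/
def Facts (G : Netlist) (R : Formula → Prop) (X : Formula) : Prop :=
  ∀ p g, G.Has p g → R (imp X (gateFormula p g))

/-- In the context `X`, the wires `a` and `b` of `G` are equivalent. -/
def Equiv (G : Netlist) (R : Formula → Prop) (X : Formula) (a b : Wire) : Prop :=
  a < G.width ∧ b < G.width ∧ R (imp X (.iff (var a) (var b)))

open Classical in
theorem mem (_ : Arena G s C V R) {B : Formula} (hX : X ∈ C) (hB : B ∈ V) :
    imp X B ∈ Finset.image₂ imp C V :=
  Finset.mem_image₂_of_mem hX hB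

theorem lift (h : Arena G s C V R) {L B : Formula} (hX : X ∈ C) (hY : .and X L ∈ C) (hB : B ∈ V)
    (hR : R (imp X B)) : R (imp (.and X L) B) := by
  have hs := h.sizeC _ hY
  refine h.logic.cut hs (h.sizeC _ hX) (h.sizeV _ hB) (h.mem hY hB) ?_ hR
  exact h.logic.andl hs (h.sizeC _ hX) (le_trans (by simp only [size]; omega) hs)
    (h.mem hY (h.sub hX)) (h.logic.refl hs (h.mem hY (h.sub hY)))

theorem lift_facts (h : Arena G s C V R) {L : Formula} (hX : X ∈ C) (hY : .and X L ∈ C)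
    (hR : Facts G R X) : Facts G R (.and X L) := fun p g hp =>
  h.lift hX hY (h.gates _ (mem_formulas.2 ⟨p, g, hp, rfl⟩)) (hR p g hp)

theorem lift_equiv (h : Arena G s C V R) {L : Formula} (hX : X ∈ C) (hY : .and X L ∈ C) {a b : ℕ}
    (hR : Equiv G R X a b) : Equiv G R (.and X L) a b :=
  ⟨hR.1, hR.2.1, h.lift hX hY (h.iff _ hR.1 _ hR.2.1) hR.2.2⟩

theorem assumption (h : Arena G s C V R) {L : Formula} (hX : X ∈ C) (hY : .and X L ∈ C)
    (hL : L ∈ V) : R (imp (.and X L) L) := by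
  have hs := h.sizeC _ hY
  exact h.logic.andr hs (h.sizeC _ hX) (h.sizeV _ hL) (h.mem hY hL)
    (h.logic.refl hs (h.mem hY (h.sub hY)))

theorem equiv_refl (h : Arena G s C V R) (hX : X ∈ C) {a : ℕ} (ha : a < G.width) :
    Equiv G R X a a :=
  ⟨ha, ha, h.logic.iffRefl (h.sizeC _ hX) (h.mem hX (h.iff _ ha _ ha))⟩

theorem equiv_trans (h : Arena G s C V R) (hX : X ∈ C) {a b c : ℕ} (hab : Equiv G R X a b)
    (hbc : Equiv G R X b c) : Equiv G R X a c :=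
  ⟨hab.1, hbc.2.1, h.logic.iffTrans (h.sizeC _ hX) (h.mem hX (h.iff _ hab.1 _ hbc.2.1))
    hab.2.2 hbc.2.2⟩

theorem transfer (h : Arena G s C V R) (hX : X ∈ C) {a b : ℕ} {β : Bool} (hab : Equiv G R X a b)
    (ha : R (imp X (.lit (var a) β))) : R (imp X (.lit (var b) β)) :=
  h.logic.transfer (h.sizeC _ hX) (h.mem hX (h.lit _ hab.2.1 _)) hab.2.2 ha

/-- If the gates of `G₁` occur in `G`, then knowing the values of wires of `G₁` propagates along
gates. -/
theorem closed_known (h : Arena G s C V R) (hX : X ∈ C) (hF : Facts G R X)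
    (hρ : ∀ p g, G₁.Has p g → G.Has (ρ p) ⟨g.op, ρ g.left, ρ g.right⟩) {v : ℕ → Bool}
    (hv : Cons v G₁) : Closed (fun p p' => R (imp X (.lit (var (ρ p)) (v p))) ∧
      R (imp X (.lit (var (ρ p')) (v p')))) G₁ G₁ := by
  rintro p p' op a b a' b' hp hp' (⟨c, rfl⟩ | ⟨⟨ha, ha'⟩, hb, hb'⟩)
  · rw [hv _ _ _ _ hp, hv _ _ _ _ hp']
    exact ⟨h.logic.const (h.sizeC _ hX) (h.mem hX (h.lit _ (hρ _ _ hp).lt _)) (hF _ _ (hρ _ _ hp)),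
      h.logic.const (h.sizeC _ hX) (h.mem hX (h.lit _ (hρ _ _ hp').lt _)) (hF _ _ (hρ _ _ hp'))⟩
  · rw [hv _ _ _ _ hp, hv _ _ _ _ hp']
    exact ⟨h.logic.gate (h.sizeC _ hX) (h.mem hX (h.lit _ (hρ _ _ hp).lt _)) (hF _ _ (hρ _ _ hp))
      ha hb, h.logic.gate (h.sizeC _ hX) (h.mem hX (h.lit _ (hρ _ _ hp').lt _))
        (hF _ _ (hρ _ _ hp')) ha' hb'⟩

/-- If the gates of `G₁` occur in `G`, then gates with equivalent inputs have equivalent outputs. -/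
theorem closed_equiv (h : Arena G s C V R) (hX : X ∈ C) (hF : Facts G R X)
    (hρ : ∀ p g, G₁.Has p g → G.Has (ρ p) ⟨g.op, ρ g.left, ρ g.right⟩) :
    Closed (fun p p' => Equiv G R X (ρ p) p') G₁ G := by
  rintro p p' op a b a' b' hp hp' (⟨c, rfl⟩ | ⟨ha, hb⟩)
  · exact ⟨(hρ _ _ hp).lt, hp'.lt, h.logic.constCong (h.sizeC _ hX)
      (h.mem hX (h.iff _ (hρ _ _ hp).lt _ hp'.lt)) (hF _ _ (hρ _ _ hp)) (hF _ _ hp')⟩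
  · exact ⟨(hρ _ _ hp).lt, hp'.lt, h.logic.cong (h.sizeC _ hX)
      (h.mem hX (h.iff _ (hρ _ _ hp).lt _ hp'.lt)) (hF _ _ (hρ _ _ hp)) (hF _ _ hp')
      ha.2.2 hb.2.2⟩

end Arena

/-- The wire `p` is the output of a multiplexer that selects `a` if `t` is true, and `b` otherwise. -/
def IsMux (G : Netlist) (t a b p : Wire) : Prop :=
  ∃ x y, G.Has x ⟨fun x y => x && y, t, a⟩ ∧ G.Has y ⟨fun x y => !x && y, t, b⟩ ∧
    G.Has p ⟨fun x y => x || y, x, y⟩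

theorem sem_muxList {G : Netlist} {t : ℕ} {a b : List ℕ} (h : a.length = b.length) :
    Sem G (muxList t a b) fun r =>
      Forall₂ (fun (u : ℕ × ℕ) p => IsMux G t u.1 u.2 p) (a.zip b) r := by
  induction a generalizing b with
  | nil => unfold muxList; exact .pure .nil
  | cons x a ih =>
    cases b with
    | nil => simp at h
    | cons y b =>
      refine Sem.bind (Q := fun p => IsMux G t x y p) (fun p hp => ?_) fun p hp =>
        (ih (by simpa using h)).bind fun r hr => .pure (.cons hp hr)
      obtain ⟨u, hu, hp⟩ := hp.bind
      obtain ⟨w, hw, hp⟩ := hp.bind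
      exact ⟨u, w, hu.emit, hw.emit, hp.emit⟩

theorem sem_constList {G : Netlist} (l : List Bool) :
    Sem G (constList l) fun r => r.length = l.length ∧ ∀ w ∈ r, w < G.width := by
  induction l with
  | nil => exact .pure ⟨rfl, by simp⟩
  | cons b l ih =>
    refine Sem.bind (Q := fun p : ℕ => p < G.width) (fun p hp => hp.emit.lt) fun p hp =>
      ih.bind fun r hr => .pure ⟨by simp [hr.1], by simpa [hp] using hr.2⟩

theorem sem_selectOut {G : Netlist} {n : ℕ} {ts : List (Wire × List Wire)}
    (h : ∀ t ∈ ts, t.2.length = n) : Sem G (selectOut n ts) (Bd G.width n) := by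
  induction ts with
  | nil => exact (sem_constList (bits n 0)).mono fun r hr => ⟨by simpa using hr.1, hr.2⟩
  | cons t ts ih =>
    have ht := h t (by simp)
    refine (ih fun t ht => h t (by simp [ht])).bind fun r hr =>
      (sem_muxList (ht.trans hr.1.symm)).mono fun r' hr' => ⟨?_, fun w hw => ?_⟩
    · rw [← hr'.length_eq, List.length_zip, ht, hr.1, min_self]
    · obtain ⟨i, hi, rfl⟩ := List.mem_iff_getElem.1 hw
      obtain ⟨x, y, -, -, hp⟩ := hr'.get (hr'.length_eq ▸ hi) hi
      exact hp.lt

theorem forall₂_comp {α β γ : Type} {P : α → β → Prop} {Q : β → γ → Prop} {S : α → γ → Prop}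
    (h : ∀ a b c, P a b → Q b c → S a c) {l : List α} {l' : List β} {l'' : List γ}
    (h1 : Forall₂ P l l') (h2 : Forall₂ Q l' l'') : Forall₂ S l l'' := by
  induction h1 generalizing l'' with
  | nil => cases h2; exact .nil
  | cons ha _ ih => cases h2 with | cons hb h2 => exact .cons (h _ _ _ ha hb) (ih h2)

namespace Arena

variable {G : Netlist} {s : ℕ} {C V : Finset Formula} {R : Formula → Prop} {X : Formula}
  {ρ : ℕ → ℕ}

theorem muxList (h : Arena G s C V R) (hX : X ∈ C) (hF : Facts G R X) {t : ℕ} {a b r : List ℕ}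
    (hab : a.length = b.length) (ha : ∀ w ∈ a, w < G.width) (hb : ∀ w ∈ b, w < G.width)
    (hr : Runs G (muxList t a b) r) {β : Bool} (ht : R (imp X (.lit (var t) β))) :
    Forall₂ (Equiv G R X) (if β then a else b) r := by
  have key : Forall₂ (fun (u : ℕ × ℕ) p => Equiv G R X (if β then u.1 else u.2) p) (a.zip b) r := by
    refine (List.forall₂_and_left _ _ |>.2
      ⟨fun u hu => List.of_mem_zip hu, sem_muxList hab r hr⟩).imp ?_
    rintro u p ⟨hu, x, y, hx, hy, hp⟩
    have h1 : (if β then u.1 else u.2) < G.width := by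
      cases β
      · exact hb _ hu.2
      · exact ha _ hu.1
    refine ⟨h1, hp.lt, ?_⟩
    exact h.logic.mux (h.sizeC _ hX) (h.mem hX (h.iff _ h1 _ hp.lt)) (hF _ _ hx) (hF _ _ hy)
      (hF _ _ hp) ht
  have e : (a.zip b).map (fun u => if β then u.1 else u.2) = if β then a else b := by
    cases β
    · simpa using List.map_snd_zip hab.ge
    · simpa using List.map_fst_zip hab.le
  rw [← e]
  exact List.forall₂_map_left_iff.2 key

/-- Case distinction on the first successful test: to derive `B`, it suffices to do so if all tests
fail, and if a test `t` succeeds and the wires `outs` are equivalent to the candidate `f t`. The tests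
in `l` have been considered, the tests in `ts` remain, and `outs` is what is selected from them. -/
theorem first_hit (h : Arena G s C V R) {n : ℕ} {tests : List Wire} {f : Wire → List Wire}
    {H B : Formula} (hB : B ∈ V) {outs : List Wire} (ht : ∀ t ∈ tests, ρ t < G.width)
    (hf : ∀ t ∈ tests, Bd G.width n ((f t).map ρ))
    (hC : ∀ l, l <:+ tests.reverse → failCtx ρ H l ∈ C ∧ hitCtx ρ H l ∈ C)
    (hfail : Facts G R (failCtx ρ H tests.reverse) →
      (∀ t ∈ tests, R (imp (failCtx ρ H tests.reverse) (.lit (var (ρ t)) false))) →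
      R (imp (failCtx ρ H tests.reverse) B))
    (hhit : ∀ X ∈ C, Facts G R X → ∀ t ∈ tests, R (imp X (.lit (var (ρ t)) true)) →
      Forall₂ (Equiv G R X) ((f t).map ρ) outs → R (imp X B))
    {l ts : List Wire} (hl : tests.reverse = ts.reverse ++ l) {r : List Wire}
    (hr : Runs G (selectOut n (ts.map fun t => (ρ t, (f t).map ρ))) r)
    (hF : Facts G R (failCtx ρ H l)) (hro : Forall₂ (Equiv G R (failCtx ρ H l)) r outs)
    (hlf : ∀ t ∈ l, R (imp (failCtx ρ H l) (.lit (var (ρ t)) false))) :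
    R (imp (failCtx ρ H l) B) := by
  induction ts generalizing l r with
  | nil =>
    simp only [List.reverse_nil, List.nil_append] at hl
    subst hl
    exact hfail hF fun t ht => hlf t (by simpa using ht)
  | cons t ts ih =>
    have htm : t ∈ tests := by rw [← List.mem_reverse, hl]; simp
    have hsub : ∀ u ∈ ts, u ∈ tests := fun u hu => by rw [← List.mem_reverse, hl]; simp [hu]
    have hl' : tests.reverse = ts.reverse ++ t :: l := by simpa using hl
    obtain ⟨r', hr', hr⟩ := hr.bind
    have hX := (hC l ⟨_, hl.symm⟩).1
    obtain ⟨hY0, hY1⟩ := hC (t :: l) ⟨_, hl'.symm⟩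
    simp only [failCtx, hitCtx] at hY0 hY1
    have hbd : Bd G.width n r' := sem_selectOut (fun u hu => by
      obtain ⟨w, hw, rfl⟩ := List.mem_map.1 hu
      exact (hf w (hsub w hw)).1) r' hr'
    have hft := hf t htm
    have step : ∀ β, .and (failCtx ρ H l) (.lit (var (ρ t)) β) ∈ C →
        Forall₂ (Equiv G R (.and (failCtx ρ H l) (.lit (var (ρ t)) β)))
          (if β then (f t).map ρ else r') outs := fun β hY =>
      forall₂_comp (P := Equiv G R _) (Q := Equiv G R _) (S := Equiv G R _)
        (fun _ _ _ h1 h2 => h.equiv_trans hY h1 h2)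
        (h.muxList hY (h.lift_facts hX hY hF) (hft.1.trans hbd.1.symm) hft.2 hbd.2 hr
          (h.assumption hX hY (h.lit _ (ht t htm) _)))
        (hro.imp fun _ _ h1 => h.lift_equiv hX hY h1)
    refine h.logic.cases (A := var (ρ t)) (h.sizeC _ hX) h.logic.pos (h.sizeV _ hB) (h.mem hX hB)
      ?_ ?_
    · exact hhit _ hY1 (h.lift_facts hX hY1 hF) t htm
        (h.assumption hX hY1 (h.lit _ (ht t htm) _)) (step true hY1)
    · refine ih hl' hr' (h.lift_facts hX hY0 hF) (step false hY0) fun u hu => ?_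
      rcases List.mem_cons.1 hu with rfl | hu
      · exact h.assumption hX hY0 (h.lit _ (ht _ htm) _)
      · refine h.lift hX hY0 (h.lit _ (ht u ?_) _) (hlf u hu)
        rw [← List.mem_reverse, hl]
        simp [hu]

theorem of_bigAnd (h : Arena G s C V R) (hX : X ∈ C) {L : List Formula}
    (hL : ∀ l, l <:+ L → bigAnd l ∈ V) (hLV : ∀ A ∈ L, A ∈ V) (hR : R (imp X (bigAnd L))) :
    ∀ A ∈ L, R (imp X A) := by
  induction L with
  | nil => simp
  | cons A L ih =>
    have hA := hLV A (by simp)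
    have hL' : bigAnd L ∈ V := hL L (List.suffix_cons A L)
    intro B hB
    rcases List.mem_cons.1 hB with rfl | hB
    · exact h.logic.andl (h.sizeC _ hX) (h.sizeV _ hA) (h.sizeV _ hL') (h.mem hX hA) hR
    · refine ih (fun l hl => hL l (hl.trans (List.suffix_cons A L)))
        (fun A hA => hLV A (by simp [hA])) ?_ B hB
      exact h.logic.andr (h.sizeC _ hX) (h.sizeV _ hA) (h.sizeV _ hL') (h.mem hX hL') hR

theorem to_bigAnd (h : Arena G s C V R) (hX : X ∈ C) {L : List Formula}
    (hL : ∀ l, l <:+ L → bigAnd l ∈ V) (hLV : ∀ A ∈ L, A ∈ V) (hR : ∀ A ∈ L, R (imp X A)) :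
    R (imp X (bigAnd L)) := by
  induction L with
  | nil => exact h.logic.top (h.sizeC _ hX) (h.mem hX (hL [] List.suffix_rfl))
  | cons A L ih =>
    have hA := hLV A (by simp)
    have hL' : bigAnd L ∈ V := hL L (List.suffix_cons A L)
    exact h.logic.andi (h.sizeC _ hX) (h.sizeV _ hA) (h.sizeV _ hL')
      (h.mem hX (hL _ List.suffix_rfl)) (hR A (by simp))
      (ih (fun l hl => hL l (hl.trans (List.suffix_cons A L)))
        (fun A hA => hLV A (by simp [hA])) fun B hB => hR B (by simp [hB]))

end Arena

/-- A bound on the cost of the derivation, for a formula with `W` wires and `T` tests. -/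
def drvCost (K W T : ℕ) : ℕ :=
  ((2 * T + 2) * (W * W + 5 * W + 2 * T + 4)) * (K * (56 * W + 3 * T + 2))

open Classical in
/-- The formulas that the derivation needs: the contexts of the case distinction, on the one hand, and
conjunctions of gates, literals and equivalences of wires, on the other. There are polynomially many
implications from the former to the latter, so everything that is derivable within the arena has a
short derivation. -/
theorem exists_arena {F : FregeSystem} {K : ℕ} (hK : ∀ s ≥ 1, ∀ (Γ : Set Formula)
    (U : Finset Formula), Logic U s (Reach F (K * s) Γ U)) (Γ : Set Formula) (G : Netlist)
    (ρ : ℕ → ℕ) (tests : List Wire) (L : List Formula) (hL : ∀ A ∈ L, A ∈ G.formulas)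
    (hlen : L.length ≤ G.gates.length) :
    ∃ (C V : Finset Formula) (s : ℕ) (R : Formula → Prop), Arena G s C V R ∧
      (∀ A ∈ Γ, R A) ∧ (∀ A, R A → Drv F (drvCost K G.width tests.length) Γ A) ∧
      (∀ l, l <:+ G.formulas → bigAnd l ∈ V) ∧ (∀ l, l <:+ L → bigAnd l ∈ V) ∧
      ∀ l, l <:+ tests.reverse → failCtx ρ (bigAnd G.formulas) l ∈ C ∧
        hitCtx ρ (bigAnd G.formulas) l ∈ C := by
  set H := bigAnd G.formulas with hH
  set W := G.width with hW
  set T := tests.length with hT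
  have hgW : G.gates.length ≤ W := Nat.le_add_left _ _
  let C : Finset Formula := (tests.reverse.tails.map (failCtx ρ H)).toFinset ∪
    (tests.reverse.tails.map (hitCtx ρ H)).toFinset
  let V : Finset Formula := (((((G.formulas.tails.map bigAnd).toFinset ∪ G.formulas.toFinset) ∪
    (L.tails.map bigAnd).toFinset) ∪
    (Finset.range W ×ˢ Finset.univ).image fun u => lit (var u.1) u.2) ∪
    (Finset.range W ×ˢ Finset.range W).image fun u => iff (var u.1) (var u.2)) ∪ C
  have hmemC : ∀ X, X ∈ C ↔ ∃ l, l <:+ tests.reverse ∧ (failCtx ρ H l = X ∨ hitCtx ρ H l = X) := by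
    intro X
    simp only [C, Finset.mem_union, List.mem_toFinset, List.mem_map, List.mem_tails]
    grind
  have hmemV : ∀ B, B ∈ V ↔ ((((((∃ l, l <:+ G.formulas ∧ bigAnd l = B) ∨ B ∈ G.formulas) ∨
      (∃ l, l <:+ L ∧ bigAnd l = B)) ∨ (∃ p < W, ∃ b, lit (var p) b = B)) ∨
      (∃ p < W, ∃ p' < W, iff (var p) (var p') = B)) ∨ B ∈ C) := by
    intro B
    simp only [V, Finset.mem_union, List.mem_toFinset, List.mem_map, List.mem_tails,
      Finset.mem_image, Finset.mem_product, Finset.mem_range, Finset.mem_univ, and_true,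
      Prod.exists, and_assoc, exists_and_left]
  set s := 56 * W + 3 * T + 2 with hs
  have hsg : ∀ A ∈ G.formulas, A.size ≤ 55 := by
    intro A hA
    obtain ⟨p, g, -, rfl⟩ := mem_formulas.1 hA
    exact size_gateFormula p g
  have hsH : H.size ≤ 56 * W + 1 := by
    have := size_bigAnd hsg
    rw [G.length_formulas, ← hH] at this
    omega
  have hsC : ∀ X ∈ C, X.size ≤ s := by
    intro X hX
    obtain ⟨l, hl, h⟩ := (hmemC X).1 hX
    have hl := hl.length_le
    rw [List.length_reverse] at hl
    rcases h with rfl | rfl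
    · rw [size_failCtx]; omega
    · have := size_hitCtx ρ H l; omega
  have hsV : ∀ B ∈ V, B.size ≤ s := by
    intro B hB
    rcases (hmemV B).1 hB with ((((⟨l, hl, rfl⟩ | h) | ⟨l, hl, rfl⟩) | ⟨p, hp, b, rfl⟩) |
      ⟨p, hp, p', hp', rfl⟩) | h
    · have h1 := size_bigAnd fun A hA => hsg A (hl.subset hA)
      have h2 := hl.length_le
      rw [G.length_formulas] at h2
      omega
    · have h1 := hsg B h
      have h2 : 0 < G.formulas.length := List.length_pos_of_mem h
      rw [G.length_formulas] at h2
      omega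
    · have h1 := size_bigAnd fun A hA => hsg A (hL A (hl.subset hA))
      have h2 := hl.length_le
      omega
    · have := size_lit p b; omega
    · simp only [Formula.iff, size]; omega
    · exact hsC B h
  have hcC : C.card ≤ 2 * T + 2 := by
    refine (Finset.card_union_le _ _).trans ?_
    have h1 := (tests.reverse.tails.map (failCtx ρ H)).toFinset_card_le
    have h2 := (tests.reverse.tails.map (hitCtx ρ H)).toFinset_card_le
    simp only [List.length_map, List.length_tails, List.length_reverse] at h1 h2
    omega
  have hcV : V.card ≤ W * W + 5 * W + 2 * T + 4 := by
    have h1 := (G.formulas.tails.map bigAnd).toFinset_card_le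
    have h2 := G.formulas.toFinset_card_le
    have h3 := (L.tails.map bigAnd).toFinset_card_le
    have h4 : ((Finset.range W ×ˢ (Finset.univ : Finset Bool)).image
      fun u => lit (var u.1) u.2).card ≤ W * 2 := Finset.card_image_le.trans (by simp)
    have h5 : ((Finset.range W ×ˢ Finset.range W).image
      fun u => iff (var u.1) (var u.2)).card ≤ W * W := Finset.card_image_le.trans (by simp)
    simp only [List.length_map, List.length_tails, G.length_formulas] at h1 h2 h3
    refine (Finset.card_union_le _ _).trans (le_trans (Nat.add_le_add_right
      ((Finset.card_union_le _ _).trans (Nat.add_le_add ((Finset.card_union_le _ _).trans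
      (Nat.add_le_add ((Finset.card_union_le _ _).trans (Nat.add_le_add
      ((Finset.card_union_le _ _).trans (Nat.add_le_add h1 h2)) h3)) h4)) h5)) _) ?_)
    omega
  refine ⟨C, V, s, Reach F (K * s) Γ (Finset.image₂ imp C V),
    ⟨hK s (by omega) _ _, hsC, hsV, Finset.subset_union_right, ?_, ?_, ?_⟩,
    fun A hA => .base hA, fun A hA => ?_, ?_, ?_, ?_⟩
  · exact fun p hp b => (hmemV _).2 (.inl (.inl (.inr ⟨p, hp, b, rfl⟩)))
  · exact fun p hp p' hp' => (hmemV _).2 (.inl (.inr ⟨p, hp, p', hp', rfl⟩))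
  · exact fun A hA => (hmemV _).2 (.inl (.inl (.inl (.inl (.inr hA)))))
  · obtain ⟨L, h1, h2, h3⟩ := hA.drv
    refine ⟨L, h1, h2, h3.trans (Nat.mul_le_mul_right _ ?_)⟩
    exact (Finset.card_image₂_le _ _ _).trans (Nat.mul_le_mul hcC hcV)
  · exact fun l hl => (hmemV _).2 (.inl (.inl (.inl (.inl (.inl ⟨l, hl, rfl⟩)))))
  · exact fun l hl => (hmemV _).2 (.inl (.inl (.inl (.inr ⟨l, hl, rfl⟩))))
  · exact fun l hl => ⟨(hmemC _).2 ⟨l, hl, .inl rfl⟩, (hmemC _).2 ⟨l, hl, .inr rfl⟩⟩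

/-! ### Most seeds pass the test of a correct circuit -/

section
variable {n q g s : ℕ}

theorem computes_not_dlogTest (hn : 0 < n) (hqn : q ≤ 2 ^ n) (hg : IsGen q g) (δ : List Bool)
    (hδ : δ.length = descLen n s n) :
    Computes n (testCost n s) (fun x => !dlogHolds q g (decodeCircuit n s n δ) x) fun l => (do
      let d ← constList δ
      dlogTest n q g s d l) >>= bnot := by
  refine Computes.not (t := descLen n s n + (evalCost n s n + 66 * n ^ 3 + 78 * n ^ 2 + 11 * n +
    15)) ?_ |>.cost (by rw [testCost]; ring_nf; omega)
  exact {
    mono := fun l => inferInstance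
    good := fun A l hl => ((good_constList δ).bind fun d B hB hd =>
      good_dlogTest q g s (hδ ▸ hd) (hl.le hB) hn).cost (by rw [hδ])
    sem := fun v G l hv hl => (hv.constList δ).bind fun d hd =>
      (hv.dlogTest hn hqn hg.lt.1 hg.lt.2 d l (by simpa [hδ] using congrArg List.length hd)
        hl).mono fun p hp => by rw [hp, hd] }

/-- The group has `q - 1 ≥ 2 ^ (n - 1)` members. -/
theorem uniformCount_dlogHolds (hqn : q ≤ 2 ^ n) (hqn' : 2 ^ (n - 1) < q) {C : Circuit}
    (hC : ∀ z, 0 < z → z < q → g ^ ofBits (C.eval (bits n z)) % q = z) :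
    2 ^ (n - 1) ≤ uniformCount n (dlogHolds q g C) := by
  have e : uniformCount n (dlogHolds q g C) =
      ((Finset.range (2 ^ n)).filter fun z => dlogHolds q g C (bits n z) = true).card := by
    rw [uniformCount, List.countP_eq_length_filter]
    have e : ∀ z ∈ List.range (2 ^ n), dlogHolds q g C (bits n z) =
      decide (dlogHolds q g C (bits n z) = true) := by simp
    rw [List.filter_congr e]
    rfl
  rw [e]
  have h : Finset.Ico 1 q ⊆
      (Finset.range (2 ^ n)).filter fun z => dlogHolds q g C (bits n z) = true := by
    intro z hz
    rw [Finset.mem_Ico] at hz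
    have hz' : z < 2 ^ n := hz.2.trans_le hqn
    simp only [Finset.mem_filter, Finset.mem_range, dlogHolds, ofBits_bits, Nat.mod_eq_of_lt hz',
      hC z hz.1 hz.2, Bool.and_eq_true, decide_eq_true_eq, and_true]
    exact ⟨hz', hz⟩
  have := Finset.card_le_card h
  rw [Nat.card_Ico] at this
  omega

/-- A correct circuit passes the test on at least a quarter of the strings in `xs`: it does so on half
of all `n`-bit strings, and `1 / n ≤ 1 / 4`. This is the premise of the self-reducibility formula for
`P = 2 ^ (n - 2)`. -/
theorem Fools.quarter (hn : 4 ≤ n) (hqn : q ≤ 2 ^ n) (hqn' : 2 ^ (n - 1) < q)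
    (hg : IsGen q g) {xs : List (List Bool)} (hxs : Fools n (testCost n s) xs) (δ : List Bool)
    (hδ : δ.length = descLen n s n)
    (hC : ∀ z, 0 < z → z < q → g ^ ofBits ((decodeCircuit n s n δ).eval (bits n z)) % q = z) :
    2 ^ (n - 2) * xs.length ≤ 2 ^ n * xs.countP (dlogHolds q g (decodeCircuit n s n δ)) := by
  have h1 := hxs.2 _ _ (computes_not_dlogTest (by omega) hqn hg δ hδ)
  have h2 := countP_not_add (dlogHolds q g (decodeCircuit n s n δ)) xs
  have h3 : uniformCount n (fun r => !dlogHolds q g (decodeCircuit n s n δ) r) +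
      uniformCount n (dlogHolds q g (decodeCircuit n s n δ)) = 2 ^ n := by
    have := countP_not_add (fun z => dlogHolds q g (decodeCircuit n s n δ) (bits n z))
      (List.range (2 ^ n))
    rw [List.length_range] at this
    exact this
  have h4 := uniformCount_dlogHolds hqn hqn' hC
  obtain ⟨m, rfl⟩ := Nat.exists_eq_add_of_le' (show 2 ≤ n by omega)
  rw [show m + 2 - 2 = m by omega]
  rw [show m + 2 - 1 = m + 1 by omega] at h4
  set A := xs.countP (dlogHolds q g (decodeCircuit (m + 2) s (m + 2) δ))
  set A' := xs.countP fun x => !dlogHolds q g (decodeCircuit (m + 2) s (m + 2) δ) x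
  set U := uniformCount (m + 2) (dlogHolds q g (decodeCircuit (m + 2) s (m + 2) δ))
  set U' := uniformCount (m + 2) fun r => !dlogHolds q g (decodeCircuit (m + 2) s (m + 2) δ) r
  set L := xs.length
  have h5 : 2 ^ (m + 2) = 4 * 2 ^ m := by ring
  have h6 : 2 ^ (m + 1) = 2 * 2 ^ m := by ring
  rw [h5] at h1 h3 ⊢
  rw [h6] at h4
  set p := 2 ^ m
  have h7 : U' ≤ 2 * p := by omega
  have h8 : (m + 2) * L * U' ≤ (m + 2) * L * (2 * p) := Nat.mul_le_mul_left _ h7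
  have h9 : (m + 2) * (4 * p) * A' + (m + 2) * (4 * p) * A = (m + 2) * (4 * p) * L := by
    rw [← mul_add, h2]
  have h10 : (m + 2) * (p * L) ≤ (m + 2) * (4 * p * A) := by
    have h11 : 2 * (p * L) ≤ m * (p * L) := Nat.mul_le_mul_right _ (by omega)
    nlinarith
  exact Nat.le_of_mul_le_mul_left h10 (by omega)

/-! ### The circuit contains the self-reducibility formula -/

/-- The netlist of the self-reducibility formula. -/
def selfNet (n q g s : ℕ) (xs : List (List Bool)) : Netlist :=
  ((selfBody n q g s xs (List.range n) ((List.range n).map (n + ·))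
    ((List.range (descLen n s n)).map (2 * n + ·))).run ⟨2 * n + descLen n s n, []⟩).2

/-- The output wire of the self-reducibility formula. -/
def selfOut (n q g s : ℕ) (xs : List (List Bool)) : Wire :=
  ((selfBody n q g s xs (List.range n) ((List.range n).map (n + ·))
    ((List.range (descLen n s n)).map (2 * n + ·))).run ⟨2 * n + descLen n s n, []⟩).1

/-- The wires of the self-reducibility formula as wires of a circuit with `n` inputs `b`, followed by
the constants `0` and `1`, by which the number `P` and the description `δ` are given, and by a copy of
the gates. -/
def rename (n s P : ℕ) (δ : List Bool) (w : ℕ) : ℕ :=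
  if w < n then n + (P.testBit w).toNat
  else if w < 2 * n then w - n
  else if w < 2 * n + descLen n s n then n + (δ.getD (w - 2 * n) false).toNat
  else w - (2 * n + descLen n s n) + (n + 2)

/-- Two constants and a copy of the gates of `G`, with their inputs renamed. -/
def baseNet (n : ℕ) (ρ : ℕ → ℕ) (G : Netlist) : Netlist :=
  ⟨n, ⟨fun _ _ => false, 0, 0⟩ :: ⟨fun _ _ => true, 0, 0⟩ ::
    G.gates.map fun g => ⟨g.op, ρ g.left, ρ g.right⟩⟩

variable {P : ℕ} {δ : List Bool} {G : Netlist}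

theorem baseNet_const (n : ℕ) (ρ : ℕ → ℕ) (G : Netlist) (β : Bool) :
    (baseNet n ρ G).Has (n + β.toNat) ⟨fun _ _ => β, 0, 0⟩ := by
  cases β
  · exact ⟨0, rfl, rfl⟩
  · exact ⟨1, rfl, rfl⟩

theorem baseNet_has (hG : G.inputs = 2 * n + descLen n s n) {p : ℕ} {g : Gate} (h : G.Has p g) :
    (baseNet n (rename n s P δ) G).Has (rename n s P δ p)
      ⟨g.op, rename n s P δ g.left, rename n s P δ g.right⟩ := by
  obtain ⟨i, hi, rfl⟩ := h
  refine ⟨i + 2, by simp [baseNet, hi], ?_⟩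
  rw [hG, rename, if_neg (by omega), if_neg (by omega), if_neg (by omega)]
  simp only [baseNet]
  omega

theorem rename_lt {w k : ℕ} (hw : w < 2 * n + descLen n s n + k) :
    rename n s P δ w < n + (2 + k) := by
  have hb : ∀ b : Bool, b.toNat ≤ 1 := Bool.toNat_le
  unfold rename
  split_ifs
  · have := hb (P.testBit w); omega
  · omega
  · have := hb (δ.getD (w - 2 * n) false); omega
  · omega

theorem baseNet_width (ρ : ℕ → ℕ) : (baseNet n ρ G).width = n + (2 + G.gates.length) := by
  simp only [baseNet, Netlist.width, List.length_cons, List.length_map]; omega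

theorem baseNet_wf (hn : 0 < n) (hG : G.inputs = 2 * n + descLen n s n) (hw : G.WF) :
    (baseNet n (rename n s P δ) G).WF := by
  rintro p g ⟨i, hi, rfl⟩
  match i with
  | 0 => cases hi; exact ⟨hn, hn⟩
  | 1 => cases hi; exact ⟨Nat.lt_add_right _ hn, Nat.lt_add_right _ hn⟩
  | i + 2 =>
    simp only [baseNet, List.getElem?_cons_succ, List.getElem?_map, Option.map_eq_some_iff] at hi
    obtain ⟨g', hg', rfl⟩ := hi
    obtain ⟨h1, h2⟩ := hw (G.inputs + i) g' ⟨i, hg', rfl⟩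
    rw [hG] at h1 h2
    have h3 := rename_lt (n := n) (s := s) (P := P) (δ := δ) h1
    have h4 := rename_lt (n := n) (s := s) (P := P) (δ := δ) h2
    simp only [baseNet]
    omega

theorem selfFormula_subst (n q g s : ℕ) (xs : List (List Bool)) (σ : ℕ → Formula) :
    (selfFormula n q g s xs).subst σ =
      imp (bigAnd ((selfNet n q g s xs).formulas.map (Formula.subst σ)))
        (σ (selfOut n q g s xs)) := by
  rw [selfFormula_eq, toFormula_eq, Formula.subst, subst_bigAnd]
  rfl

theorem selfNet_spec (q g : ℕ) {xs : List (List Bool)} (hxs : ∀ x ∈ xs, x.length = n)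
    (hn : 0 < n) : (selfNet n q g s xs).inputs = 2 * n + descLen n s n ∧
      (selfNet n q g s xs).WF ∧ (selfNet n q g s xs).gates.length ≤ selfCost n s xs.length ∧
      selfOut n q g s xs < (selfNet n q g s xs).width := by
  have h1 : Bd (2 * n + descLen n s n) n (List.range n) := range_bd (by omega)
  have h2 : Bd (2 * n + descLen n s n) n ((List.range n).map (n + ·)) := by
    refine ⟨by simp, fun w hw => ?_⟩
    obtain ⟨i, hi, rfl⟩ := List.mem_map.1 hw
    rw [List.mem_range] at hi
    omega
  have h3 : Bd (2 * n + descLen n s n) (descLen n s n)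
      ((List.range (descLen n s n)).map (2 * n + ·)) := by
    refine ⟨by simp, fun w hw => ?_⟩
    obtain ⟨i, hi, rfl⟩ := List.mem_map.1 hw
    rw [List.mem_range] at hi
    omega
  obtain ⟨h4, h5, h6⟩ := good_selfBody q g s hxs hn h1 h2 h3 ⟨2 * n + descLen n s n, []⟩
    (by simp [Netlist.width]) (by simp only [Netlist.width]; omega)
  have h7 : (selfNet n q g s xs).inputs = 2 * n + descLen n s n := by
    unfold selfNet
    exact (Mono.le (m := selfBody n q g s xs (List.range n) ((List.range n).map (n + ·))
      ((List.range (descLen n s n)).map (2 * n + ·))) ⟨2 * n + descLen n s n, []⟩).1.symm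
  refine ⟨h7, h5 (Netlist.wf_nil _), ?_, h6⟩
  change (selfNet n q g s xs).width ≤ _ at h4
  simp only [Netlist.width, h7, List.length_nil] at h4
  omega

/-- The valuation of the self-reducibility formula for the given number `P`, the given description
`δ`, and `b = 0`. -/
theorem exists_valuation (q g : ℕ) {xs : List (List Bool)} (hxs : ∀ x ∈ xs, x.length = n)
    (hn : 0 < n) (P : ℕ) {δ : List Bool} (hδ : δ.length = descLen n s n) :
    ∃ v, Cons v (selfNet n q g s xs) ∧ (∀ i < n, v i = P.testBit i) ∧
      (∀ i < n, v (n + i) = false) ∧ ∀ i < descLen n s n, v (2 * n + i) = δ.getD i false := by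
  obtain ⟨h1, h2, -, -⟩ := selfNet_spec (s := s) q g hxs hn
  set x := bits n P ++ (List.replicate n false ++ δ) with hx
  have hl : x.length = 2 * n + descLen n s n := by simp [hx, hδ]; omega
  refine ⟨_, h2.cons_runGates (x := x) (by rw [hl, h1]), fun i hi => ?_, fun i hi => ?_,
    fun i hi => ?_⟩
  · rw [runGates_getD _ _ (by omega), hx, List.getD_append _ _ _ _ (by simpa using hi), bits]
    simp [hi]
  · rw [runGates_getD _ _ (by omega), hx, List.getD_append_right _ _ _ _ (by simp),
      List.getD_append _ _ _ _ (by simpa using hi)]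
    simp [hi]
  · rw [runGates_getD _ _ (by omega), hx, List.getD_append_right _ _ _ _ (by simp; omega),
      List.getD_append_right _ _ _ _ (by simp; omega)]
    simp only [length_bits, List.length_replicate]
    congr 1
    omega

end

/-! ### The derivation -/

/-- The outputs of a builder, run on the base netlist, are candidates for the discrete logarithm. -/
def dlogCircuit (B : Netlist) (n : ℕ) (ts : List (Wire × List Wire)) : Circuit :=
  ⟨((selectOut n ts).run B).2.gates, ((selectOut n ts).run B).1⟩

theorem dlogCircuit_spec {B : Netlist} {n : ℕ} {ts : List (Wire × List Wire)} (hB : B.WF)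
    (hBn : B.inputs = n) (hn : 0 < n) (h : ∀ t ∈ ts, t.1 < B.width ∧ Bd B.width n t.2) :
    (dlogCircuit B n ts).WF n n ∧
      (dlogCircuit B n ts).size ≤ B.gates.length + (ts.length * (3 * n) + n) ∧
      B.Le ⟨n, (dlogCircuit B n ts).gates⟩ ∧
      Runs ⟨n, (dlogCircuit B n ts).gates⟩ (selectOut n ts) (dlogCircuit B n ts).outs := by
  obtain ⟨h1, h2, h3⟩ := good_selectOut h B le_rfl (by simp only [Netlist.width]; omega)
  have h4 : ((selectOut n ts).run B).2.inputs = n := by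
    exact (Mono.le (m := selectOut n ts) B).1.symm.trans hBn
  have h5 : (⟨n, (dlogCircuit B n ts).gates⟩ : Netlist) = ((selectOut n ts).run B).2 := by
    have h6 : ∀ N : Netlist, N.inputs = n → (⟨n, N.gates⟩ : Netlist) = N := by
      rintro ⟨_, _⟩ rfl; rfl
    exact h6 _ h4
  rw [← h5] at h1 h2 h3
  refine ⟨⟨fun i hi => (h2 hB).gates i hi, h3.1, h3.2⟩, ?_, ?_, ?_⟩
  · simp only [Netlist.width, hBn, Circuit.size] at h1 ⊢
    omega
  · rw [h5]; exact Mono.le B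
  · rw [h5]; exact runs_self _ _

theorem Arena.lift_failCtx {G : Netlist} {s : ℕ} {C V : Finset Formula} {R : Formula → Prop}
    {ρ : ℕ → ℕ} {H B : Formula} (h : Arena G s C V R) (hB : B ∈ V) {l : List Wire}
    (hC : ∀ k, k <:+ l → failCtx ρ H k ∈ C) (hR : R (imp H B)) :
    R (imp (failCtx ρ H l) B) := by
  induction l with
  | nil => exact hR
  | cons t l ih =>
    exact h.lift (hC l (List.suffix_cons t l)) (hC (t :: l) List.suffix_rfl) hB
      (ih fun k hk => hC k (hk.trans (List.suffix_cons t l)))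

theorem runs_mapM_mem {α : Type} {G : Netlist} {f : α → Build Wire} [∀ a, Mono (f a)] {l : List α}
    {bs : List Wire} (h : Runs G (l.mapM f) bs) :
    bs.length = l.length ∧ ∀ b ∈ bs, ∃ a ∈ l, Runs G (f a) b := by
  have h1 := h.mapM
  refine ⟨h1.length_eq.symm, fun b hb => ?_⟩
  obtain ⟨i, hi, rfl⟩ := List.mem_iff_getElem.1 hb
  exact ⟨_, List.getElem_mem _, h1.get (h1.length_eq ▸ hi) hi⟩

/-- The wires of the self-reducibility formula for a correct circuit with description `δ`, together
with their values in case that `P = 2 ^ (n - 2)` and `b = 0`. -/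
structure SelfWires (n q g s : ℕ) (xs : List (List Bool)) (δ : List Bool) where
  /-- the netlist -/
  net : Netlist
  /-- the output -/
  out : Wire
  /-- the premise -/
  prem : Wire
  /-- the test `b ∈ G` -/
  inG : Wire
  /-- the conjunction of the premise and `b ∈ G` -/
  hyp : Wire
  /-- the conclusion -/
  concl : Wire
  /-- the tests of the reduction -/
  tests : List Wire
  /-- the exponents that are tried by the tests -/
  exps : Wire → List Wire
  /-- the values of the wires for `P = 2 ^ (n - 2)`, `δ` and `b = 0` -/
  v : ℕ → Bool
  inputs : net.inputs = 2 * n + descLen n s n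
  wf : net.WF
  size : net.gates.length ≤ selfCost n s xs.length
  out_lt : out < net.width
  formula : ∀ σ, (selfFormula n q g s xs).subst σ =
    imp (bigAnd (net.formulas.map (Formula.subst σ))) (σ out)
  cons : Cons v net
  vP : ∀ i < n, v i = (2 ^ (n - 2)).testBit i
  vd : ∀ i < descLen n s n, v (2 * n + i) = δ.getD i false
  runPrem : Runs net (premWire n q g s xs (List.range n)
    ((List.range (descLen n s n)).map (2 * n + ·))) prem
  runG : Runs net (inGroup n q ((List.range n).map (n + ·))) inG
  runConcl : Runs net (conclWire n xs.length (List.range n) tests) concl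
  hasHyp : net.Has hyp ⟨fun x y => x && y, prem, inG⟩
  hasOut : net.Has out ⟨fun x y => !x || y, hyp, concl⟩
  length : tests.length = xs.length
  v_prem : v prem = true
  v_concl : v concl = false
  v_tests : ∀ t ∈ tests, v t = false
  exps_spec : ∀ t ∈ tests, t < net.width ∧ Bd net.width n (exps t) ∧ ∃ y e i,
    Runs net (powMod n q g (exps t)) y ∧ Runs net (eqList y ((List.range n).map (n + ·))) e ∧
      net.Has t ⟨fun x y => x && y, i, e⟩

/-- The premise holds by `Fools.quarter`. The conclusion fails since all tests fail for `b = 0`, while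
`P / 2 ^ (n + 1) - 3 / (2 n) = 1 / 8 - 3 / (2 n)` is positive for `n ≥ 13`. -/
theorem exists_selfWires {n q g s : ℕ} (hn : 13 ≤ n)
    (hqn : q ≤ 2 ^ n) (hqn' : 2 ^ (n - 1) < q) (hg : IsGen q g) {xs : List (List Bool)}
    (hxs : Fools n (testCost n s) xs) (hT : xs ≠ []) {δ : List Bool}
    (hδ : δ.length = descLen n s n)
    (hC : ∀ z, 0 < z → z < q → g ^ ofBits ((decodeCircuit n s n δ).eval (bits n z)) % q = z) :
    Nonempty (SelfWires n q g s xs δ) := by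
  have hn0 : 0 < n := by omega
  set P := 2 ^ (n - 2) with hP
  set G₁ := selfNet n q g s xs with hG₁
  obtain ⟨hin, hwf, hsize, hout⟩ := selfNet_spec (s := s) q g hxs.1 hn0
  rw [← hG₁] at hin hwf hsize hout
  have hW₁ : G₁.width = 2 * n + descLen n s n + G₁.gates.length := by rw [Netlist.width, hin]
  obtain ⟨v, hv, hvP, hvb, hvd⟩ := exists_valuation (s := s) q g hxs.1 hn0 P hδ
  rw [← hG₁] at hv
  set Pw := List.range n with hPw
  set bw := (List.range n).map (n + ·) with hbw
  set dw := (List.range (descLen n s n)).map (2 * n + ·) with hdw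
  have hPl : Pw.length = n := by simp [hPw]
  have hbl : bw.length = n := by simp [hbw]
  have hdl : dw.length = descLen n s n := by simp [hdw]
  have hbits : val v bw = 0 := by
    have h1 : bw.map v = bits n 0 := by
      rw [hbw, bits, List.map_map]
      refine List.map_congr_left fun i hi => ?_
      simpa using hvb i (List.mem_range.1 hi)
    rw [val, h1, ofBits_bits, Nat.zero_mod]
  have hvalP : val v Pw = 2 ^ (n - 2) := by
    have h1 : Pw.map v = bits n P := List.map_congr_left fun i hi => hvP i (List.mem_range.1 hi)
    rw [val, h1, ofBits_bits, Nat.mod_eq_of_lt (Nat.pow_lt_pow_right one_lt_two (by omega))]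
  have hdesc : dw.map v = δ := by
    apply List.ext_getElem (by simp [hdl, hδ])
    intro i h1 h2
    have := hvd i (by omega)
    simp only [hdw, List.map_map, List.getElem_map, List.getElem_range, Function.comp]
    rw [this, List.getD_eq_getElem _ _ h2]
  have hdG : ∀ w ∈ dw, w < G₁.width := fun w hw => by
    obtain ⟨i, hi, rfl⟩ := List.mem_map.1 hw
    rw [List.mem_range] at hi
    omega
  have hbG : ∀ w ∈ bw, w < G₁.width := fun w hw => by
    obtain ⟨i, hi, rfl⟩ := List.mem_map.1 hw
    rw [List.mem_range] at hi
    omega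
  -- the wires of the self-reducibility formula
  have hrun : Runs G₁ (selfBody n q g s xs Pw bw dw) (selfOut n q g s xs) := runs_self _ _
  obtain ⟨p, hp, hrun⟩ := hrun.bind
  obtain ⟨i, hi, hrun⟩ := hrun.bind
  obtain ⟨tests, htests, hrun⟩ := hrun.bind
  obtain ⟨c, hc, hrun⟩ := hrun.bind
  obtain ⟨h, hh, hrun⟩ := hrun.bind
  have hh := hh.emit
  have ho := hrun.emit
  obtain ⟨htl, htm⟩ := runs_mapM_mem htests
  have hvp : v p = true := by
    rw [hv.premWire hn0 hqn hg.lt.1 hg.lt.2 hxs.1 Pw dw hPl hdl p hp, hvalP, hdesc,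
      decide_eq_true_eq]
    exact hxs.quarter (by omega) hqn hqn' hg δ hδ hC
  have hvt : ∀ t ∈ tests, v t = false := by
    intro t ht
    obtain ⟨x, hx, hr⟩ := htm t ht
    exact Sem.bind (Q := fun _ => True) (fun _ _ => trivial) (fun r _ =>
      hv.reducedTest_zero hqn hg dw bw r hbl hbits) t hr
  have hvc : v c = false := by
    have h1 : tests.countP v = 0 := List.countP_eq_zero.2 fun t ht => by simp [hvt t ht]
    rw [hv.conclWire Pw tests hPl htl c hc, hvalP, h1, decide_eq_false_iff_not]
    have h2 : 0 < xs.length := List.length_pos_iff.2 hT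
    obtain ⟨m, rfl⟩ := Nat.exists_eq_add_of_le' (show 2 ≤ n by omega)
    have h3 : 2 ^ (m + 2) = 4 * 2 ^ m := by ring
    have h4 : 0 < xs.length * 2 ^ m := by positivity
    rw [show m + 2 - 2 = m by omega, h3]
    nlinarith
  -- the exponents that the tests try out
  have hexp : ∀ t, ∃ a : List ℕ, t ∈ tests → t < G₁.width ∧ Bd G₁.width n a ∧ ∃ y e i,
      Runs G₁ (powMod n q g a) y ∧ Runs G₁ (eqList y bw) e ∧
        G₁.Has t ⟨fun x y => x && y, i, e⟩ := by
    intro t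
    by_cases ht : t ∈ tests
    · obtain ⟨x, hx, hr⟩ := htm t ht
      obtain ⟨h1, a, h2, h3⟩ := exists_exponent hv hn0 hqn hg hdl hbl hbits hdG hbG (hxs.1 x hx) hr
      exact ⟨a, fun _ => ⟨h1, h2, h3⟩⟩
    · exact ⟨[], fun h => absurd h ht⟩
  choose f hf using hexp
  exact ⟨⟨G₁, _, p, i, h, c, tests, f, v, hin, hwf, hsize, hout, selfFormula_subst n q g s xs, hv,
    hvP, hvd, hp, hi, hc, hh, ho, htl, hvp, hvc, hvt, hf⟩⟩

/-- For a circuit, described by `δ`, that solves the discrete logarithm problem, the instance of the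
self-reducibility formula for `δ` implies the correctness of the circuit that tries out all outputs
of the generator; and this has a short derivation. It is by case distinction on the first successful
test. The substitution of variables for variables, `ρ`, makes the formula speak about the gates of the
circuit. -/
theorem exists_derivation {F : FregeSystem} {K : ℕ} (hK : ∀ s ≥ 1, ∀ (Γ : Set Formula)
    (U : Finset Formula), Logic U s (Reach F (K * s) Γ U)) {n q g s : ℕ} (hn : 13 ≤ n)
    (hqn : q ≤ 2 ^ n) (hqn' : 2 ^ (n - 1) < q) (hg : IsGen q g) {xs : List (List Bool)}
    (hxs : Fools n (testCost n s) xs) (hT : xs ≠ []) {δ : List Bool}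
    (hδ : δ.length = descLen n s n)
    (hC : ∀ z, 0 < z → z < q → g ^ ofBits ((decodeCircuit n s n δ).eval (bits n z)) % q = z) :
    ∃ (D : Circuit) (ρ : ℕ → ℕ), D.WF n n ∧
      D.size ≤ 2 + selfCost n s xs.length + (xs.length * (3 * n) + n) ∧
      Drv F (drvCost K (n + D.size + dlogCost n) xs.length)
        {(selfFormula n q g s xs).subst fun i => var (ρ i)} (dlogFormula n q g D) := by
  have hn0 : 0 < n := by omega
  obtain ⟨G₁, o, p, i, h, c, tests, f, v, hin, hwf, hsize, hout, hform, hv, hvP, hvd, hp, hi, hc,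
    hh, ho, htl, hvp, hvc, hvt, hf⟩ := exists_selfWires hn hqn hqn' hg hxs hT hδ hC
  have hW₁ : G₁.width = 2 * n + descLen n s n + G₁.gates.length := by rw [Netlist.width, hin]
  set ρ := rename n s (2 ^ (n - 2)) δ with hρ
  set Pw := List.range n with hPw
  set bw := (List.range n).map (n + ·) with hbw
  set dw := (List.range (descLen n s n)).map (2 * n + ·) with hdw
  have hdl : dw.length = descLen n s n := by simp [hdw]
  -- the circuit evaluates the formula for `P = 2 ^ (n - 2)` and the given `δ`, and then outputs the
  -- exponent tried by the first test of the reduction that succeeds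
  set B := baseNet n ρ G₁ with hB
  have hBW : B.width = n + (2 + G₁.gates.length) := baseNet_width _
  have hρB : ∀ w < G₁.width, ρ w < B.width := fun w hw => by
    rw [hBW]; exact rename_lt (hW₁ ▸ hw)
  set ts := tests.map fun t => (ρ t, (f t).map ρ) with hts
  have hfB : ∀ t ∈ tests, Bd B.width n ((f t).map ρ) := fun t ht => by
    obtain ⟨-, h2, -⟩ := hf t ht
    refine ⟨by simp [h2.1], fun w hw => ?_⟩
    obtain ⟨u, hu, rfl⟩ := List.mem_map.1 hw
    exact hρB u (h2.2 u hu)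
  obtain ⟨D, hDwf, hDsize, hBD, hsel⟩ : ∃ D : Circuit, D.WF n n ∧
      D.size ≤ B.gates.length + (ts.length * (3 * n) + n) ∧ B.Le ⟨n, D.gates⟩ ∧
      Runs ⟨n, D.gates⟩ (selectOut n ts) D.outs := ⟨_, dlogCircuit_spec (B := B) (n := n) (ts := ts)
    (baseNet_wf hn0 hin hwf) rfl hn0 (by
      intro u hu
      obtain ⟨t, ht, rfl⟩ := List.mem_map.1 hu
      exact ⟨hρB t (hf t ht).1, hfB t ht⟩)⟩
  refine ⟨D, ρ, hDwf, ?_, ?_⟩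
  · have h1 : B.gates.length = 2 + G₁.gates.length := by
      simp only [Netlist.width, hB, baseNet] at hBW ⊢
      omega
    rw [h1, hts, List.length_map, htl] at hDsize
    omega
  obtain ⟨hGW, hGo⟩ := hDwf.dlogNet_width hn0 q g
  set G := dlogNet n q g D with hG
  have hBG : B.Le G := hBD.trans (dlogNet_le n q g D)
  have hBGw := hBG.width_le
  have hsel : Runs G (selectOut n ts) D.outs := by
    obtain ⟨u, h1, h2⟩ := hsel
    exact ⟨u, h1, h2.trans (dlogNet_le n q g D)⟩
  have hρG : ∀ p g, G₁.Has p g → G.Has (ρ p) ⟨g.op, ρ g.left, ρ g.right⟩ := fun p g hp =>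
    hBG.has (baseNet_has hin hp)
  have hconst : ∀ β : Bool, G.Has (n + β.toNat) ⟨fun _ _ => β, 0, 0⟩ := fun β =>
    hBG.has (baseNet_const n ρ G₁ β)
  obtain ⟨y', hy', hrun'⟩ := (dlogNet_runs n q g D).bind
  obtain ⟨e', he', hrun'⟩ := hrun'.bind
  obtain ⟨i', hi', hrun'⟩ := hrun'.bind
  have ho' := hrun'.emit
  rw [← hG] at hy' he' hi' ho'
  -- the gates of the formula are among those of the circuit, so the instance of the formula says that
  -- its output is true
  set σ : ℕ → Formula := fun i => var (ρ i) with hσ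
  set L := G₁.formulas.map (Formula.subst σ) with hL
  have hLG : ∀ A ∈ L, A ∈ G.formulas := by
    intro A hA
    obtain ⟨A', hA', rfl⟩ := List.mem_map.1 hA
    obtain ⟨p, g, hp, rfl⟩ := mem_formulas.1 hA'
    rw [subst_gateFormula]
    exact mem_formulas.2 ⟨_, _, hρG p g hp, rfl⟩
  have hLlen : L.length ≤ G.gates.length := by
    rw [hL, List.length_map, Netlist.length_formulas]
    have h1 := hBG.2.length_le
    simp only [hB, baseNet, List.length_cons, List.length_map] at h1
    omega
  obtain ⟨C, V, m, R, hA, hΓ, hdrv, hVG, hVL, hCt⟩ := exists_arena hK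
    {(selfFormula n q g s xs).subst σ} G ρ tests L hLG hLlen
  set H := bigAnd G.formulas with hH
  suffices hmain : R (dlogFormula n q g D) by
    obtain ⟨l, h1, h2, h3⟩ := hdrv _ hmain
    refine ⟨l, h1, h2, h3.trans ?_⟩
    rw [htl]
    unfold drvCost
    gcongr
  rw [dlogFormula_eq, ← hG, ← hH]
  set o' := dlogOut n q g D with hodef'
  have hHC : H ∈ C := (hCt [] (List.nil_suffix)).1
  have hGV : ∀ A ∈ G.formulas, A ∈ V := hA.gates
  have hHF : Arena.Facts G R H := fun p g hp =>
    hA.of_bigAnd hHC hVG hGV (hA.logic.refl (hA.sizeC _ hHC) (hA.mem hHC (hA.sub hHC))) _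
      (mem_formulas.2 ⟨p, g, hp, rfl⟩)
  have hρo : ρ o < G.width := (hρB o hout).trans_le hBGw
  have hoV : lit (var (ρ o)) true ∈ V := hA.lit _ hρo _
  have hax : R (imp H (lit (var (ρ o)) true)) := by
    refine hA.logic.cut (hA.sizeC _ hHC) (hA.sizeV _ (hVL L List.suffix_rfl)) (hA.sizeV _ hoV)
      (hA.mem hHC hoV) (hA.to_bigAnd hHC hVL (fun A h => hGV A (hLG A h)) fun A h => ?_)
      (hΓ _ ?_)
    · obtain ⟨p, g, hp, rfl⟩ := mem_formulas.1 (hLG A h)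
      exact hHF p g hp
    · rw [Set.mem_singleton_iff, hform]
      rfl
  have hbequiv : ∀ X ∈ C, Forall₂ (fun p p' => Arena.Equiv G R X (ρ p) p') bw (List.range n) := by
    intro X hX
    rw [hbw, List.forall₂_map_left_iff, List.forall₂_same]
    intro j hj
    rw [List.mem_range] at hj
    have e : ρ (n + j) = j := by
      rw [hρ, rename, if_neg (by omega), if_pos (by omega)]; omega
    rw [e]
    exact hA.equiv_refl hX (by omega)
  have hrV : lit (var o') true ∈ V := hA.lit _ hGo _
  refine hA.first_hit (n := n) (tests := tests) (f := f) (ρ := ρ) (H := H) (outs := D.outs)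
    (l := []) (ts := tests) (B := lit (var o') true) hrV
    (fun t ht => (hρB t (hf t ht).1).trans_le hBGw) (fun t ht => (hfB t ht).le hBGw) hCt ?_ ?_
    (by simp) hsel hHF ?_ (by simp)
  · -- No test succeeds. The premise does not depend on `b` and the conclusion depends only on the
    -- values of the tests, so both have the same values as for `b = 0`, and these can be derived gate
    -- by gate. As the premise is true and the conclusion is false, the formula implies `b ∉ G`.
    intro hF htf
    set X := failCtx ρ H tests.reverse with hXdef
    have hX : X ∈ C := (hCt _ List.suffix_rfl).1
    have hXs := hA.sizeC _ hX
    have hknown := hA.closed_known hX hF hρG hv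
    have hin : ∀ w, ρ w = n + (v w).toNat → R (imp X (lit (var (ρ w)) (v w))) := by
      intro w hw
      rw [hw]
      exact hA.logic.const hXs (hA.mem hX (hA.lit _ (hconst _).lt _)) (hF _ _ (hconst _))
    have hinP : Forall₂ (fun p p' => R (imp X (lit (var (ρ p)) (v p))) ∧
        R (imp X (lit (var (ρ p')) (v p')))) Pw Pw := by
      rw [List.forall₂_same]
      intro w hw
      rw [List.mem_range] at hw
      have := hin w (by rw [hvP w hw, hρ, rename, if_pos hw])
      exact ⟨this, this⟩
    have hind : Forall₂ (fun p p' => R (imp X (lit (var (ρ p)) (v p))) ∧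
        R (imp X (lit (var (ρ p')) (v p')))) dw dw := by
      rw [List.forall₂_same]
      intro w hw
      obtain ⟨j, hj, rfl⟩ := List.mem_map.1 hw
      rw [List.mem_range] at hj
      have := hin (2 * n + j) (by
        rw [hvd j hj, hρ, rename, if_neg (by omega), if_neg (by omega), if_pos (by omega),
          Nat.add_sub_cancel_left])
      exact ⟨this, this⟩
    have hint : Forall₂ (fun p p' => R (imp X (lit (var (ρ p)) (v p))) ∧
        R (imp X (lit (var (ρ p')) (v p')))) tests tests := by
      rw [List.forall₂_same]
      intro t ht
      rw [hvt t ht]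
      exact ⟨htf t ht, htf t ht⟩
    have h1 := (hknown.premWire (fun x hx h0 => by
      have := hxs.1 x hx
      rw [h0] at this
      simp at this
      omega) hinP hind hdl.ge p p hp hp).1
    have h2 := (hknown.conclWire xs.length hinP hint c c hc hc).1
    rw [hvp] at h1
    rw [hvc] at h2
    have h3 := hA.lift_failCtx (l := tests.reverse) (ρ := ρ) hoV (fun k hk => (hCt k hk).1) hax
    have h4 := (hA.closed_equiv hX hF hρG).inGroup n q (hbequiv X hX) i i' hi hi'
    have h5 : R (imp X (lit (var (ρ i)) false)) := hA.logic.refute hXs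
      (hA.mem hX (hA.lit _ h4.1 _)) (hF _ _ (hρG _ _ hh)) (hF _ _ (hρG _ _ ho)) h1 h2 h3
    exact hA.logic.impGate hXs (hA.mem hX hrV) (hF _ _ ho') (.inl (hA.transfer hX h4 h5))
  · -- The test `t` succeeds, and the circuit outputs the exponent `a` that it has tried. The test
    -- and the goal evaluate `g ^ a = b` by equal circuits on equivalent inputs.
    intro X hX hF t ht hrt hro
    have hXs := hA.sizeC _ hX
    obtain ⟨-, -, y, e, i, hy, he, hti⟩ := hf t ht
    have hequiv := hA.closed_equiv hX hF hρG
    have h1 := hequiv.powMod n q g (List.forall₂_map_left_iff.1 hro) y y' hy hy'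
    have h2 := hequiv.eqList h1 (hbequiv X hX) e e' he he'
    have h3 : R (imp X (lit (var (ρ e)) true)) := hA.logic.andGate hXs
      (hA.mem hX (hA.lit _ h2.1 _)) (hF _ _ (hρG _ _ hti)) hrt
    exact hA.logic.impGate hXs (hA.mem hX hrV) (hF _ _ ho') (.inr (hA.transfer hX h2 h3))
  · rw [List.forall₂_same]
    intro w hw
    refine hA.equiv_refl hHC ?_
    have h1 := hDwf.2.2 w hw
    exact h1.trans_le (dlogNet_le n q g D).width_le

/-! ### The bounds on the size of the circuit and of the proof -/

theorem size_selfFormula {n q g s : ℕ} {xs : List (List Bool)} (hxs : ∀ x ∈ xs, x.length = n)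
    (hn : 0 < n) : (selfFormula n q g s xs).size ≤ 56 * selfCost n s xs.length + 3 := by
  obtain ⟨-, -, h1, -⟩ := selfNet_spec (s := s) q g hxs hn
  have h2 : (bigAnd (selfNet n q g s xs).formulas).size ≤ _ := size_bigAnd fun A hA => by
    obtain ⟨p, g, -, rfl⟩ := mem_formulas.1 hA
    exact size_gateFormula p g
  rw [Netlist.length_formulas] at h2
  have h3 : (selfFormula n q g s xs).size = (bigAnd (selfNet n q g s xs).formulas).size + 1 + 1 := by
    rw [selfFormula_eq, toFormula_eq]
    rfl
  omega

/-- A bound on the size of the circuit. -/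
def circuitBound (n s T : ℕ) : ℕ := 2 + selfCost n s T + (T * (3 * n) + n)

/-- A bound on the size of the proof. -/
def proofBound (K n s T : ℕ) : ℕ :=
  56 * selfCost n s T + 3 + 2 * n * (1 + (n + 1) + (n + 1) + n * (1 + (n + 1))) +
    drvCost K (n + circuitBound n s T + dlogCost n) T

theorem drvCost_mono (K : ℕ) {W W' : ℕ} (h : W ≤ W') (T : ℕ) : drvCost K W T ≤ drvCost K W' T := by
  unfold drvCost
  gcongr

namespace PolyBounded

variable {f g : ℕ → ℕ}

theorem selfCost (hf : PolyBounded f) (hg : PolyBounded g) :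
    PolyBounded fun n => selfCost n (f n) (g n) := by
  have hw : PolyBounded fun n => 2 * n + Nat.size (g n) + 4 :=
    (((const 2).mul id).add hg.size).add (const 4)
  have hw' : PolyBounded fun n => 10 * (2 * n + Nat.size (g n) + 4) + 2 :=
    ((const 10).mul hw).add (const 2)
  exact (((((((const 2).mul (hg.mul hf.testCost)).add
    ((const 2).mul ((hg.mul ((const 6).mul hw)).add hw))).add
    ((const 2).mul ((hw.mul hw').add hw))).add ((const 2).mul ((id.mul hw').add hw))).add
    ((const 18).mul hw)).add ((const 8).mul id)).add (const 30)

theorem circuitBound (hf : PolyBounded f) (hg : PolyBounded g) :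
    PolyBounded fun n => circuitBound n (f n) (g n) :=
  ((const 2).add (hf.selfCost hg)).add ((hg.mul ((const 3).mul id)).add id)

theorem dlogCost : PolyBounded dlogCost :=
  (((((id.mul (((const 66).mul (id.pow 2)).add ((const 78).mul id))).add id).add
    (((const 2).mul id).add (const 1))).add (((const 8).mul id).add (const 13))).add (const 1))

theorem drvCost (K : ℕ) (hf : PolyBounded f) (hg : PolyBounded g) :
    PolyBounded fun n => drvCost K (f n) (g n) :=
  ((((const 2).mul hg).add (const 2)).mul
    ((((hf.mul hf).add ((const 5).mul hf)).add ((const 2).mul hg)).add (const 4))).mul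
    ((const K).mul ((((const 56).mul hf).add ((const 3).mul hg)).add (const 2)))

theorem proofBound (K : ℕ) (hf : PolyBounded f) (hg : PolyBounded g) :
    PolyBounded fun n => proofBound K n (f n) (g n) :=
  ((((const 56).mul (hf.selfCost hg)).add (const 3)).add (((const 2).mul id).mul
    ((((const 1).add (id.add (const 1))).add (id.add (const 1))).add
      (id.mul ((const 1).add (id.add (const 1))))))).add
    (drvCost K ((id.add (hf.circuitBound hg)).add dlogCost) hg)

end PolyBounded

/-- A circuit that solves the discrete logarithm problem computes exponents of all members of the
group, as numbers. -/
theorem SolvesDlog.pow_mod {n q : ℕ} (hq : q.Prime) {u : (ZMod q)ˣ} {C : Circuit}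
    (h : SolvesDlog n q u C) {z : ℕ} (hz : 0 < z) (hzq : z < q) :
    (u : ZMod q).val ^ ofBits (C.eval (bits n z)) % q = z := by
  have := Fact.mk hq
  have hz0 : (z : ZMod q) ≠ 0 := by
    rw [Ne, ZMod.natCast_eq_zero_iff]
    exact fun hd => absurd (Nat.le_of_dvd hz hd) (by omega)
  have h1 := h (Units.mk0 _ hz0)
  rw [Units.val_mk0, ZMod.val_natCast_of_lt hzq] at h1
  rw [mod_eq_iff hzq]
  push_cast
  rw [ZMod.natCast_zmod_val]
  exact congrArg Units.val h1

theorem Line.correct_self {S : PSystem} (goal : Formula) {n q g : ℕ} {π : Cert} (hn : S.n₀ ≤ n)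
    (hqn' : 2 ^ (n - 1) < q) (hqn : q ≤ 2 ^ n) (hπ : π.Certifies q g) (σ : ℕ → Formula) :
    Line.Correct S goal [] ⟨(selfAxiom S.ε S.k S.c S.f n q g).subst σ, .self n q g π⟩ := by
  generalize hA : (selfAxiom S.ε S.k S.c S.f n q g).subst σ = A
  exact ⟨hn, hqn', hqn, hπ, σ, hA.symm⟩

/-- From `n₀` on, there are proofs of polynomial size. -/
theorem exists_short_proof {F : FregeSystem} {K : ℕ} (hK : ∀ s ≥ 1, ∀ (Γ : Set Formula)
    (U : Finset Formula), Logic U s (Reach F (K * s) Γ U)) {ε : ℝ} {f : List Bool → Bool}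
    {k c n₀ n q g : ℕ} (hn₀ : n₀ ≤ n) (hn : 13 ≤ n) (hqn : q ≤ 2 ^ n) (hqn' : 2 ^ (n - 1) < q)
    (hg : IsGen q g) (hxs : Fools n (testCost n (n ^ k)) (nwOutputs ε c f n)) {C : Circuit}
    (hC : C.WF n n) (hs : C.size ≤ n ^ k)
    (h : ∀ z, 0 < z → z < q → g ^ ofBits (C.eval (bits n z)) % q = z) :
    ∃ D : Circuit, D.WF n n ∧ D.size ≤ circuitBound n (n ^ k) (nwOutputs ε c f n).length ∧
      ∃ π, (PSystem.mk F ε f k c n₀).IsProof π (dlogFormula n q g D) ∧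
        proofSize π ≤ proofBound K n (n ^ k) (nwOutputs ε c f n).length := by
  have hn0 : 0 < n := by omega
  obtain ⟨δ, hδ, hδC⟩ := hC.exists_desc hn0 hs
  have hT : nwOutputs ε c f n ≠ [] := by simp [nwOutputs]
  obtain ⟨D, ρ, hD, hDs, hdrv⟩ := exists_derivation hK hn hqn hqn' hg hxs hT hδ fun z hz hzq => by
    rw [hδC _ (length_bits n z), h z hz hzq]
  obtain ⟨cert, hcert, hcs⟩ := hg.exists_small_cert hqn
  have hl := Line.correct_self (S := ⟨F, ε, f, k, c, n₀⟩) (dlogFormula n q g D) hn₀ hqn' hqn hcert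
    (fun i => var (ρ i))
  simp only [selfAxiom] at hl
  generalize nwOutputs ε c f n = xs at *
  obtain ⟨π, hπ, hπs⟩ := PSystem.exists_proof_of_line hl hdrv
  refine ⟨D, hD, hDs, π, hπ, hπs.trans ?_⟩
  have h1 : ((selfFormula n q g (n ^ k) xs).subst fun i => var (ρ i)).size ≤
      56 * selfCost n (n ^ k) xs.length + 3 :=
    ((size_subst_le le_rfl (fun i => le_rfl) _).trans_eq (mul_one _)).trans
      (size_selfFormula hxs.1 hn0)
  have h2 : drvCost K (n + D.size + dlogCost n) xs.length ≤
      drvCost K (n + circuitBound n (n ^ k) xs.length + dlogCost n) xs.length :=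
    drvCost_mono K (Nat.add_le_add_right (Nat.add_le_add_left hDs n) _) _
  exact Nat.add_le_add (Nat.add_le_add h1 hcs) h2

/-- Each single parameter has some proof, by completeness. -/
theorem exists_proof_bound (S : PSystem) (n q g : ℕ) : ∃ e : ℕ, IsGen q g → q ≤ 2 ^ n →
    (∃ C : Circuit, C.WF n n ∧ ∀ z, 0 < z → z < q → g ^ ofBits (C.eval (bits n z)) % q = z) →
    ∃ D : Circuit, D.WF n n ∧ D.size ≤ e ∧
      ∃ π, S.IsProof π (dlogFormula n q g D) ∧ proofSize π ≤ e := by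
  by_cases h : IsGen q g ∧ q ≤ 2 ^ n ∧
    ∃ C : Circuit, C.WF n n ∧ ∀ z, 0 < z → z < q → g ^ ofBits (C.eval (bits n z)) % q = z
  · obtain ⟨hg, hqn, C, hC, hz⟩ := h
    obtain ⟨π, hπ⟩ := S.exists_proof (dlogFormula_tautology hC hqn hg hz)
    exact ⟨C.size + proofSize π, fun _ _ _ => ⟨C, hC, by omega, π, hπ, by omega⟩⟩
  · exact ⟨0, fun h1 h2 h3 => absurd ⟨h1, h2, h3⟩ h⟩

end SelfProv

open SelfProv in
theorem theorem15 (F : FregeSystem) (k : ℕ) (ε : ℝ) (hε₀ : 0 < ε) (hε₁ : ε < 1)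
    (f : List Bool → Bool) (hf : InE f) (hard : HardOnAverage ε f) :
    ∃ c₀ : ℕ, ∀ c ≥ c₀, ∃ n₁ : ℕ, ∀ n₀ ≥ n₁,
      (∀ A : Formula, (∃ π, (PSystem.mk F ε f k c n₀).IsProof π A) ↔ A.Tautology) ∧
      ∃ e : ℕ, ∀ (n q : ℕ) (u : (ZMod q)ˣ), q.Prime → 2 ^ (n - 1) < q → q ≤ 2 ^ n →
        (∀ x : (ZMod q)ˣ, x ∈ Subgroup.zpowers u) →
        (∃ C : Circuit, C.WF n n ∧ C.size ≤ n ^ k ∧ SolvesDlog n q u C) →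
        ∃ D : Circuit, D.WF n n ∧ D.size ≤ e * n ^ e ∧
          ∃ π : List Line,
            (PSystem.mk F ε f k c n₀).IsProof π (dlogFormula n q (u : ZMod q).val D) ∧
            proofSize π ≤ e * n ^ e := by
  obtain ⟨c₀, hc₀⟩ := exists_fools hε₀ hard k
  obtain ⟨m₀, hm₀⟩ := Filter.eventually_atTop.1 hard
  refine ⟨c₀, fun c hc => ?_⟩
  obtain ⟨n₁, hn₁⟩ := hc₀ c hc
  refine ⟨n₁ + m₀ + 13, fun n₀ hn₀ => ?_⟩
  set S := PSystem.mk F ε f k c n₀ with hS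
  refine ⟨fun A => ⟨fun ⟨π, hπ⟩ => hπ.tautology (fun n hn => ?_) fun n q g hn hq hq' hg => ?_,
    fun h => S.exists_proof h⟩, ?_⟩
  · have hn : n₀ ≤ n := hn
    exact ttAxiom_tautology (by omega) (hm₀ n (by omega))
  · have hn : n₀ ≤ n := hn
    exact selfFormula_tautology (by omega) hq' hq hg (hn₁ n (by omega))
  obtain ⟨K, hK⟩ := F.exists_logic
  have hpoly := PolyBounded.id.pow k
  have hT := length_nwOutputs_poly ε c f
  obtain ⟨e₁, he₁⟩ := (hpoly.circuitBound hT).add (hpoly.proofBound K hT)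
  choose e₂ he₂ using exists_proof_bound S
  set E := ∑ n ∈ Finset.range n₀, ∑ q ∈ Finset.range (2 ^ n + 1), ∑ g ∈ Finset.range q, e₂ n q g
    with hE
  refine ⟨e₁ + E, fun n q u hq hqn' hqn hu ⟨C, hC, hCs, hCd⟩ => ?_⟩
  have hg : IsGen q (u : ZMod q).val := ⟨hq, u, rfl, hu⟩
  have hn1 : 1 ≤ n := by
    rcases Nat.eq_zero_or_pos n with rfl | h
    · simp only [pow_zero] at hqn
      have := hq.two_le
      omega
    · exact h
  have hcorrect := fun z (hz : 0 < z) (hzq : z < q) => hCd.pow_mod hq hz hzq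
  rcases Nat.lt_or_ge n n₀ with hlt | hge
  · -- there are finitely many triples `(n, q, g)` with `n < n₀`
    obtain ⟨D, hD, hDs, π, hπ, hπs⟩ := he₂ n q _ hg hqn ⟨C, hC, hcorrect⟩
    have hle : e₂ n q (u : ZMod q).val ≤ (e₁ + E) * n ^ (e₁ + E) := by
      calc e₂ n q (u : ZMod q).val ≤ ∑ g ∈ Finset.range q, e₂ n q g :=
            Finset.single_le_sum (f := fun g => e₂ n q g) (fun _ _ => Nat.zero_le _)
              (Finset.mem_range.2 hg.lt.2)
        _ ≤ ∑ q ∈ Finset.range (2 ^ n + 1), ∑ g ∈ Finset.range q, e₂ n q g :=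
            Finset.single_le_sum (f := fun q => ∑ g ∈ Finset.range q, e₂ n q g)
              (fun _ _ => Nat.zero_le _) (Finset.mem_range.2 (by omega))
        _ ≤ E := Finset.single_le_sum
              (f := fun n => ∑ q ∈ Finset.range (2 ^ n + 1), ∑ g ∈ Finset.range q, e₂ n q g)
              (fun _ _ => Nat.zero_le _) (Finset.mem_range.2 hlt)
        _ ≤ (e₁ + E) * 1 := by omega
        _ ≤ (e₁ + E) * n ^ (e₁ + E) := Nat.mul_le_mul_left _ (Nat.one_le_pow _ _ hn1)
    exact ⟨D, hD, hDs.trans hle, π, hπ, hπs.trans hle⟩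
  · obtain ⟨D, hD, hDs, π, hπ, hπs⟩ := exists_short_proof hK (n₀ := n₀) hge (by omega) hqn hqn' hg
      (hn₁ n (by omega)) hC hCs hcorrect
    have h1 := he₁ n hn1
    have hle : e₁ * n ^ e₁ ≤ (e₁ + E) * n ^ (e₁ + E) := by gcongr <;> omega
    exact ⟨D, hD, (Nat.le_of_add_right_le h1 |> hDs.trans).trans hle, π, hπ,
      (hπs.trans ((Nat.le_add_left _ _).trans h1)).trans hle⟩
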